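/- Let $T$ be a finite tree, let $\ell:V(T)\to\mathbb Z_{\ge 0}$ be a function, and let $\Gamma=(T,\ell)$ be the graph (a *bunch of grapes*) obtained by attaching $\ell(v)$ triangles ($3$-cycles) to each vertex $v$ of $T$. Assume that $\Gamma$ is a minimal simplicial model, i.e. $\ell(v)\ge 1$ whenever $v$ has valency $2$ in $T$, and that $\Gamma$ is *normal*: $\ell(v)>0$ for at least two distinct vertices $v$ of $T$, and $\ell(v)\ge 1$ for every leaf $v$ of $T$. Put $\ell(T)=\sum_{v\in V(T)}\ell(v)$. Let $UC_2(\Gamma)$ be the space of unordered pairs of distinct points of $\Gamma$ and let $\mathbb B_2(\Gamma)=\pi_1(UC_2(\Gamma))$ be the graph $2$-braid group. Let $UD_2(\Gamma)\subset UC_2(\Gamma)$ be the square complex whose cells are the unordered pairs of disjoint cells (vertices or edges) of $\Gamma$. A *standard product subcomplex* of $UD_2(\Gamma)$ is the image of a local isometry $\Gamma_1\times\Gamma_2\to UD_2(\Gamma)$, embedding a slice in each of the two directions, where $\Gamma_1,\Gamma_2$ are connected graphs with at least one edge and without vertices of valency $1$. Let $UP_2(\Gamma)$ be the union of all standard product subcomplexes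 that are maximal with respect to inclusion. Here a *local isometry* is a combinatorial map that is injective on the link of every vertex and maps it onto an induced subcomplex of the link of the image vertex, and a subcomplex is *locally convex* if its inclusion is a local isometry. Then: 1. $\Gamma$ has no vertex of valency $1$ and contains two disjoint cycles. The complex $UD_2(\Gamma)$ is compact, connected, non-positively curved and weakly special (no hyperplane intersects or osculates itself), and $UP_2(\Gamma)$ is nonempty and connected. 2. $UP_2(\Gamma)$ is locally convex in $UD_2(\Gamma)$. 3. The inclusion $\iota:UP_2(\Gamma)\to UD_2(\Gamma)$ induces an injective homomorphism $\iota_*$ on fundamental groups, and there is an integer $N\ge\ell(T)$ such that $$\pi_1(UD_2(\Gamma))\cong \operatorname{im}(\iota_*)*\mathbb F_N\qquad\text{and}\qquad \mathbb B_2(\Gamma)\cong\pi_1(UP_2(\Gamma))*\mathbb F_N,$$ where $\mathbb F_N$ is the free group of rank $N$. -/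

import Mathlib

universe u v

namespace GraphBraid

/-! ### Bunches of grapes -/

/-- Vertices of the bunch of grapes over a stem with vertex set `V`: the vertices of the stem, and
two further vertices for each of the `ℓ v` triangles attached at the stem vertex `v`. -/
abbrev GrapeVertex {V : Type u} (ℓ : V → ℕ) : Type u :=
  V ⊕ (Σ v : V, Fin (ℓ v) × Bool)

/-- The edges of a bunch of grapes (in one direction each, up to symmetry): the twigs (edges of the
stem), the two edges of each grape at its stem vertex, and the third edge of each grape. -/
inductive GrapeEdge {V : Type u} (T : SimpleGraph V) (ℓ : V → ℕ) :
    GrapeVertex ℓ → GrapeVertex ℓ → Prop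
  | twig (v w : V) : T.Adj v w → GrapeEdge T ℓ (Sum.inl v) (Sum.inl w)
  | side (v : V) (i : Fin (ℓ v)) (b : Bool) : GrapeEdge T ℓ (Sum.inl v) (Sum.inr ⟨v, (i, b)⟩)
  | cap (v : V) (i : Fin (ℓ v)) :
      GrapeEdge T ℓ (Sum.inr ⟨v, (i, false)⟩) (Sum.inr ⟨v, (i, true)⟩)

/-- The bunch of grapes `(T, ℓ)`: attach `ℓ v` triangles to each vertex `v` of `T`. -/
def bunch {V : Type u} (T : SimpleGraph V) (ℓ : V → ℕ) : SimpleGraph (GrapeVertex ℓ) :=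
  SimpleGraph.fromRel (GrapeEdge T ℓ)

/-- `(T, ℓ)` is a normal bunch of grapes. The field `minimal` is the standing assumption that a
bunch of grapes is a minimal simplicial model. -/
structure IsNormalBunch {V : Type u} (T : SimpleGraph V) (ℓ : V → ℕ) : Prop where
  tree : T.IsTree
  minimal : ∀ v, (T.neighborSet v).ncard = 2 → 1 ≤ ℓ v
  large : ∃ v₁ v₂, v₁ ≠ v₂ ∧ 0 < ℓ v₁ ∧ 0 < ℓ v₂
  leaf : ∀ v, (T.neighborSet v).ncard = 1 → 1 ≤ ℓ v

/-- A graph without vertices of valency one. -/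
def Leafless {W : Type u} (G : SimpleGraph W) : Prop :=
  ∀ v, ¬ ∃! w, G.Adj v w

/-- The graph contains two cycles without a common vertex. -/
def HasDisjointCycles {W : Type u} (G : SimpleGraph W) : Prop :=
  ∃ (a b : W) (p : G.Walk a a) (q : G.Walk b b),
    p.IsCycle ∧ q.IsCycle ∧ List.Disjoint p.support q.support

/-! ### Square complexes -/

/-- A (combinatorial) square complex whose edges are determined by their two distinct end points and
whose squares are determined by their boundary 4-cycles. `IsSquare x y z w` says that the 4-cycle
`x, y, z, w` (in this cyclic order) bounds a square. -/
structure SquareComplex (X : Type u) where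
  verts : Set X
  Adj : X → X → Prop
  IsSquare : X → X → X → X → Prop
  adj_symm : ∀ {x y}, Adj x y → Adj y x
  adj_ne : ∀ {x y}, Adj x y → x ≠ y
  adj_mem : ∀ {x y}, Adj x y → x ∈ verts
  square_adj : ∀ {x y z w}, IsSquare x y z w → Adj x y
  square_ne : ∀ {x y z w}, IsSquare x y z w → x ≠ z
  square_rotate : ∀ {x y z w}, IsSquare x y z w → IsSquare y z w x
  square_reflect : ∀ {x y z w}, IsSquare x y z w → IsSquare x w z y

namespace SquareComplex

variable {X : Type u} {Y : Type v}

/-- `K.IsSubcomplex L`: every cell of `K` is a cell of `L`. -/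
structure IsSubcomplex (K L : SquareComplex X) : Prop where
  verts : ∀ {x}, x ∈ K.verts → x ∈ L.verts
  adj : ∀ {x y}, K.Adj x y → L.Adj x y
  square : ∀ {x y z w}, K.IsSquare x y z w → L.IsSquare x y z w

/-- The union of a family of square complexes with vertices in `X`. -/
def union (S : Set (SquareComplex X)) : SquareComplex X where
  verts := {x | ∃ K ∈ S, x ∈ K.verts}
  Adj x y := ∃ K ∈ S, K.Adj x y
  IsSquare x y z w := ∃ K ∈ S, K.IsSquare x y z w
  adj_symm := fun ⟨K, hK, h⟩ => ⟨K, hK, K.adj_symm h⟩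
  adj_ne := fun ⟨K, _, h⟩ => K.adj_ne h
  adj_mem := fun ⟨K, hK, h⟩ => ⟨K, hK, K.adj_mem h⟩
  square_adj := fun ⟨K, hK, h⟩ => ⟨K, hK, K.square_adj h⟩
  square_ne := fun ⟨K, _, h⟩ => K.square_ne h
  square_rotate := fun ⟨K, hK, h⟩ => ⟨K, hK, K.square_rotate h⟩
  square_reflect := fun ⟨K, hK, h⟩ => ⟨K, hK, K.square_reflect h⟩

/-- Adjacency in the link of the vertex `x`. The vertices of the link are the edges at `x`, hence
the neighbours of `x`; two of them are joined in the link by the squares that contain both. -/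
def LinkAdj (K : SquareComplex X) (x y z : X) : Prop :=
  ∃ w, K.IsSquare x y w z

/-- Non-positive curvature: every vertex link is a flag simplicial complex, that is (the dimension
being at most two), it has no multiple edges and no triangles. -/
def IsNPC (K : SquareComplex X) : Prop :=
  (∀ x y z w w', K.IsSquare x y w z → K.IsSquare x y w' z → w = w') ∧
  (∀ x y z t, K.LinkAdj x y z → K.LinkAdj x z t → ¬ K.LinkAdj x y t)

/-- Two edges are parallel if they are joined by a chain of squares, consecutive edges of the chain
being opposite edges of a square. -/
def Parallel (K : SquareComplex X) : Sym2 X → Sym2 X → Prop :=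
  Relation.EqvGen fun e e' => ∃ x y z w, K.IsSquare x y z w ∧ e = s(x, y) ∧ e' = s(w, z)

/-- No hyperplane intersects or osculates itself: two distinct edges with a common end point,
whether they are consecutive in a square (self-intersection) or not (self-osculation), are never
parallel. -/
def IsWeaklySpecial (K : SquareComplex X) : Prop :=
  ∀ x y z, K.Adj x y → K.Adj x z → K.Parallel s(x, y) s(x, z) → y = z

/-- A map on vertices that carries each cell of `K` isomorphically onto a cell of `L`. -/
structure IsCombinatorial (K : SquareComplex X) (L : SquareComplex Y) (f : X → Y) : Prop where
  verts : ∀ {x}, x ∈ K.verts → f x ∈ L.verts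
  adj : ∀ {x y}, K.Adj x y → L.Adj (f x) (f y)
  square : ∀ {x y z w}, K.IsSquare x y z w → L.IsSquare (f x) (f y) (f z) (f w)

/-- A local isometry: on the link of every vertex the map is injective, and its image is an
induced subcomplex of the link of the image vertex. -/
structure IsLocalIsometry (K : SquareComplex X) (L : SquareComplex Y) (f : X → Y) : Prop
    extends IsCombinatorial K L f where
  link_injective : ∀ {x y z}, K.Adj x y → K.Adj x z → f y = f z → y = z
  link_induced : ∀ {x y z}, K.Adj x y → K.Adj x z →
    L.LinkAdj (f x) (f y) (f z) → K.LinkAdj x y z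

/-- The subcomplex `K` of `L` is locally convex: its inclusion is a local isometry. -/
def IsLocallyConvex (K L : SquareComplex X) : Prop :=
  K.IsSubcomplex L ∧ IsLocalIsometry K L id

/-- `P` is the image complex of `K` under `f`. -/
structure IsImage (K : SquareComplex X) (f : X → Y) (P : SquareComplex Y) : Prop where
  verts : ∀ p, p ∈ P.verts ↔ ∃ x ∈ K.verts, f x = p
  adj : ∀ p q, P.Adj p q ↔ ∃ x y, K.Adj x y ∧ f x = p ∧ f y = q
  square : ∀ p q r s, P.IsSquare p q r s ↔
    ∃ x y z w, K.IsSquare x y z w ∧ f x = p ∧ f y = q ∧ f z = r ∧ f w = s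

/-- The product of two graphs, as a square complex. -/
def prod {V₁ : Type u} {V₂ : Type v} (G₁ : SimpleGraph V₁) (G₂ : SimpleGraph V₂) :
    SquareComplex (V₁ × V₂) where
  verts := Set.univ
  Adj := (G₁.boxProd G₂).Adj
  IsSquare x y z w := ∃ a b c d, G₁.Adj a b ∧ G₂.Adj c d ∧
    ((x = (a, c) ∧ y = (b, c) ∧ z = (b, d) ∧ w = (a, d)) ∨
      (x = (a, c) ∧ y = (a, d) ∧ z = (b, d) ∧ w = (b, c)))
  adj_symm := fun h => h.symm
  adj_ne := fun h => h.ne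
  adj_mem := fun _ => Set.mem_univ _
  square_adj := by
    rintro x y z w ⟨a, b, c, d, h₁, h₂, ⟨rfl, rfl, rfl, rfl⟩ | ⟨rfl, rfl, rfl, rfl⟩⟩
    · simp [SimpleGraph.boxProd_adj, h₁]
    · simp [SimpleGraph.boxProd_adj, h₂]
  square_ne := by
    rintro x y z w ⟨a, b, c, d, h₁, h₂, ⟨rfl, rfl, rfl, rfl⟩ | ⟨rfl, rfl, rfl, rfl⟩⟩ <;>
    · intro h
      exact h₁.ne (Prod.ext_iff.1 h).1
  square_rotate := by
    rintro x y z w ⟨a, b, c, d, h₁, h₂, ⟨rfl, rfl, rfl, rfl⟩ | ⟨rfl, rfl, rfl, rfl⟩⟩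
    · exact ⟨b, a, c, d, h₁.symm, h₂, Or.inr ⟨rfl, rfl, rfl, rfl⟩⟩
    · exact ⟨a, b, d, c, h₁, h₂.symm, Or.inl ⟨rfl, rfl, rfl, rfl⟩⟩
  square_reflect := by
    rintro x y z w ⟨a, b, c, d, h₁, h₂, ⟨rfl, rfl, rfl, rfl⟩ | ⟨rfl, rfl, rfl, rfl⟩⟩
    · exact ⟨a, b, c, d, h₁, h₂, Or.inr ⟨rfl, rfl, rfl, rfl⟩⟩
    · exact ⟨a, b, c, d, h₁, h₂, Or.inl ⟨rfl, rfl, rfl, rfl⟩⟩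

/-- `P` is a standard product subcomplex of `L`: the image of a local isometry from a product of
two connected leafless graphs, each with at least one edge, that is injective on some slice in
each direction. (An edge of `L` has distinct end points and is determined by them, so graphs that
immerse in `L` are simple.) -/
def IsStandardProduct (L P : SquareComplex X) : Prop :=
  ∃ (V₁ V₂ : Type u) (G₁ : SimpleGraph V₁) (G₂ : SimpleGraph V₂) (f : V₁ × V₂ → X),
    (G₁.Connected ∧ (∃ a b, G₁.Adj a b) ∧ Leafless G₁) ∧
    (G₂.Connected ∧ (∃ a b, G₂.Adj a b) ∧ Leafless G₂) ∧
    IsLocalIsometry (prod G₁ G₂) L f ∧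
    (∃ v₂, Function.Injective fun a => f (a, v₂)) ∧
    (∃ v₁, Function.Injective fun b => f (v₁, b)) ∧
    IsImage (prod G₁ G₂) f P

/-- A maximal product subcomplex: a standard product subcomplex that is maximal with respect to
inclusion among the standard product subcomplexes. -/
def IsMaximalProduct (L M : SquareComplex X) : Prop :=
  IsStandardProduct L M ∧
    ∀ P, IsStandardProduct L P → M.IsSubcomplex P → P.IsSubcomplex M

/-- The union of all maximal product subcomplexes. -/
def maxUnion (L : SquareComplex X) : SquareComplex X :=
  union {M | IsMaximalProduct L M}

end SquareComplex

/-! ### Discrete configuration spaces -/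

/-- The unordered discrete 2-configuration space: its cells are the unordered pairs of disjoint
cells (vertices or edges) of the graph. -/
def UD₂ {W : Type u} (G : SimpleGraph W) : SquareComplex (Sym2 W) where
  verts := {p | ∃ v w, v ≠ w ∧ p = s(v, w)}
  Adj p q := ∃ a b v, G.Adj a b ∧ v ≠ a ∧ v ≠ b ∧ p = s(a, v) ∧ q = s(b, v)
  IsSquare p q r t := ∃ a b c d, G.Adj a b ∧ G.Adj c d ∧ a ≠ c ∧ a ≠ d ∧ b ≠ c ∧ b ≠ d ∧
    p = s(a, c) ∧ q = s(b, c) ∧ r = s(b, d) ∧ t = s(a, d)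
  adj_symm := fun ⟨a, b, v, h, ha, hb, hp, hq⟩ => ⟨b, a, v, h.symm, hb, ha, hq, hp⟩
  adj_ne := by
    rintro p q ⟨a, b, v, h, ha, hb, rfl, rfl⟩ heq
    rcases Sym2.eq_iff.1 heq with ⟨h1, _⟩ | ⟨h1, _⟩
    · exact h.ne h1
    · exact ha h1.symm
  adj_mem := fun ⟨a, _, v, _, ha, _, hp, _⟩ => ⟨a, v, ha.symm, hp⟩
  square_adj := fun ⟨a, b, c, _, h₁, _, hac, _, hbc, _, hp, hq, _, _⟩ =>
    ⟨a, b, c, h₁, hac.symm, hbc.symm, hp, hq⟩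
  square_ne := by
    rintro p q r t ⟨a, b, c, d, h₁, h₂, hac, had, hbc, hbd, rfl, rfl, rfl, rfl⟩ heq
    rcases Sym2.eq_iff.1 heq with ⟨h1, _⟩ | ⟨h1, _⟩
    · exact h₁.ne h1
    · exact had h1
  square_rotate := by
    rintro p q r t ⟨a, b, c, d, h₁, h₂, hac, had, hbc, hbd, rfl, rfl, rfl, rfl⟩
    exact ⟨c, d, b, a, h₂, h₁.symm, hbc.symm, hac.symm, hbd.symm, had.symm,
      Sym2.eq_swap, Sym2.eq_swap, Sym2.eq_swap, Sym2.eq_swap⟩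
  square_reflect := by
    rintro p q r t ⟨a, b, c, d, h₁, h₂, hac, had, hbc, hbd, rfl, rfl, rfl, rfl⟩
    exact ⟨c, d, a, b, h₂, h₁, hac.symm, hbc.symm, had.symm, hbd.symm,
      Sym2.eq_swap, Sym2.eq_swap, Sym2.eq_swap, Sym2.eq_swap⟩

/-- The union of the maximal product subcomplexes of `UD₂ G`. -/
def UP₂ {W : Type u} (G : SimpleGraph W) : SquareComplex (Sym2 W) :=
  (UD₂ G).maxUnion

/-- The maximal product subcomplexes are subcomplexes. -/
theorem UP₂_isSubcomplex {W : Type u} (G : SimpleGraph W) : (UP₂ G).IsSubcomplex (UD₂ G) where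
  verts := by
    rintro x ⟨M, ⟨⟨V₁, V₂, G₁, G₂, f, -, -, hf, -, -, hM⟩, -⟩, hx⟩
    obtain ⟨y, hy, rfl⟩ := (hM.verts x).1 hx
    exact hf.verts hy
  adj := by
    rintro x y ⟨M, ⟨⟨V₁, V₂, G₁, G₂, f, -, -, hf, -, -, hM⟩, -⟩, h⟩
    obtain ⟨x', y', h', rfl, rfl⟩ := (hM.adj x y).1 h
    exact hf.adj h'
  square := by
    rintro x y z w ⟨M, ⟨⟨V₁, V₂, G₁, G₂, f, -, -, hf, -, -, hM⟩, -⟩, h⟩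
    obtain ⟨x', y', z', w', h', rfl, rfl, rfl, rfl⟩ := (hM.square x y z w).1 h
    exact hf.square h'

/-! ### Topological realizations and the graph 2-braid group -/

noncomputable section

/-- The vertex `v` as a point of the geometric realization. -/
def pt {W : Type u} (v : W) : W → ℝ :=
  Set.indicator {v} fun _ => 1

/-- The geometric realization of a (finite, simple) graph: the union in `W → ℝ` of its vertices
and of the straight segments between adjacent vertices. -/
def Realization {W : Type u} (G : SimpleGraph W) : Type u :=
  {x : W → ℝ // ∃ a b, (a = b ∨ G.Adj a b) ∧ x ∈ segment ℝ (pt a) (pt b)}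

instance {W : Type u} (G : SimpleGraph W) : TopologicalSpace (Realization G) :=
  instTopologicalSpaceSubtype

/-- The ordered 2-configuration space of a topological space. -/
def OrderedConf (Z : Type u) : Type u :=
  {p : Z × Z // p.1 ≠ p.2}

instance (Z : Type u) [TopologicalSpace Z] : TopologicalSpace (OrderedConf Z) :=
  inferInstanceAs (TopologicalSpace {p : Z × Z // p.1 ≠ p.2})

/-- The orbits of the permutation action of the symmetric group on two letters. -/
def swapSetoid (Z : Type u) : Setoid (OrderedConf Z) where
  r p q := q = p ∨ (q.1.1 = p.1.2 ∧ q.1.2 = p.1.1)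
  iseqv :=
    { refl := fun _ => Or.inl rfl
      symm := by
        rintro p q (rfl | ⟨h₁, h₂⟩)
        · exact Or.inl rfl
        · exact Or.inr ⟨h₂.symm, h₁.symm⟩
      trans := by
        rintro p q r (rfl | ⟨h₁, h₂⟩) (rfl | ⟨h₃, h₄⟩)
        · exact Or.inl rfl
        · exact Or.inr ⟨h₃, h₄⟩
        · exact Or.inr ⟨h₁, h₂⟩
        · exact Or.inl (Subtype.ext (Prod.ext (h₃.trans h₂) (h₄.trans h₁))) }

/-- The unordered 2-configuration space of a topological space, with the quotient topology. -/
def UnorderedConf (Z : Type u) : Type u :=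
  Quotient (swapSetoid Z)

instance (Z : Type u) [TopologicalSpace Z] : TopologicalSpace (UnorderedConf Z) :=
  inferInstanceAs (TopologicalSpace (Quotient (swapSetoid Z)))

/-- The configuration space `UC₂ G` of two unordered points in the graph `G`. Its fundamental group
is the graph 2-braid group of `G`. -/
abbrev UC₂ {W : Type u} (G : SimpleGraph W) : Type u :=
  UnorderedConf (Realization G)

/-- The graph 2-braid group of `G`, with base point `x`. -/
abbrev braidGroup₂ {W : Type u} (G : SimpleGraph W) (x : UC₂ G) : Type u :=
  FundamentalGroup (UC₂ G) x

/-- The subspace of `UC₂ G` underlying a subcomplex `K` of `UD₂ G`: the unordered pairs `{x, y}`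
such that `x` and `y` lie in the closed cells `σ` and `τ` of `G` for some cell `{σ, τ}` of `K`. -/
def space {W : Type u} (G : SimpleGraph W) (K : SquareComplex (Sym2 W)) : Set (UC₂ G) :=
  {z | ∃ p : OrderedConf (Realization G), z = Quotient.mk (swapSetoid (Realization G)) p ∧
    ((∃ v w, s(v, w) ∈ K.verts ∧ p.1.1.1 = pt v ∧ p.1.2.1 = pt w) ∨
      (∃ a b v, K.Adj s(a, v) s(b, v) ∧
        p.1.1.1 ∈ segment ℝ (pt a) (pt b) ∧ p.1.2.1 = pt v) ∨
      (∃ a b c d, K.IsSquare s(a, c) s(b, c) s(b, d) s(a, d) ∧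
        p.1.1.1 ∈ segment ℝ (pt a) (pt b) ∧ p.1.2.1 ∈ segment ℝ (pt c) (pt d)))}

theorem space_mono {W : Type u} (G : SimpleGraph W) {K L : SquareComplex (Sym2 W)}
    (h : K.IsSubcomplex L) : space G K ⊆ space G L := by
  rintro z ⟨p, hz, ⟨v, w, hK, hp⟩ | ⟨a, b, v, hK, hp⟩ | ⟨a, b, c, d, hK, hp⟩⟩
  · exact ⟨p, hz, Or.inl ⟨v, w, h.verts hK, hp⟩⟩
  · exact ⟨p, hz, Or.inr (Or.inl ⟨a, b, v, h.adj hK, hp⟩)⟩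
  · exact ⟨p, hz, Or.inr (Or.inr ⟨a, b, c, d, h.square hK, hp⟩)⟩

/-- The underlying space of the discrete configuration space. -/
abbrev spaceUD₂ {W : Type u} (G : SimpleGraph W) : Set (UC₂ G) :=
  space G (UD₂ G)

/-- The underlying space of the union of the maximal product subcomplexes. -/
abbrev spaceUP₂ {W : Type u} (G : SimpleGraph W) : Set (UC₂ G) :=
  space G (UP₂ G)

/-- The inclusion of the underlying space of `UP₂ G` into that of `UD₂ G`. -/
def inclUP₂ {W : Type u} (G : SimpleGraph W) : C(spaceUP₂ G, spaceUD₂ G) :=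
  ContinuousMap.inclusion (space_mono G (UP₂_isSubcomplex G))

end

end GraphBraid

open GraphBraid

/-! A point of a graph is written in barycentric coordinates on the vertices, a configuration as a
pair of such vectors, and unordered configurations are handled through swap-invariant sets of pairs.
Collapsing the grapes maps the bunch to its stem `T`. Two vertices are apart if their images in `T`
differ.

Combinatorics: a product in `UD₂` moves one point in each direction (`exists_split`), so a standard
product consists of the pairs from two disjoint embedded leafless graphs. Such a graph contains the
stem vertex of every grape that it meets, so the two factors lie over disjoint parts of the stem
(`exists_split_apart`). Conversely, two disjoint cells of a tree are separated by an edge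
(`exists_separating`), and the graphs over the two sides of a twig span a maximal product
(`isMaximalProduct_side`); they are leafless by normality and minimality. Hence `UP₂` is the full
subcomplex of `UD₂` on the pairs that are apart. Local convexity reduces to the fourth corner of a
square (`apart_of_adj`), and connectedness to sliding two points along a tree.

Topology: `UC₂` deforms onto `UD₂` (`exists_homotopyEquiv_UC₂`), and the open set `offDiag` of
discrete configurations with distinct images in the stem deforms onto `UP₂`
(`exists_homotopyEquiv_offDiag`). The rest of `UD₂` is covered by contractible open pieces, added to
`offDiag` in three rounds. `capStem`, one for each grape at `v`, meets `offDiag` in one component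
for each twig at `v`. `bothGrape`, one for each grape, meets the previous stage in two components.
`twoGrapes`, one for each pair of grapes at a common vertex, meets it in four.

A simply connected piece glued along `m` simply connected components adds `m - 1` free generators
(`IsAttached.isFreeExt`). A grape at `v` thus gives `deg v - 1` and then one more generator, a pair
of grapes at a common vertex gives three, and `N` is the total. The second round alone gives `N ≥
ℓ(T)`.

The gluing step is a van Kampen argument in terms of transports: a group-valued function of short
paths, multiplicative within each set of an open cover, integrates to a holonomy along all paths and
so to a homomorphism on the fundamental group. The holonomy with values in the expected free product
is inverse to the obvious map out of it. -/

namespace GraphBraid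

open unitInterval Set Topology

set_option linter.unusedSectionVars false

/-! ### Transport along paths -/

section Transport

variable {X : Type*} [TopologicalSpace X] {G : Type*} [Group G]

/-- The path that a map `H` of a normed space traces over the segment from `p` to `q`. -/
noncomputable def edgePath {E : Type*} [NormedAddCommGroup E] [NormedSpace ℝ E] (H : C(E, X)) (p q : E) :
    C(I, X) :=
  ⟨fun r => H (AffineMap.lineMap p q (r : ℝ)), H.continuous.comp (by
    simp only [AffineMap.lineMap_apply_module]; fun_prop)⟩

abbrev bot (κ : C(I × I, X)) : C(I, X) := κ.comp ⟨fun s => (s, 0), by fun_prop⟩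
abbrev top (κ : C(I × I, X)) : C(I, X) := κ.comp ⟨fun s => (s, 1), by fun_prop⟩
abbrev left (κ : C(I × I, X)) : C(I, X) := κ.comp ⟨fun t => (0, t), by fun_prop⟩
abbrev right (κ : C(I × I, X)) : C(I, X) := κ.comp ⟨fun t => (1, t), by fun_prop⟩

/-- A group-valued function of paths that is a homotopy invariant and multiplicative (in the
order of composition of the fundamental groupoid) for paths in each of the sets of a family. -/
structure IsTransport (F : C(I, X) → G) (𝒰 : Set (Set X)) : Prop where
  const : ∀ x, F (.const _ x) = 1
  square : ∀ U ∈ 𝒰, ∀ κ : C(I × I, X), (∀ z, κ z ∈ U) →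
    F (right κ) * F (bot κ) = F (top κ) * F (left κ)

variable {F : C(I, X) → G} {𝒰 : Set (Set X)}

theorem edgePath_self {E : Type*} [NormedAddCommGroup E] [NormedSpace ℝ E] (H : C(E, X)) (p : E) :
    edgePath H p p = .const _ (H p) := by
  ext r; simp [edgePath]

/-- A triangle is a square with one side collapsed: the vertical segments of the square go to the
segments from the points of `pq` to the points of `pr`, so the left side is constant at `p`.
Convexity keeps the square in `S`. -/
theorem IsTransport.triangle {E : Type*} [NormedAddCommGroup E] [NormedSpace ℝ E]
    (hF : IsTransport F 𝒰) (H : C(E, X)) {U : Set X} (hU : U ∈ 𝒰) {S : Set E} (hS : Convex ℝ S)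
    (hSU : ∀ z ∈ S, H z ∈ U) {p q r : E} (hp : p ∈ S) (hq : q ∈ S) (hr : r ∈ S) :
    F (edgePath H q r) * F (edgePath H p q) = F (edgePath H p r) := by
  let κ : C(I × I, X) := ⟨fun z => H (AffineMap.lineMap (AffineMap.lineMap p q (z.1 : ℝ))
      (AffineMap.lineMap p r (z.1 : ℝ)) (z.2 : ℝ)), H.continuous.comp (by
    simp only [AffineMap.lineMap_apply_module]; fun_prop)⟩
  have hκ : ∀ z, κ z ∈ U := fun z => hSU _ <|
    hS.lineMap_mem (hS.lineMap_mem hp hq z.1.2) (hS.lineMap_mem hp hr z.1.2) z.2.2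
  have h := hF.square U hU κ hκ
  have h1 : right κ = edgePath H q r := by ext t; simp [κ, edgePath]
  have h2 : bot κ = edgePath H p q := by ext t; simp [κ, edgePath]
  have h3 : top κ = edgePath H p r := by ext t; simp [κ, edgePath]
  have h4 : left κ = .const _ (H p) := by ext t; simp [κ]
  rwa [h1, h2, h3, h4, hF.const, mul_one] at h

/-- On a star-shaped compact set a transport is the coboundary of a function. -/
theorem IsTransport.exists_potential {E : Type*} [NormedAddCommGroup E] [NormedSpace ℝ E]
    (hF : IsTransport F 𝒰) (ho : ∀ U ∈ 𝒰, IsOpen U) (hc : ∀ x, ∃ U ∈ 𝒰, x ∈ U) (H : C(E, X))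
    {S : Set E} (hS : IsCompact S) (hS' : StarConvex ℝ 0 S) :
    ∃ (g : E → G) (ε : ℝ), 0 < ε ∧ (∀ p ∈ S, ∃ U ∈ 𝒰, ∀ z ∈ Metric.ball p ε, H z ∈ U) ∧
      ∀ p ∈ S, ∀ q ∈ S, dist p q < ε → g q = F (edgePath H p q) * g p := by
  -- A Lebesgue number: within a ball of radius `δ` about a point of `S` the triangle relation is
  -- available.
  obtain ⟨δ, hδ, hball⟩ := lebesgue_number_lemma_of_metric (s := S)
    (c := fun U : 𝒰 => H ⁻¹' U.1) hS (fun U => (ho _ U.2).preimage H.continuous)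
    (fun z _ => by
      obtain ⟨U, hU, hz⟩ := hc (H z)
      exact mem_iUnion.2 ⟨⟨U, hU⟩, hz⟩)
  have tri : ∀ x ∈ S, ∀ p ∈ Metric.ball x δ, ∀ q ∈ Metric.ball x δ, ∀ r ∈ Metric.ball x δ,
      F (edgePath H q r) * F (edgePath H p q) = F (edgePath H p r) := by
    intro x hx p hp q hq r hr
    obtain ⟨U, hU⟩ := hball x hx
    exact hF.triangle H U.2 (convex_ball x δ) hU hp hq hr
  obtain ⟨R, hR0, hR⟩ := hS.isBounded.exists_pos_norm_le
  obtain ⟨n, hn⟩ := exists_nat_gt (3 * R / δ)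
  have hnpos : (0 : ℝ) < n := lt_of_le_of_lt (by positivity) hn
  have hRn : R / n < δ / 3 := by
    rw [div_lt_iff₀ hδ] at hn
    rw [div_lt_div_iff₀ hnpos (by norm_num)]
    linarith
  let a : ℕ → ℝ := fun k => k / n
  -- `g k p` develops the transport along the first `k` of `n` equal steps of the ray from `0` to
  -- `p`; by the choice of `n` each step is shorter than `δ / 3`.
  let g : ℕ → E → G := fun k => Nat.rec (fun _ => 1)
    (fun k gk p => F (edgePath H (a k • p) (a (k + 1) • p)) * gk p) k
  have hg0 : ∀ p, g 0 p = 1 := fun _ => rfl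
  have hgs : ∀ k p, g (k + 1) p = F (edgePath H (a k • p) (a (k + 1) • p)) * g k p :=
    fun _ _ => rfl
  have hstep : ∀ k, ∀ p ∈ S, dist (a (k + 1) • p) (a k • p) < δ / 3 := by
    intro k p hp
    have : a (k + 1) • p - a k • p = (1 / (n : ℝ)) • p := by
      rw [← sub_smul]; congr 1; simp only [a]; push_cast; ring
    rw [dist_eq_norm, this, norm_smul, Real.norm_of_nonneg (by positivity)]
    refine lt_of_le_of_lt ?_ hRn
    rw [one_div, inv_mul_eq_div]
    gcongr
    exact hR p hp
  have hsmul : ∀ k ≤ n, ∀ p q : E, dist p q < δ / 3 → dist (a k • p) (a k • q) < δ / 3 := by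
    intro k hk p q h
    have h0 : 0 ≤ a k := by positivity
    have h1 : a k ≤ 1 := (div_le_one hnpos).2 (by exact_mod_cast hk)
    rw [dist_eq_norm, ← smul_sub, norm_smul, Real.norm_of_nonneg h0, ← dist_eq_norm]
    nlinarith [dist_nonneg (x := p) (y := q)]
  -- Induction along the rays: the quadrilateral between step `k` of the rays to `p` and to `q` lies
  -- in one ball of radius `δ` (its corners are within `2δ/3` of the first one) and is cut by a
  -- diagonal into two triangles.
  have key : ∀ k ≤ n, ∀ p ∈ S, ∀ q ∈ S, dist p q < δ / 3 →
      g k q = F (edgePath H (a k • p) (a k • q)) * g k p := by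
    intro k
    induction k with
    | zero =>
      intro _ p _ q _ _
      simp [hg0, a, edgePath_self, hF.const]
    | succ k ih =>
      intro hk p hp q hq hpq
      have hmem : a k • p ∈ S := by
        have := hS'.smul_mem hp (show 0 ≤ a k by positivity)
          ((div_le_one hnpos).2 (by exact_mod_cast (Nat.le_of_succ_le hk)))
        simpa using this
      have c0 : a k • p ∈ Metric.ball (a k • p) δ := Metric.mem_ball_self hδ
      have c1 : a k • q ∈ Metric.ball (a k • p) δ := by
        have := hsmul k (Nat.le_of_succ_le hk) p q hpq
        rw [Metric.mem_ball, dist_comm]; linarith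
      have c2 : a (k + 1) • p ∈ Metric.ball (a k • p) δ := by
        have := hstep k p hp
        rw [Metric.mem_ball]; linarith
      have c3 : a (k + 1) • q ∈ Metric.ball (a k • p) δ := by
        have h1 := hstep k p hp
        have h2 := hsmul (k + 1) hk p q hpq
        have h3 := dist_triangle (a (k + 1) • q) (a (k + 1) • p) (a k • p)
        rw [dist_comm] at h2
        rw [Metric.mem_ball]; linarith
      rw [hgs, hgs, ih (Nat.le_of_succ_le hk) p hp q hq hpq, ← mul_assoc, ← mul_assoc,
        tri _ hmem _ c0 _ c1 _ c3, tri _ hmem _ c0 _ c2 _ c3]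
  refine ⟨g n, δ / 3, by positivity, fun p hp => ?_, fun p hp q hq hpq => ?_⟩
  · obtain ⟨U, hU⟩ := hball p hp
    exact ⟨U, U.2, fun z hz => hU (Metric.ball_subset_ball (by linarith) hz)⟩
  · have := key n le_rfl p hp q hq hpq
    have h1 : a n = 1 := div_self hnpos.ne'
    rwa [h1, one_smul, one_smul] at this

/-- The extension of a path to the real line. -/
noncomputable def extendPath (γ : C(I, X)) : C(ℝ, X) :=
  ⟨fun t => γ (projIcc 0 1 zero_le_one t), γ.continuous.comp continuous_projIcc⟩

theorem edgePath_extendPath (γ : C(I, X)) : edgePath (extendPath γ) 0 1 = γ := by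
  ext r
  simp [edgePath, extendPath, AffineMap.lineMap_apply_module]

/-- A function on the unit interval whose coboundary is the transport along `γ`. -/
def IsPotential (F : C(I, X) → G) (γ : C(I, X)) (g : ℝ → G) : Prop :=
  ∃ ε > 0, ∀ s ∈ Icc (0 : ℝ) 1, ∀ t ∈ Icc (0 : ℝ) 1, dist s t < ε →
    g t = F (edgePath (extendPath γ) s t) * g s

/-- Over a short step both potentials are multiplied on the left by the same factor, so `g⁻¹ * g'`
is constant along a mesh finer than both tolerances. -/
theorem IsPotential.unique {γ : C(I, X)} {g g' : ℝ → G} (h : IsPotential F γ g)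
    (h' : IsPotential F γ g') : g 1 * (g 0)⁻¹ = g' 1 * (g' 0)⁻¹ := by
  obtain ⟨ε, hε, h⟩ := h
  obtain ⟨ε', hε', h'⟩ := h'
  obtain ⟨n, hn⟩ := exists_nat_gt (1 / min ε ε')
  have hm : 0 < min ε ε' := lt_min hε hε'
  have hnpos : (0 : ℝ) < n := lt_of_le_of_lt (by positivity) hn
  have hn' : 1 / (n : ℝ) < min ε ε' := by
    rw [div_lt_iff₀ hm] at hn
    rw [div_lt_iff₀ hnpos]; linarith
  have key : ∀ k : ℕ, k ≤ n → (g (k / n))⁻¹ * g' (k / n) = (g 0)⁻¹ * g' 0 := by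
    intro k
    induction k with
    | zero => intro _; simp
    | succ k ih =>
      intro hk
      have m1 : (k / n : ℝ) ∈ Icc (0 : ℝ) 1 :=
        ⟨by positivity, (div_le_one hnpos).2 (by exact_mod_cast Nat.le_of_succ_le hk)⟩
      have m2 : ((k + 1 : ℕ) / n : ℝ) ∈ Icc (0 : ℝ) 1 :=
        ⟨by positivity, (div_le_one hnpos).2 (by exact_mod_cast hk)⟩
      have hd : dist (k / n : ℝ) ((k + 1 : ℕ) / n : ℝ) < min ε ε' := by
        rw [dist_comm, Real.dist_eq]
        have : ((k + 1 : ℕ) / n : ℝ) - k / n = 1 / n := by push_cast; ring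
        rw [this, abs_of_nonneg (by positivity)]; exact hn'
      rw [h _ m1 _ m2 (hd.trans_le (min_le_left _ _)), h' _ m1 _ m2 (hd.trans_le (min_le_right _ _)),
        ← ih (Nat.le_of_succ_le hk)]
      group
  have := key n le_rfl
  rw [div_self hnpos.ne'] at this
  have h3 : g' 1 = g 1 * ((g 0)⁻¹ * g' 0) := by rw [← this]; group
  rw [h3]; group

open Classical in
/-- The holonomy of a transport along an arbitrary path. -/
noncomputable def hol (F : C(I, X) → G) (γ : C(I, X)) : G :=
  -- The default value plays no role for a transport over an open cover: there every path has a
  -- potential, by `IsTransport.isPotential_exists`.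
  if h : ∃ g, IsPotential F γ g then h.choose 1 * (h.choose 0)⁻¹ else 1

theorem IsPotential.hol_eq {γ : C(I, X)} {g : ℝ → G} (h : IsPotential F γ g) :
    hol F γ = g 1 * (g 0)⁻¹ := by
  have h' : ∃ g, IsPotential F γ g := ⟨g, h⟩
  rw [hol, dif_pos h']
  exact h'.choose_spec.unique h

/-- The transport along the initial segments of `γ` is a potential, by the triangle relation. -/
theorem IsTransport.hol_eq_of_mem (hF : IsTransport F 𝒰) {U : Set X} (hU : U ∈ 𝒰) {γ : C(I, X)}
    (hγ : ∀ t, γ t ∈ U) : hol F γ = F γ := by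
  have h : IsPotential F γ (fun t => F (edgePath (extendPath γ) 0 t)) :=
    ⟨1, one_pos, fun s _ t _ _ =>
      (hF.triangle (extendPath γ) hU convex_univ (fun z _ => hγ _) (mem_univ _) (mem_univ _)
        (mem_univ _)).symm⟩
  rw [h.hol_eq, edgePath_extendPath, edgePath_self, hF.const, inv_one, mul_one]

/-- The second half records that short subpaths lie in single sets of the cover; this lets local
comparisons of transports be integrated in `IsTransport.map_hol`. -/
theorem IsTransport.isPotential_exists (hF : IsTransport F 𝒰) (ho : ∀ U ∈ 𝒰, IsOpen U)
    (hc : ∀ x, ∃ U ∈ 𝒰, x ∈ U) (γ : C(I, X)) :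
    ∃ g, IsPotential F γ g ∧ ∃ ε > 0, ∀ s ∈ Icc (0 : ℝ) 1, ∀ t ∈ Icc (0 : ℝ) 1, dist s t < ε →
      ∃ U ∈ 𝒰, ∀ r, edgePath (extendPath γ) s t r ∈ U := by
  obtain ⟨g, ε, hε, hb, hg⟩ := hF.exists_potential ho hc (extendPath γ) isCompact_Icc
    ((convex_Icc (0 : ℝ) 1).starConvex (left_mem_Icc.2 zero_le_one))
  refine ⟨g, ⟨ε, hε, hg⟩, ε, hε, fun s hs t ht hst => ?_⟩
  obtain ⟨U, hU, h⟩ := hb s hs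
  exact ⟨U, hU, fun r => h _ ((convex_ball s ε).lineMap_mem (Metric.mem_ball_self hε)
    (by rwa [Metric.mem_ball, dist_comm]) r.2)⟩

/-- The holonomy of a transport for an open cover is a global transport. -/
theorem IsTransport.isTransport_hol (hF : IsTransport F 𝒰) (ho : ∀ U ∈ 𝒰, IsOpen U)
    (hc : ∀ x, ∃ U ∈ 𝒰, x ∈ U) : IsTransport (hol F) {univ} where
  const x := by
    obtain ⟨U, hU, hx⟩ := hc x
    rw [hF.hol_eq_of_mem hU (fun _ => hx), hF.const]
  square := by
    rintro _ - κ -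
    let K : C(ℝ × ℝ, X) := ⟨fun z => κ (projIcc 0 1 zero_le_one z.1, projIcc 0 1 zero_le_one z.2),
      κ.continuous.comp ((continuous_projIcc.comp continuous_fst).prodMk
        (continuous_projIcc.comp continuous_snd))⟩
    -- A potential on the whole square restricts to potentials of its four sides, and the relation
    -- to be shown becomes a telescoping identity between corner values.
    obtain ⟨g, ε, hε, -, hg⟩ := hF.exists_potential ho hc K (isCompact_Icc.prod isCompact_Icc)
      (((convex_Icc (0 : ℝ) 1).prod (convex_Icc (0 : ℝ) 1)).starConvex
        (⟨left_mem_Icc.2 zero_le_one, left_mem_Icc.2 zero_le_one⟩))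
    have m0 : (0 : ℝ) ∈ Icc (0 : ℝ) 1 := left_mem_Icc.2 zero_le_one
    have m1 : (1 : ℝ) ∈ Icc (0 : ℝ) 1 := right_mem_Icc.2 zero_le_one
    have hb : IsPotential F (bot κ) (fun t => g (t, 0)) := ⟨ε, hε, fun s hs t ht hst => by
      beta_reduce
      rw [hg (s, 0) ⟨hs, m0⟩ (t, 0) ⟨ht, m0⟩ (by simpa [Prod.dist_eq] using hst)]
      congr 2
      ext r; simp [edgePath, extendPath, K, AffineMap.lineMap_apply_module]⟩
    have ht : IsPotential F (top κ) (fun t => g (t, 1)) := ⟨ε, hε, fun s hs t ht hst => by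
      beta_reduce
      rw [hg (s, 1) ⟨hs, m1⟩ (t, 1) ⟨ht, m1⟩ (by simpa [Prod.dist_eq] using hst)]
      congr 2
      ext r; simp [edgePath, extendPath, K, AffineMap.lineMap_apply_module]⟩
    have hl : IsPotential F (left κ) (fun t => g (0, t)) := ⟨ε, hε, fun s hs t ht hst => by
      beta_reduce
      rw [hg (0, s) ⟨m0, hs⟩ (0, t) ⟨m0, ht⟩ (by simpa [Prod.dist_eq] using hst)]
      congr 2
      ext r; simp [edgePath, extendPath, K, AffineMap.lineMap_apply_module]⟩
    have hr : IsPotential F (right κ) (fun t => g (1, t)) := ⟨ε, hε, fun s hs t ht hst => by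
      beta_reduce
      rw [hg (1, s) ⟨m1, hs⟩ (1, t) ⟨m1, ht⟩ (by simpa [Prod.dist_eq] using hst)]
      congr 2
      ext r; simp [edgePath, extendPath, K, AffineMap.lineMap_apply_module]⟩
    rw [hb.hol_eq, ht.hol_eq, hl.hol_eq, hr.hol_eq]
    group

/-- A global transport that restricts to the image of `F` on the sets of the cover is the image of
the holonomy of `F`. -/
theorem IsTransport.map_hol {G' : Type*} [Group G'] (hF : IsTransport F 𝒰)
    (ho : ∀ U ∈ 𝒰, IsOpen U) (hc : ∀ x, ∃ U ∈ 𝒰, x ∈ U) {F' : C(I, X) → G'}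
    (hF' : IsTransport F' {univ}) (φ : G →* G')
    (h : ∀ U ∈ 𝒰, ∀ γ : C(I, X), (∀ t, γ t ∈ U) → φ (F γ) = F' γ) (γ : C(I, X)) :
    φ (hol F γ) = F' γ := by
  obtain ⟨g, hg, ε, hε, hs⟩ := hF.isPotential_exists ho hc γ
  have h' : IsPotential F' γ (fun t => φ (g t)) := by
    obtain ⟨ε', hε', hg'⟩ := hg
    refine ⟨min ε ε', lt_min hε hε', fun s hs' t ht hst => ?_⟩
    obtain ⟨U, hU, hm⟩ := hs s hs' t ht (hst.trans_le (min_le_left _ _))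
    beta_reduce
    rw [hg' s hs' t ht (hst.trans_le (min_le_right _ _)), map_mul, h U hU _ hm]
  rw [hg.hol_eq, ← hF'.hol_eq_of_mem (mem_singleton _) (fun _ => mem_univ _), h'.hol_eq, map_mul,
    map_inv]

theorem IsTransport.eq_of_homotopic (hF : IsTransport F {univ}) {x y : X} {p q : Path x y}
    (h : p.Homotopic q) : F p.toContinuousMap = F q.toContinuousMap := by
  obtain ⟨K⟩ := h
  -- A homotopy has its time in the first coordinate, whereas the bottom and top of a square run
  -- along the first one. The two vertical sides are constant because the end points stay fixed.
  have h := hF.square _ (mem_singleton _) (K.toContinuousMap.comp .prodSwap) (fun _ => mem_univ _)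
  have h1 : right (K.toContinuousMap.comp .prodSwap) = .const _ y := by ext t; simp
  have h2 : left (K.toContinuousMap.comp .prodSwap) = .const _ x := by ext t; simp
  have h3 : bot (K.toContinuousMap.comp .prodSwap) = p.toContinuousMap := by ext t; simp
  have h4 : top (K.toContinuousMap.comp .prodSwap) = q.toContinuousMap := by ext t; simp
  rwa [h1, h2, h3, h4, hF.const, hF.const, one_mul, mul_one] at h

/-- This is the triangle relation for the collinear points `0`, `1/2`, `1` of the extended path; the
two short sides are reparametrizations of `p` and `q`. -/
theorem IsTransport.trans (hF : IsTransport F {univ}) {x y z : X} (p : Path x y) (q : Path y z) :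
    F (p.trans q).toContinuousMap = F q.toContinuousMap * F p.toContinuousMap := by
  have h := hF.triangle (extendPath (p.trans q).toContinuousMap) (mem_singleton _) convex_univ
    (fun _ _ => mem_univ _) (mem_univ 0) (mem_univ (1 / 2)) (mem_univ 1)
  rw [edgePath_extendPath] at h
  rw [← h]
  congr 2
  · ext r
    have h1 : (1 / 2 : ℝ) + r / 2 ∈ Set.Icc (0 : ℝ) 1 := ⟨by linarith [r.2.1], by linarith [r.2.2]⟩
    have h2 : AffineMap.lineMap (1 / 2 : ℝ) 1 (r : ℝ) = 1 / 2 + r / 2 := by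
      simp only [AffineMap.lineMap_apply_module, smul_eq_mul]; ring
    symm
    change q r = (p.trans q) (projIcc 0 1 zero_le_one (AffineMap.lineMap (1 / 2 : ℝ) 1 (r : ℝ)))
    rw [h2, projIcc_of_mem _ h1, Path.trans_apply]
    split_ifs with h3
    · have : (r : ℝ) = 0 := le_antisymm (by simp only at h3; linarith) r.2.1
      have hr : r = 0 := Subtype.ext this
      subst hr
      rw [q.source]
      symm
      convert p.target using 2
      ext; simp
    · congr 1; ext; simp only; ring
  · ext r
    have h1 : (r : ℝ) / 2 ∈ Set.Icc (0 : ℝ) 1 := ⟨by linarith [r.2.1], by linarith [r.2.2]⟩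
    have h2 : AffineMap.lineMap (0 : ℝ) (1 / 2) (r : ℝ) = r / 2 := by
      simp only [AffineMap.lineMap_apply_module, smul_eq_mul]; ring
    symm
    change p r = (p.trans q) (projIcc 0 1 zero_le_one (AffineMap.lineMap (0 : ℝ) (1 / 2) (r : ℝ)))
    rw [h2, projIcc_of_mem _ h1, Path.trans_apply, dif_pos (by simp only; linarith [r.2.2])]
    congr 1; ext; simp only; ring

theorem IsTransport.symm (hF : IsTransport F {univ}) {x y : X} (p : Path x y) :
    F p.symm.toContinuousMap = (F p.toContinuousMap)⁻¹ := by
  rw [eq_inv_iff_mul_eq_one, ← hF.trans, hF.eq_of_homotopic ⟨(Path.Homotopy.reflTransSymm p).symm⟩]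
  exact hF.const x

end Transport

/-! ### Attaching simply connected pieces -/

section Loops

variable {X : Type*} [TopologicalSpace X] {x₀ : X}

/-- The path `γ` as a morphism of the fundamental groupoid, closed up to a loop by a choice of paths
from the base point. -/
noncomputable def loopOf (c : ∀ x, Path x₀ x) {x y : X} (q : Path.Homotopic.Quotient x y) :
    FundamentalGroup X x₀ :=
  ((Path.Homotopic.Quotient.mk (c x)).trans q).trans (Path.Homotopic.Quotient.mk (c y)).symm

theorem loopOf_trans (c : ∀ x, Path x₀ x) {x y z : X} (q : Path.Homotopic.Quotient x y)
    (r : Path.Homotopic.Quotient y z) : loopOf c (q.trans r) = loopOf c r * loopOf c q := by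
  rw [FundamentalGroup.mul_def]
  simp only [loopOf, Path.Homotopic.Quotient.trans_assoc]
  rw [← Path.Homotopic.Quotient.trans_assoc (Path.Homotopic.Quotient.mk (c y)).symm,
    Path.Homotopic.Quotient.symm_trans, Path.Homotopic.Quotient.refl_trans]

theorem loopOf_refl (c : ∀ x, Path x₀ x) (x : X) :
    loopOf c (Path.Homotopic.Quotient.refl x) = 1 := by
  simp [loopOf]
  rfl

theorem loopOf_self (c : ∀ x, Path x₀ x) (h : c x₀ = Path.refl x₀)
    (q : Path.Homotopic.Quotient x₀ x₀) : loopOf c q = q := by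
  rw [loopOf, h, ← Path.Homotopic.Quotient.mk_symm, Path.refl_symm]
  simp

theorem loopOf_choice (c : ∀ x, Path x₀ x) (h : c x₀ = Path.refl x₀) (x : X) :
    loopOf c (Path.Homotopic.Quotient.mk (c x)) = 1 := by
  simp [loopOf, h]
  rfl

/-- The loop of a path. -/
noncomputable def loopClass (c : ∀ x, Path x₀ x) (γ : C(I, X)) : FundamentalGroup X x₀ :=
  loopOf c (Path.Homotopic.Quotient.mk ⟨γ, rfl, rfl⟩)

theorem loopClass_path (c : ∀ x, Path x₀ x) {x y : X} (p : Path x y) :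
    loopClass c p.toContinuousMap = loopOf c (Path.Homotopic.Quotient.mk p) := by
  obtain ⟨f, rfl, rfl⟩ := p
  rfl

/-- The square is simply connected, so the two ways around its boundary are homotopic, and this
survives under `κ`. -/
theorem isTransport_loopClass (c : ∀ x, Path x₀ x) : IsTransport (loopClass c) {univ} where
  const x := by
    rw [show ContinuousMap.const I x = (Path.refl x).toContinuousMap from rfl, loopClass_path]
    exact loopOf_refl c x
  square := by
    rintro _ - κ -
    let b : Path ((0 : I), (0 : I)) (1, 0) := ⟨⟨fun s => (s, 0), by fun_prop⟩, rfl, rfl⟩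
    let t : Path ((0 : I), (1 : I)) (1, 1) := ⟨⟨fun s => (s, 1), by fun_prop⟩, rfl, rfl⟩
    let l : Path ((0 : I), (0 : I)) (0, 1) := ⟨⟨fun s => (0, s), by fun_prop⟩, rfl, rfl⟩
    let r : Path ((1 : I), (0 : I)) (1, 1) := ⟨⟨fun s => (1, s), by fun_prop⟩, rfl, rfl⟩
    have : ContractibleSpace I :=
      (convex_Icc (0 : ℝ) 1).contractibleSpace ⟨0, left_mem_Icc.2 zero_le_one⟩
    have h := (SimplyConnectedSpace.paths_homotopic (b.trans r) (l.trans t)).map κ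
    rw [Path.map_trans, Path.map_trans, ← Path.Homotopic.Quotient.eq] at h
    have h' := congrArg (loopOf c) h
    simp only [Path.Homotopic.Quotient.mk_trans, loopOf_trans, ← loopClass_path] at h'
    exact h'

theorem map_loopOf {Y : Type*} [TopologicalSpace Y] (f : C(X, Y)) (c : ∀ x, Path x₀ x)
    (d : ∀ y, Path (f x₀) y) (h : ∀ x, d (f x) = (c x).map f.continuous) {x y : X}
    (q : Path.Homotopic.Quotient x y) :
    FundamentalGroup.map f x₀ (loopOf c q) = loopOf d (q.map f) := by
  induction q using Path.Homotopic.Quotient.ind with | mk p =>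
  simp only [loopOf, h]
  change Path.Homotopic.Quotient.mk ((((c x).trans p).trans (c y).symm).map f.continuous) = _
  rw [Path.map_trans, Path.map_trans]
  rfl

/-- The homomorphism on the fundamental group defined by a global transport. -/
noncomputable def IsTransport.toHom {G : Type*} [Group G] {F : C(I, X) → G} (hF : IsTransport F {univ}) (x : X) :
    FundamentalGroup X x →* G where
  toFun q := Quotient.lift (fun p : Path x x => F p.toContinuousMap)
    (fun _ _ h => hF.eq_of_homotopic h) q
  map_one' := hF.const x
  map_mul' := by
    rintro ⟨p⟩ ⟨q⟩
    exact hF.trans q p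

/-- The constant path at the base point makes the closing up of loops the identity on the
fundamental group. -/
theorem exists_pathChoice [PathConnectedSpace X] (x₀ : X) :
    ∃ c : ∀ x, Path x₀ x, c x₀ = Path.refl x₀ := by
  classical
  refine ⟨fun x => if h : x = x₀ then (Path.refl x₀).cast rfl h else
    PathConnectedSpace.somePath x₀ x, ?_⟩
  simp

/-- The set `U` is path connected, and paths in `U` are homotopic in the ambient space as soon as
they have the same end points. -/
def IsSC (U : Set X) : Prop :=
  IsPathConnected U ∧ ∀ ⦃x y : X⦄ (p q : Path x y), (∀ t, p t ∈ U) → (∀ t, q t ∈ U) → p.Homotopic q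

theorem IsSC.exists_path {U : Set X} (h : IsSC U) {x y : X} (hx : x ∈ U) (hy : y ∈ U) :
    ∃ p : Path x y, ∀ t, p t ∈ U :=
  ⟨(h.1.joinedIn x hx y hy).somePath, (h.1.joinedIn x hx y hy).somePath_mem⟩

theorem path_trans_mem {U : Set X} {x y z : X} {p : Path x y} {q : Path y z} (hp : ∀ t, p t ∈ U)
    (hq : ∀ t, q t ∈ U) (t : I) : (p.trans q) t ∈ U := by
  rw [Path.trans_apply]
  split_ifs
  · exact hp _
  · exact hq _

end Loops

/-- The map `j` identifies the fundamental group of its target with the free product of the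
fundamental group of its source and the free group on `S`. -/
def IsFreeExt {A X : Type*} [TopologicalSpace A] [TopologicalSpace X] (j : C(A, X)) (S : Type*) :
    Prop :=
  ∀ a, ∃ e : FundamentalGroup X (j a) ≃* Monoid.Coprod (FundamentalGroup A a) (FreeGroup S),
    ∀ γ, e (FundamentalGroup.map j a γ) = Monoid.Coprod.inl γ

/-! ### Spaces obtained by attaching simply connected open pieces -/

section Attach

variable {A X : Type*} [TopologicalSpace A] [TopologicalSpace X]

/-- The data of a space covered by an open subspace and disjoint simply connected open pieces whose
intersections with the subspace have simply connected components. -/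
structure IsAttached (j : C(A, X)) {ι : Type*} {K : ι → Type*} (U : ι → Set X)
    (C : ∀ n, K n → Set A) : Prop where
  emb : IsOpenEmbedding j
  openU : ∀ n, IsOpen (U n)
  scU : ∀ n, IsSC (U n)
  disjU : ∀ ⦃n m x⦄, x ∈ U n → x ∈ U m → n = m
  openC : ∀ n k, IsOpen (C n k)
  scC : ∀ n k, IsSC (C n k)
  disjC : ∀ ⦃n k l a⦄, a ∈ C n k → a ∈ C n l → k = l
  inter : ∀ n a, j a ∈ U n ↔ ∃ k, a ∈ C n k
  cover : ∀ x, x ∈ range j ∨ ∃ n, x ∈ U n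

variable {j : C(A, X)} {ι : Type*} {K : ι → Type*} {U : ι → Set X} {C : ∀ n, K n → Set A}

theorem IsAttached.pathConnectedSpace [PathConnectedSpace A] (h : IsAttached j U C)
    (k₀ : ∀ n, K n) : PathConnectedSpace X := by
  obtain ⟨a₀⟩ := (inferInstance : Nonempty A)
  have key : ∀ x, Joined (j a₀) x := by
    intro x
    rcases h.cover x with ⟨a, rfl⟩ | ⟨n, hn⟩
    · exact (PathConnectedSpace.joined a₀ a).map j.continuous
    · obtain ⟨a, ha⟩ := (h.scC n (k₀ n)).1.nonempty
      exact ((PathConnectedSpace.joined a₀ a).map j.continuous).trans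
        ((h.scU n).1.joinedIn _ ((h.inter n a).2 ⟨_, ha⟩) _ hn).joined
  exact ⟨⟨j a₀⟩, fun x y => (key x).symm.trans (key y)⟩

theorem exists_lift_of_isOpenEmbedding {Y : Type*} [TopologicalSpace Y] (hj : IsOpenEmbedding j)
    (f : C(Y, X)) (hf : ∀ y, f y ∈ range j) : ∃ g : C(Y, A), j.comp g = f := by
  choose g hg using hf
  refine ⟨⟨g, hj.isInducing.continuous_iff.2 ?_⟩, ContinuousMap.ext hg⟩
  rw [show j ∘ g = f from funext hg]
  exact f.continuous

/-- The interval is connected and the sets `C n k`, for fixed `n`, are open and disjoint. -/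
theorem IsAttached.exists_component (h : IsAttached j U C) {n : ι} {γ : C(I, A)}
    (hγ : ∀ t, j (γ t) ∈ U n) : ∃ k, ∀ t, γ t ∈ C n k := by
  obtain ⟨k, hk⟩ := (h.inter n _).1 (hγ 0)
  refine ⟨k, fun t => ?_⟩
  have hp : IsPreconnected (range γ) := isPreconnected_range γ.continuous
  refine hp.subset_left_of_subset_union (h.openC n k) (isOpen_iUnion fun l : {l // l ≠ k} =>
    h.openC n l.1) (disjoint_left.2 ?_) ?_ ⟨γ 0, mem_range_self 0, hk⟩ (mem_range_self t)
  · intro a ha hb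
    obtain ⟨⟨l, hl⟩, hb⟩ := mem_iUnion.1 hb
    exact hl (h.disjC hb ha)
  · rintro _ ⟨s, rfl⟩
    obtain ⟨l, hl⟩ := (h.inter n _).1 (hγ s)
    by_cases hlk : l = k
    · exact Or.inl (hlk ▸ hl)
    · exact Or.inr (mem_iUnion.2 ⟨⟨l, hlk⟩, hl⟩)

end Attach

/-! ### The fundamental group of a space with attached pieces -/

section Attach

variable {A X : Type*} [TopologicalSpace A] [TopologicalSpace X]
variable {j : C(A, X)} {ι : Type*} {K : ι → Type*} {U : ι → Set X} {C : ∀ n, K n → Set A}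

/-- The free product decomposition of the fundamental group of a space that arises from an open
subspace by attaching simply connected pieces: a piece that meets the subspace in `m` components
contributes `m - 1` free generators. -/
theorem IsAttached.isFreeExt [PathConnectedSpace A] (h : IsAttached j U C) (k₀ : ∀ n, K n) :
    IsFreeExt j (Σ n, {k : K n // k ≠ k₀ n}) := by
  classical
  intro a₀
  obtain ⟨c, hc⟩ := exists_pathChoice a₀
  have inj : Function.Injective j := h.emb.injective
  choose pt hpt using fun n k => (h.scC n k).1.nonempty
  -- the values of the transport at the points of the pieces
  let s : ∀ n, K n → Monoid.Coprod (FundamentalGroup A a₀)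
      (FreeGroup (Σ n, {k : K n // k ≠ k₀ n})) := fun n k =>
    if hk : k = k₀ n then 1 else .inr (.of ⟨n, k, hk⟩)
  -- A potential on each piece. On component `k` it is the class of a path in the component, times
  -- the constant `s n k`; simple connectedness of the component makes the path irrelevant. Off the
  -- subspace any value would do, and `1` is taken.
  have hφ : ∃ φ : ι → X → Monoid.Coprod (FundamentalGroup A a₀)
      (FreeGroup (Σ n, {k : K n // k ≠ k₀ n})),
      (∀ n k a (w : Path (pt n k) a), (∀ t, w t ∈ C n k) →
        φ n (j a) = .inl (loopOf c (Path.Homotopic.Quotient.mk w)) * s n k) ∧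
      ∀ n x, x ∉ range j → φ n x = 1 := by
    have : ∀ n x, ∃ g : Monoid.Coprod (FundamentalGroup A a₀)
        (FreeGroup (Σ n, {k : K n // k ≠ k₀ n})),
        (∀ k a (w : Path (pt n k) a), (∀ t, w t ∈ C n k) → j a = x →
          g = .inl (loopOf c (Path.Homotopic.Quotient.mk w)) * s n k) ∧ (x ∉ range j → g = 1) := by
      intro n x
      by_cases hx : ∃ k a, a ∈ C n k ∧ j a = x
      · obtain ⟨k, a, ha, rfl⟩ := hx
        obtain ⟨w, hw⟩ := (h.scC n k).exists_path (hpt n k) ha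
        refine ⟨.inl (loopOf c (Path.Homotopic.Quotient.mk w)) * s n k, ?_,
          fun hx => absurd (mem_range_self a) hx⟩
        intro k' a' w' hw' haa
        obtain rfl := inj haa
        obtain rfl : k = k' := h.disjC ha (by simpa using hw' 1)
        rw [Path.Homotopic.Quotient.eq.2 ((h.scC n k).2 w w' hw hw')]
      · refine ⟨1, fun k a w hw hax => absurd ⟨k, a, by simpa using hw 1, hax⟩ hx, fun _ => rfl⟩
    choose φ h1 h2 using this
    exact ⟨φ, fun n k a w hw => h1 n (j a) k a w hw rfl, h2⟩
  obtain ⟨φ, hφ, hφ'⟩ := hφ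
  -- the transport
  let F : C(I, X) → Monoid.Coprod (FundamentalGroup A a₀)
      (FreeGroup (Σ n, {k : K n // k ≠ k₀ n})) := fun γ =>
    if hγ : ∃ γ' : C(I, A), j.comp γ' = γ then .inl (loopClass c hγ.choose)
    else if hγ : ∃ n, ∀ t, γ t ∈ U n then φ hγ.choose (γ 1) * (φ hγ.choose (γ 0))⁻¹ else 1
  have F1 : ∀ γ' : C(I, A), F (j.comp γ') = .inl (loopClass c γ') := by
    intro γ'
    have hγ : ∃ γ'' : C(I, A), j.comp γ'' = j.comp γ' := ⟨γ', rfl⟩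
    have : hγ.choose = γ' :=
      ContinuousMap.ext fun t => inj (congrArg (fun f => f t) hγ.choose_spec)
    simp only [F, dif_pos hγ, this]
  have F2 : ∀ n (γ : C(I, X)), (∀ t, γ t ∈ U n) → F γ = φ n (γ 1) * (φ n (γ 0))⁻¹ := by
    intro n γ hγ
    by_cases hl : ∃ γ' : C(I, A), j.comp γ' = γ
    · obtain ⟨γ', rfl⟩ := hl
      obtain ⟨k, hk⟩ := h.exists_component hγ
      obtain ⟨w, hw⟩ := (h.scC n k).exists_path (hpt n k) (hk 0)
      let p : Path (γ' 0) (γ' 1) := ⟨γ', rfl, rfl⟩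
      rw [F1, ContinuousMap.comp_apply, ContinuousMap.comp_apply, hφ n k _ w hw,
        hφ n k _ (w.trans p) (path_trans_mem hw hk), Path.Homotopic.Quotient.mk_trans,
        loopOf_trans, map_mul]
      change _ = Monoid.Coprod.inl (loopClass c γ') * _ * _ * _
      group
    · have hn : ∃ n, ∀ t, γ t ∈ U n := ⟨n, hγ⟩
      simp only [F, dif_neg hl, dif_pos hn]
      rw [h.disjU (hn.choose_spec 0) (hγ 0)]
  let 𝒰 : Set (Set X) := insert (range j) (range U)
  have ho : ∀ V ∈ 𝒰, IsOpen V := by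
    rintro V (rfl | ⟨n, rfl⟩)
    · exact h.emb.isOpen_range
    · exact h.openU n
  have hcov : ∀ x, ∃ V ∈ 𝒰, x ∈ V := by
    intro x
    rcases h.cover x with hx | ⟨n, hn⟩
    · exact ⟨_, Or.inl rfl, hx⟩
    · exact ⟨_, Or.inr ⟨n, rfl⟩, hn⟩
  have hF : IsTransport F 𝒰 := by
    constructor
    · intro x
      rcases h.cover x with ⟨a, rfl⟩ | ⟨n, hn⟩
      · rw [show ContinuousMap.const I (j a) = j.comp (.const I a) from rfl, F1,
          (isTransport_loopClass c).const, map_one]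
      · rw [F2 n _ (fun _ => hn)]
        simp
    · rintro V (rfl | ⟨n, rfl⟩) κ hκ
      · obtain ⟨κ', rfl⟩ := exists_lift_of_isOpenEmbedding h.emb κ hκ
        have := congrArg (Monoid.Coprod.inl (N := FreeGroup (Σ n, {k : K n // k ≠ k₀ n})))
          ((isTransport_loopClass c).square _ (mem_singleton _) κ' (fun _ => mem_univ _))
        rw [map_mul, map_mul] at this
        simp only [ContinuousMap.comp_assoc, F1] at this ⊢
        exact this
      · rw [F2 n _ (fun _ => hκ _), F2 n _ (fun _ => hκ _), F2 n _ (fun _ => hκ _),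
          F2 n _ (fun _ => hκ _)]
        simp only [ContinuousMap.comp_apply, ContinuousMap.coe_mk]
        group
  have hH := hF.isTransport_hol ho hcov
  -- paths from the base point to the points of the space
  have hd : ∃ d : ∀ x, Path (j a₀) x, (∀ a, d (j a) = (c a).map j.continuous) ∧
      ∀ n x, x ∉ range j → x ∈ U n → ∃ w : Path (j (pt n (k₀ n))) x, (∀ t, w t ∈ U n) ∧
        d x = ((c _).map j.continuous).trans w := by
    have : ∀ x, ∃ p : Path (j a₀) x, (∀ a (hx : j a = x),
          p = ((c a).map j.continuous).cast rfl hx.symm) ∧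
        ∀ n, x ∉ range j → x ∈ U n → ∃ w : Path (j (pt n (k₀ n))) x, (∀ t, w t ∈ U n) ∧
          p = ((c _).map j.continuous).trans w := by
      intro x
      by_cases hx : x ∈ range j
      · obtain ⟨a, rfl⟩ := hx
        refine ⟨(c a).map j.continuous, fun a' ha' => ?_, fun n hn => absurd (mem_range_self a) hn⟩
        obtain rfl := inj ha'
        rfl
      · obtain ⟨n, hn⟩ := (h.cover x).resolve_left hx
        obtain ⟨w, hw⟩ := (h.scU n).exists_path ((h.inter n _).2 ⟨_, hpt n (k₀ n)⟩) hn
        refine ⟨((c _).map j.continuous).trans w, fun a ha => absurd ⟨a, ha⟩ hx, fun m _ hm => ?_⟩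
        obtain rfl := h.disjU hn hm
        exact ⟨w, hw, rfl⟩
    choose d h1 h2 using this
    exact ⟨d, fun a => h1 _ a rfl, fun n x => h2 x n⟩
  obtain ⟨d, hd, hd'⟩ := hd
  have hd0 : d (j a₀) = Path.refl _ := by rw [hd, hc]; rfl
  -- paths that join the components of the intersections
  have mU : ∀ {n k a}, a ∈ C n k → j a ∈ U n := fun ha => (h.inter _ _).2 ⟨_, ha⟩
  choose w hw using fun n k => (h.scU n).exists_path (mU (hpt n (k₀ n))) (mU (hpt n k))
  -- The loop of a generator crosses the piece from the gate to component `k` and is closed up by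
  -- `d`, within the subspace.
  let θ : (Σ n, {k : K n // k ≠ k₀ n}) → FundamentalGroup X (j a₀) := fun z =>
    loopOf d (Path.Homotopic.Quotient.mk (w z.1 z.2.1))
  let Φ : Monoid.Coprod (FundamentalGroup A a₀) (FreeGroup (Σ n, {k : K n // k ≠ k₀ n})) →*
      FundamentalGroup X (j a₀) :=
    Monoid.Coprod.lift (FundamentalGroup.map j a₀) (FreeGroup.lift θ)
  have Φ1 : ∀ γ, Φ (.inl γ) = FundamentalGroup.map j a₀ γ := fun γ => Monoid.Coprod.lift_apply_inl ..
  have Φs : ∀ n k (u : Path (j (pt n (k₀ n))) (j (pt n k))), (∀ t, u t ∈ U n) →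
      Φ (s n k) = loopOf d (Path.Homotopic.Quotient.mk u) := by
    intro n k u hu
    by_cases hk : k = k₀ n
    · subst hk
      simp only [s, dif_pos, map_one]
      rw [Path.Homotopic.Quotient.eq.2 ((h.scU n).2 u (Path.refl _) hu
        (fun _ => mU (hpt n _))), Path.Homotopic.Quotient.mk_refl, loopOf_refl]
    · simp only [s, dif_neg hk, Φ, Monoid.Coprod.lift_apply_inr, FreeGroup.lift_apply_of, θ]
      rw [Path.Homotopic.Quotient.eq.2 ((h.scU n).2 u (w n k) hu (hw n k))]
  -- Under `Φ` the potential of a point becomes the class of any path in the piece from the gate to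
  -- the point. Hence `Φ` carries `F` to the loop class on every set of the cover, and its holonomy
  -- to the loop class of all paths.
  have Φφ : ∀ n x (u : Path (j (pt n (k₀ n))) x), (∀ t, u t ∈ U n) →
      Φ (φ n x) = loopOf d (Path.Homotopic.Quotient.mk u) := by
    intro n x u hu
    have hxU : x ∈ U n := by simpa using hu 1
    by_cases hx : x ∈ range j
    · obtain ⟨a, rfl⟩ := hx
      obtain ⟨k, hk⟩ := (h.inter n a).1 hxU
      obtain ⟨v, hv⟩ := (h.scC n k).exists_path (hpt n k) hk
      rw [hφ n k a v hv, map_mul, Φ1, Φs n k (w n k) (hw n k), map_loopOf j c d hd,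
        ← loopOf_trans, ← Path.Homotopic.Quotient.mk_map, ← Path.Homotopic.Quotient.mk_trans,
        Path.Homotopic.Quotient.eq.2 ((h.scU n).2 u _ hu
          (path_trans_mem (hw n k) (q := v.map j.continuous) (fun t => mU (hv t))))]
    · obtain ⟨v, hv, hdv⟩ := hd' n x hx hxU
      rw [hφ' n x hx, map_one, Path.Homotopic.Quotient.eq.2 ((h.scU n).2 u v hu hv)]
      have h1 := loopOf_choice d hd0 x
      rw [hdv, Path.Homotopic.Quotient.mk_trans, loopOf_trans, ← hd, loopOf_choice d hd0,
        mul_one] at h1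
      exact h1.symm
  have hΦF : ∀ γ, Φ (hol F γ) = loopClass d γ := by
    refine hF.map_hol ho hcov (isTransport_loopClass d) Φ ?_
    rintro V (rfl | ⟨n, rfl⟩) γ hγ
    · obtain ⟨γ', rfl⟩ := exists_lift_of_isOpenEmbedding h.emb γ hγ
      rw [F1, Φ1]
      exact map_loopOf j c d hd _
    · let p : Path (γ 0) (γ 1) := ⟨γ, rfl, rfl⟩
      obtain ⟨u, hu⟩ := (h.scU n).exists_path (mU (hpt n (k₀ n))) (hγ 0)
      rw [F2 n γ hγ, map_mul, map_inv, Φφ n _ u hu, Φφ n _ (u.trans p) (path_trans_mem hu hγ),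
        Path.Homotopic.Quotient.mk_trans, loopOf_trans]
      exact mul_inv_cancel_right _ _
  have hF_A : ∀ {a b} (p : Path a b), hol F (p.map j.continuous).toContinuousMap =
      .inl (loopOf c (Path.Homotopic.Quotient.mk p)) := by
    intro a b p
    rw [← loopClass_path, ← F1, hF.hol_eq_of_mem (Or.inl rfl)]
    · rfl
    · exact fun t => mem_range_self _
  -- The inverse of `Φ` is the holonomy on loops. One composite is the identity by `hΦF`, the other
  -- one is checked on the subgroup and on the free generators.
  let Ψ := hH.toHom (j a₀)
  have Ψ1 : ∀ γ, Ψ (FundamentalGroup.map j a₀ γ) = .inl γ := by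
    intro γ
    induction γ using Path.Homotopic.Quotient.ind with | mk p =>
    refine (hF_A p).trans ?_
    rw [loopOf_self c hc]
  have hΨd : ∀ {x y} (p : Path x y), Ψ (loopOf d (Path.Homotopic.Quotient.mk p)) =
      (hol F (d y).toContinuousMap)⁻¹ * (hol F p.toContinuousMap * hol F (d x).toContinuousMap) := by
    intro x y p
    change hol F (((d x).trans p).trans (d y).symm).toContinuousMap = _
    rw [hH.trans, hH.trans, hH.symm]
  refine ⟨MulEquiv.mk' ⟨Ψ, Φ, ?_, ?_⟩ (map_mul Ψ), Ψ1⟩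
  · intro γ
    induction γ using Path.Homotopic.Quotient.ind with | mk p =>
    refine (hΦF _).trans ?_
    rw [loopClass_path, loopOf_self d hd0]
  · intro g
    have : Ψ.comp Φ = MonoidHom.id _ := by
      refine Monoid.Coprod.hom_ext ?_ ?_
      · ext γ
        simp only [MonoidHom.comp_apply, MonoidHom.id_apply]
        rw [Φ1, Ψ1]
      · ext ⟨n, k, hk⟩
        simp only [MonoidHom.comp_apply, MonoidHom.id_apply]
        have hs : Monoid.Coprod.inr (FreeGroup.of ⟨n, k, hk⟩) = s n k := by simp only [s, dif_neg hk]
        -- The closing paths come from `c` and have trivial holonomy; only the crossing `w n k` of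
        -- the piece counts.
        rw [hs, Φs n k (w n k) (hw n k), hΨd, hd, hd, hF_A, hF_A, loopOf_choice c hc,
          loopOf_choice c hc, hF.hol_eq_of_mem (Or.inr ⟨n, rfl⟩) (hw n k), F2 n _ (hw n k)]
        have e1 : (w n k).toContinuousMap 1 = j (pt n k) := (w n k).target
        have e0 : (w n k).toContinuousMap 0 = j (pt n (k₀ n)) := (w n k).source
        rw [e1, e0, hφ n k _ (Path.refl _) (fun _ => hpt n k),
          hφ n _ _ (Path.refl _) (fun _ => hpt n _), Path.Homotopic.Quotient.mk_refl,
          Path.Homotopic.Quotient.mk_refl, loopOf_refl, loopOf_refl]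
        simp [s]
    exact congrArg (fun f => f g) this

end Attach

/-! ### Composition of free extensions of fundamental groups -/

section FreeExt

variable {A B X : Type*} [TopologicalSpace A] [TopologicalSpace B] [TopologicalSpace X]

/-- The free product of two free groups. -/
def freeGroupSum (α β : Type*) :
    Monoid.Coprod (FreeGroup α) (FreeGroup β) ≃* FreeGroup (α ⊕ β) :=
  MonoidHom.toMulEquiv
    (Monoid.Coprod.lift (FreeGroup.map Sum.inl) (FreeGroup.map Sum.inr))
    (FreeGroup.lift (Sum.elim (fun a => .inl (.of a)) (fun b => .inr (.of b))))
    (by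
      refine Monoid.Coprod.hom_ext ?_ ?_ <;>
      · ext a
        simp)
    (by
      ext (a | b) <;> simp)

theorem IsFreeExt.comp {j : C(A, B)} {k : C(B, X)} {S S' : Type*} (hj : IsFreeExt j S)
    (hk : IsFreeExt k S') : IsFreeExt (k.comp j) (S ⊕ S') := by
  intro a
  obtain ⟨e, he⟩ := hj a
  obtain ⟨e', he'⟩ := hk (j a)
  refine ⟨e'.trans (((MulEquiv.coprodCongr e (MulEquiv.refl _)).trans
    (MulEquiv.coprodAssoc _ _ _)).trans
      (MulEquiv.coprodCongr (MulEquiv.refl _) (freeGroupSum S S'))), fun γ => ?_⟩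
  have h : FundamentalGroup.map (k.comp j) a γ =
      FundamentalGroup.map k (j a) (FundamentalGroup.map j a γ) := by
    induction γ using Path.Homotopic.Quotient.ind with | mk p => rfl
  rw [h]
  simp only [MulEquiv.trans_apply]
  rw [he']
  simp only [MulEquiv.coprodCongr_apply, Monoid.Coprod.map_apply_inl, MonoidHom.coe_coe, he,
    MulEquiv.coprodAssoc_apply_inl_inl, MulEquiv.refl_apply]

/-- A map that induces isomorphisms on fundamental groups. -/
def IsPiOneIso (f : C(A, B)) : Prop :=
  ∀ a, Function.Bijective (FundamentalGroup.map f a)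

/-- The induced functor on fundamental groupoids is an equivalence, hence fully faithful, so no
control of base points is needed. -/
theorem isPiOneIso_of_homotopyEquiv (f : ContinuousMap.HomotopyEquiv A B) :
    IsPiOneIso f.toFun := by
  have hf : (FundamentalGroupoid.map f.toFun).FullyFaithful :=
    (FundamentalGroupoidFunctor.equivOfHomotopyEquiv f).fullyFaithfulFunctor
  exact fun a => hf.map_bijective _ _

theorem IsFreeExt.comp_iso {f : C(A, B)} {k : C(B, X)} {S : Type*} (hf : IsPiOneIso f)
    (hk : IsFreeExt k S) : IsFreeExt (k.comp f) S := by
  intro a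
  obtain ⟨e, he⟩ := hk (f a)
  let i := MulEquiv.ofBijective _ (hf a)
  refine ⟨e.trans (MulEquiv.coprodCongr i.symm (MulEquiv.refl _)), fun γ => ?_⟩
  have h : FundamentalGroup.map (k.comp f) a γ =
      FundamentalGroup.map k (f a) (FundamentalGroup.map f a γ) := by
    induction γ using Path.Homotopic.Quotient.ind with | mk p => rfl
  rw [h, MulEquiv.trans_apply, he]
  simp only [MulEquiv.coprodCongr_apply, Monoid.Coprod.map_apply_inl]
  congr 1
  exact i.symm_apply_apply γ

theorem IsFreeExt.congr {k : C(A, X)} {S S' : Type*} (hk : IsFreeExt k S) (e : S ≃ S') :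
    IsFreeExt k S' := by
  intro a
  obtain ⟨i, hi⟩ := hk a
  refine ⟨i.trans (MulEquiv.coprodCongr (MulEquiv.refl _) (FreeGroup.freeGroupCongr e)),
    fun γ => ?_⟩
  rw [MulEquiv.trans_apply, hi]
  simp

theorem IsFreeExt.injective {k : C(A, X)} {S : Type*} (hk : IsFreeExt k S) (a : A) :
    Function.Injective (FundamentalGroup.map k a) := by
  obtain ⟨e, he⟩ := hk a
  intro γ γ' h
  apply Monoid.Coprod.inl_injective (M := FundamentalGroup A a) (N := FreeGroup S)
  rw [← he, ← he, h]

theorem IsFreeExt.range {k : C(A, X)} {S : Type*} (hk : IsFreeExt k S) (a : A) :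
    Nonempty (FundamentalGroup X (k a) ≃*
      Monoid.Coprod (FundamentalGroup.map k a).range (FreeGroup S)) := by
  obtain ⟨e, -⟩ := hk a
  exact ⟨e.trans (MulEquiv.coprodCongr (MonoidHom.ofInjective (hk.injective a))
    (MulEquiv.refl _))⟩

end FreeExt

/-! ### Straight-line homotopies -/

section Straight

variable {F : Type*} [AddCommGroup F] [Module ℝ F] [TopologicalSpace F] [IsTopologicalAddGroup F]
  [ContinuousSMul ℝ F]

/-- Two maps to a set are homotopic if the set contains the segments between their values. -/
theorem homotopic_of_segment_subset {Z : Type*} [TopologicalSpace Z] {Q : Set F} (a b : C(Z, Q))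
    (h : ∀ z, segment ℝ (a z : F) (b z) ⊆ Q) : a.Homotopic b := by
  refine ⟨⟨⟨fun p => ⟨(1 - (p.1 : ℝ)) • (a p.2 : F) + (p.1 : ℝ) • (b p.2 : F), h p.2
    ⟨1 - p.1, p.1, by linarith [p.1.2.2], p.1.2.1, by ring, rfl⟩⟩, by fun_prop⟩, ?_, ?_⟩⟩
  · intro z; ext; simp
  · intro z; ext; simp

/-- Two straight-line homotopies in succession, from the identity to `r` and from `r` to the
constant `c`. The sets in question are not convex and in general not star-shaped, so the
intermediate map is needed. -/
theorem contractibleSpace_of_segment_subset {S : Set F} (r : F → F) (c : F) (hr : ContinuousOn r S)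
    (hne : S.Nonempty) (h₁ : ∀ z ∈ S, segment ℝ z (r z) ⊆ S)
    (h₂ : ∀ z ∈ S, segment ℝ (r z) c ⊆ S) : ContractibleSpace S := by
  obtain ⟨z₀, hz₀⟩ := hne
  have hc : c ∈ S := h₂ z₀ hz₀ (right_mem_segment ℝ _ _)
  let rr : C(S, S) := ⟨fun z => ⟨r z, h₁ z z.2 (right_mem_segment ℝ _ _)⟩,
    (continuousOn_iff_continuous_domRestrict.1 hr).subtype_mk _⟩
  rw [contractible_iff_id_nullhomotopic]
  refine ⟨⟨c, hc⟩, (homotopic_of_segment_subset (.id S) rr fun z => h₁ z z.2).trans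
    (homotopic_of_segment_subset rr (.const _ ⟨c, hc⟩) fun z => h₂ z z.2)⟩

/-- Paths in the image lift through the embedding, and the lifts are homotopic. -/
theorem isSC_range {S Y : Type*} [TopologicalSpace S] [TopologicalSpace Y] [SimplyConnectedSpace S]
    {f : S → Y} (hf : IsEmbedding f) : IsSC (range f) := by
  refine ⟨isPathConnected_range hf.continuous, fun x y p q hp hq => ?_⟩
  obtain ⟨x, rfl⟩ : x ∈ range f := by simpa using hp 0
  obtain ⟨y, rfl⟩ : y ∈ range f := by simpa using hp 1
  have lift : ∀ p : Path (f x) (f y), (∀ t, p t ∈ range f) →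
      ∃ p' : Path x y, p'.map hf.continuous = p := by
    intro p hp
    choose g hg using hp
    refine ⟨⟨⟨g, hf.isInducing.continuous_iff.2 ?_⟩, hf.injective ?_, hf.injective ?_⟩, ?_⟩
    · rw [show f ∘ g = p from funext hg]; exact p.continuous
    · simp [hg]
    · simp [hg]
    · ext t; exact hg t
  obtain ⟨p', rfl⟩ := lift p hp
  obtain ⟨q', rfl⟩ := lift q hq
  exact (SimplyConnectedSpace.paths_homotopic p' q').map ⟨f, hf.continuous⟩

end Straight

/-! ### Ordered coordinates on the unordered configuration space -/

section Coordinates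

variable {W : Type u} (G : SimpleGraph W)

/-- The coordinates of the ordered configurations of two distinct points of a graph. -/
def confSet : Set ((W → ℝ) × (W → ℝ)) :=
  {z | (∃ a b, (a = b ∨ G.Adj a b) ∧ z.1 ∈ segment ℝ (pt a) (pt b)) ∧
    (∃ a b, (a = b ∨ G.Adj a b) ∧ z.2 ∈ segment ℝ (pt a) (pt b)) ∧ z.1 ≠ z.2}

/-- The ordered configuration with given coordinates. -/
def ordConf (z : confSet G) : OrderedConf (Realization G) :=
  ⟨(⟨z.1.1, z.2.1⟩, ⟨z.1.2, z.2.2.1⟩), fun h => z.2.2.2 (congrArg Subtype.val h)⟩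

/-- The unordered configuration with given coordinates. -/
def unord (z : confSet G) : UC₂ G := Quotient.mk (swapSetoid (Realization G)) (ordConf G z)

/-- The set of unordered configurations with coordinates in a given set. -/
def down (Q : Set ((W → ℝ) × (W → ℝ))) : Set (UC₂ G) := {x | ∃ z : confSet G, z.1 ∈ Q ∧ unord G z = x}

variable {G}

theorem unord_eq_iff {z w : confSet G} : unord G z = unord G w ↔ w.1 = z.1 ∨ w.1 = z.1.swap := by
  refine (Quotient.eq (r := swapSetoid (Realization G))).trans ?_
  change ordConf G w = ordConf G z ∨ _ ↔ _
  refine or_congr ⟨fun h => ?_, fun h => by rw [Subtype.ext h]⟩ ?_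
  · exact congrArg (fun p : OrderedConf (Realization G) => (p.1.1.1, p.1.2.1)) h
  · rw [Prod.ext_iff]
    exact and_congr Subtype.ext_iff Subtype.ext_iff

theorem swap_mem_confSet {z : (W → ℝ) × (W → ℝ)} (h : z ∈ confSet G) : z.swap ∈ confSet G :=
  ⟨h.2.1, h.1, h.2.2.symm⟩

theorem continuous_unord : Continuous (unord G) := by
  refine continuous_quotient_mk'.comp ?_
  unfold ordConf
  exact Continuous.subtype_mk (((continuous_fst.comp continuous_subtype_val).subtype_mk _).prodMk
    ((continuous_snd.comp continuous_subtype_val).subtype_mk _)) _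

theorem unord_surjective : Function.Surjective (unord G) := by
  rintro ⟨p⟩
  exact ⟨⟨(p.1.1.1, p.1.2.1), p.1.1.2, p.1.2.2, fun h => p.2 (Subtype.ext h)⟩, rfl⟩

/-- The preimage of the image of an open set is its union with its swap. -/
theorem isOpenMap_unord : IsOpenMap (unord G) := by
  intro V hV
  have hq : IsQuotientMap (Quotient.mk (swapSetoid (Realization G))) := isQuotientMap_quotient_mk'
  refine hq.isOpen_preimage.1 ?_
  let c : OrderedConf (Realization G) → confSet G := fun p =>
    ⟨(p.1.1.1, p.1.2.1), p.1.1.2, p.1.2.2, fun h => p.2 (Subtype.ext h)⟩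
  have h1 : Continuous fun p : OrderedConf (Realization G) => p.1.1.1 :=
    continuous_subtype_val.comp (continuous_fst.comp continuous_subtype_val)
  have h2 : Continuous fun p : OrderedConf (Realization G) => p.1.2.1 :=
    continuous_subtype_val.comp (continuous_snd.comp continuous_subtype_val)
  have hc : Continuous c := (h1.prodMk h2).subtype_mk _
  let sw : confSet G → confSet G := fun z => ⟨z.1.swap, swap_mem_confSet z.2⟩
  have hsw : Continuous sw := (continuous_swap.comp continuous_subtype_val).subtype_mk _
  convert (hV.preimage hc).union (hV.preimage (hsw.comp hc)) using 1
  ext p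
  constructor
  · rintro ⟨z, hz, h⟩
    rcases unord_eq_iff.1 (show unord G z = unord G (c p) from h) with h | h
    · left
      rwa [mem_preimage, Subtype.ext h]
    · right
      have : sw (c p) = z := Subtype.ext (by simp [sw, h])
      rwa [mem_preimage, Function.comp_apply, this]
  · rintro (h | h)
    · exact ⟨c p, h, rfl⟩
    · exact ⟨sw (c p), h, unord_eq_iff.2 (Or.inr (by simp [sw])) |>.trans
        (show unord G (c p) = _ from rfl)⟩

/-- A set of pairs that is invariant under exchanging the components. -/
def Symmetric (Q : Set ((W → ℝ) × (W → ℝ))) : Prop := ∀ z ∈ Q, z.swap ∈ Q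

theorem unord_mem_down {Q : Set ((W → ℝ) × (W → ℝ))} (hs : Symmetric Q) {z : confSet G} :
    unord G z ∈ down G Q ↔ z.1 ∈ Q := by
  refine ⟨?_, fun h => ⟨z, h, rfl⟩⟩
  rintro ⟨w, hw, h⟩
  rcases unord_eq_iff.1 h with h | h
  · rwa [h]
  · rw [h]; exact hs _ hw

theorem down_mono {Q Q' : Set ((W → ℝ) × (W → ℝ))} (h : Q ⊆ Q') : down G Q ⊆ down G Q' := by
  rintro _ ⟨z, hz, rfl⟩
  exact ⟨z, h hz, rfl⟩

/-- The projection of a set of ordered configurations. -/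
def downMap {Q : Set ((W → ℝ) × (W → ℝ))} (hQ : Q ⊆ confSet G) (z : Q) : down G Q :=
  ⟨unord G ⟨z.1, hQ z.2⟩, _, z.2, rfl⟩

/-- Swap invariance of `Q` makes it saturated, so openness is inherited from the full configuration
space. -/
theorem isOpenQuotientMap_downMap {Q : Set ((W → ℝ) × (W → ℝ))} (hQ : Q ⊆ confSet G)
    (hs : Symmetric Q) : IsOpenQuotientMap (downMap hQ) := by
  refine ⟨?_, ?_, ?_⟩
  · rintro ⟨_, z, hz, rfl⟩
    exact ⟨⟨z.1, hz⟩, rfl⟩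
  · exact (continuous_unord.comp (continuous_subtype_val.subtype_mk _)).subtype_mk _
  · rintro V ⟨V', hV', rfl⟩
    refine ⟨unord G '' (Subtype.val ⁻¹' V'), isOpenMap_unord _ (hV'.preimage continuous_subtype_val),
      ?_⟩
    ext ⟨x, hx⟩
    constructor
    · rintro ⟨z, hz, rfl⟩
      exact ⟨⟨z.1, (unord_mem_down hs).1 hx⟩, hz, rfl⟩
    · rintro ⟨z, hz, h⟩
      exact ⟨⟨z.1, hQ z.2⟩, hz, congrArg Subtype.val h⟩

/-- The ambient space `Y` is left free because the same set has to be open in each of the successive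
stages of the attachment. -/
theorem isOpen_down {Q S V : Set ((W → ℝ) × (W → ℝ))} (hQ : Q ⊆ confSet G) (hs : Symmetric Q)
    (hV : IsOpen V) (hS : S = Q ∩ V) {Y : Set (UC₂ G)} (hY : Y ⊆ down G Q) :
    IsOpen {y : Y | (y : UC₂ G) ∈ down G S} := by
  subst hS
  have h := (isOpenQuotientMap_downMap hQ hs).isOpenMap _ (hV.preimage continuous_subtype_val)
  convert h.preimage (continuous_inclusion hY) using 1
  ext ⟨y, hy⟩
  constructor
  · rintro ⟨z, hz, rfl⟩
    exact ⟨⟨z.1, hz.1⟩, hz.2, rfl⟩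
  · rintro ⟨z, hz, h⟩
    exact ⟨⟨z.1, hQ z.2⟩, ⟨z.2, hz⟩, congrArg Subtype.val h⟩

/-- A relatively open set that is disjoint from its swap projects by an open embedding, so
contractibility upstairs is enough. -/
theorem isSC_down {Q S V : Set ((W → ℝ) × (W → ℝ))} (hQ : Q ⊆ confSet G) (hs : Symmetric Q)
    (hV : IsOpen V) (hS : S = Q ∩ V) (hd : ∀ z ∈ S, z.swap ∉ S) [ContractibleSpace S]
    {Y : Set (UC₂ G)} (hY : down G S ⊆ Y) :
    IsSC {y : Y | (y : UC₂ G) ∈ down G S} := by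
  have hSQ : S ⊆ Q := hS ▸ inter_subset_left
  have hSc := hSQ.trans hQ
  have hi : Function.Injective (downMap hSc) := by
    intro z w h
    rcases unord_eq_iff.1 (congrArg Subtype.val h) with h | h
    · exact Subtype.ext h.symm
    · exact absurd (h ▸ w.2) (hd _ z.2)
  have hcont : Continuous (downMap hSc) :=
    (continuous_unord.comp (continuous_subtype_val.subtype_mk _)).subtype_mk _
  have ho : IsOpenEmbedding (inclusion (down_mono hSQ) ∘ downMap hSc) := by
    refine .of_continuous_injective_isOpenMap ((continuous_inclusion _).comp hcont)
      ((inclusion_injective _).comp hi) ?_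
    rintro _ ⟨O, hO, rfl⟩
    convert (isOpenQuotientMap_downMap hQ hs).isOpenMap _
      ((hO.inter hV).preimage continuous_subtype_val) using 1
    ext y
    constructor
    · rintro ⟨z, hz, rfl⟩
      exact ⟨⟨z.1, hSQ z.2⟩, ⟨hz, (hS ▸ z.2 : z.1 ∈ Q ∩ V).2⟩, rfl⟩
    · rintro ⟨z, hz, rfl⟩
      exact ⟨⟨z.1, hS ▸ ⟨z.2, hz.2⟩⟩, hz.1, rfl⟩
  have he : IsEmbedding (Subtype.val ∘ (inclusion hY ∘ downMap hSc)) := by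
    have := IsEmbedding.subtypeVal.comp ho.isEmbedding
    exact this
  have he' : IsEmbedding (inclusion hY ∘ downMap hSc) :=
    IsEmbedding.of_comp ((continuous_inclusion _).comp hcont) continuous_subtype_val he
  convert isSC_range he' using 1
  ext ⟨y, hy⟩
  constructor
  · rintro ⟨z, hz, rfl⟩
    exact ⟨⟨z.1, hz⟩, rfl⟩
  · rintro ⟨z, h⟩
    exact ⟨⟨z.1, hSc z.2⟩, z.2, congrArg Subtype.val h⟩

/-- An equivariant straight-line deformation of ordered configurations descends to a homotopy
equivalence of spaces of unordered configurations. -/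
theorem exists_homotopyEquiv_down {Q Q' : Set ((W → ℝ) × (W → ℝ))} (hQ : Q ⊆ confSet G)
    (hs : Symmetric Q) (hs' : Symmetric Q') (hQ' : Q' ⊆ Q)
    (r : (W → ℝ) × (W → ℝ) → (W → ℝ) × (W → ℝ)) (hr : ContinuousOn r Q)
    (hrQ : ∀ z ∈ Q, r z ∈ Q') (hrid : ∀ z ∈ Q', r z = z) (hrs : ∀ z ∈ Q, r z.swap = (r z).swap)
    (hseg : ∀ z ∈ Q, segment ℝ z (r z) ⊆ Q) :
    ∃ e : ContinuousMap.HomotopyEquiv (down G Q') (down G Q),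
      e.toFun = ContinuousMap.inclusion (down_mono hQ') := by
  have hq := isOpenQuotientMap_downMap hQ hs
  have hq' := isOpenQuotientMap_downMap (hQ'.trans hQ) hs'
  have eqv : ∀ z w : Q, downMap hQ z = downMap hQ w → w.1 = z.1 ∨ w.1 = z.1.swap :=
    fun z w h => unord_eq_iff.1 (congrArg Subtype.val h)
  let rr : C(Q, Q') := ⟨fun z => ⟨r z, hrQ z z.2⟩,
    (continuousOn_iff_continuous_domRestrict.1 hr).subtype_mk _⟩
  let f : C(Q, down G Q') := ⟨fun z => downMap (hQ'.trans hQ) (rr z), hq'.continuous.comp rr.2⟩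
  have hf : ∀ z w : Q, downMap hQ z = downMap hQ w → f z = f w := by
    intro z w h
    refine Subtype.ext (unord_eq_iff.2 ?_)
    rcases eqv z w h with h | h
    · left
      change r w.1 = r z.1
      rw [h]
    · right
      change r w.1 = (r z.1).swap
      rw [h, hrs z.1 z.2]
  have hf' : Function.FactorsThrough f (⟨downMap hQ, hq.continuous⟩ : C(Q, down G Q)) :=
    fun z w h => hf z w h
  let R : C(down G Q, down G Q') :=
    IsQuotientMap.lift (f := ⟨downMap hQ, hq.continuous⟩) hq.isQuotientMap f hf'
  have hR : ∀ z, R (downMap hQ z) = f z := fun z =>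
    congrArg (fun g : C(Q, down G Q') => g z)
      (IsQuotientMap.lift_comp (f := ⟨downMap hQ, hq.continuous⟩) hq.isQuotientMap f hf')
  -- the homotopy
  have hmem : ∀ (t : I) (z : Q), (1 - (t : ℝ)) • z.1 + (t : ℝ) • r z.1 ∈ Q := fun t z =>
    hseg z z.2 ⟨1 - t, t, by linarith [t.2.2], t.2.1, by ring, rfl⟩
  let h : C(I × Q, down G Q) := ⟨fun p => downMap hQ ⟨_, hmem p.1 p.2⟩, by
    refine hq.continuous.comp (Continuous.subtype_mk ?_ _)
    have := continuousOn_iff_continuous_domRestrict.1 hr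
    have h2 : Continuous fun p : I × Q => r p.2.1 := this.comp continuous_snd
    exact ((continuous_const.sub (continuous_subtype_val.comp continuous_fst)).smul
      (continuous_subtype_val.comp continuous_snd)).add
        ((continuous_subtype_val.comp continuous_fst).smul h2)⟩
  -- The projection is open, so its product with the interval is again a quotient map and the
  -- equivariant homotopy descends.
  have hpq : IsQuotientMap (⟨Prod.map id (downMap hQ), continuous_id.prodMap hq.continuous⟩ :
      C(I × Q, I × down G Q)) := (IsOpenQuotientMap.id.prodMap hq).isQuotientMap
  have hh : Function.FactorsThrough h (⟨Prod.map id (downMap hQ),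
      continuous_id.prodMap hq.continuous⟩ : C(I × Q, I × down G Q)) := by
    rintro ⟨t, z⟩ ⟨t', w⟩ hzw
    obtain ⟨rfl, h2⟩ := Prod.ext_iff.1 hzw
    refine Subtype.ext (unord_eq_iff.2 ?_)
    rcases eqv z w h2 with h | h
    · left
      change (1 - (t : ℝ)) • w.1 + (t : ℝ) • r w.1 = (1 - (t : ℝ)) • z.1 + (t : ℝ) • r z.1
      rw [h]
    · right
      change (1 - (t : ℝ)) • w.1 + (t : ℝ) • r w.1 =
        ((1 - (t : ℝ)) • z.1 + (t : ℝ) • r z.1).swap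
      rw [h, hrs z.1 z.2]
      rfl
  let H : C(I × down G Q, down G Q) := IsQuotientMap.lift hpq h hh
  have hH : ∀ t z, H (t, downMap hQ z) = h (t, z) := fun t z =>
    congrArg (fun g : C(I × Q, down G Q) => g (t, z)) (IsQuotientMap.lift_comp hpq h hh)
  refine ⟨⟨ContinuousMap.inclusion (down_mono hQ'), R, ?_, ⟨?_⟩⟩, rfl⟩
  · have : R.comp (ContinuousMap.inclusion (down_mono hQ')) = ContinuousMap.id _ := by
      ext1 x
      obtain ⟨z, rfl⟩ := hq'.surjective x
      refine (hR ⟨z.1, hQ' z.2⟩).trans ?_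
      exact congrArg (downMap (hQ'.trans hQ)) (Subtype.ext (hrid _ z.2))
    rw [this]
  · refine ContinuousMap.Homotopy.symm ⟨H, fun x => ?_, fun x => ?_⟩
    · obtain ⟨z, rfl⟩ := hq.surjective x
      refine (hH _ _).trans ?_
      simp [h]
    · obtain ⟨z, rfl⟩ := hq.surjective x
      refine (hH _ _).trans ?_
      simp only [ContinuousMap.comp_apply, hR]
      refine Subtype.ext ?_
      simp only [h, f, rr, downMap, ContinuousMap.coe_mk]
      change _ = unord G ⟨r z, _⟩
      simp

end Coordinates

/-! ### Configurations in barycentric coordinates -/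

section Barycentric

variable {W : Type u} [Fintype W] {G : SimpleGraph W}

/-- Barycentric coordinates of the points of a graph. -/
structure IsPoint (G : SimpleGraph W) (x : W → ℝ) : Prop where
  nonneg : ∀ v, 0 ≤ x v
  sum : ∑ v, x v = 1
  supp : ∃ a b, (a = b ∨ G.Adj a b) ∧ ∀ v, x v ≠ 0 → v = a ∨ v = b

theorem pt_self {W : Type*} (v : W) : pt v v = 1 := by simp [pt]

theorem pt_ne {W : Type*} {v w : W} (h : w ≠ v) : pt v w = 0 := by simp [pt, h]

theorem sum_pt (v : W) : ∑ w, pt v w = 1 := by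
  rw [Finset.sum_eq_single v (fun w _ hw => pt_ne hw) (by simp), pt_self]

theorem pt_nonneg {W : Type*} (v w : W) : 0 ≤ pt v w := by
  by_cases h : w = v
  · rw [h, pt_self]; exact zero_le_one
  · rw [pt_ne h]

theorem isPoint_pt (v : W) : IsPoint G (pt v) where
  nonneg := pt_nonneg v
  sum := sum_pt v
  supp := ⟨v, v, Or.inl rfl, fun w hw => by
    by_contra h
    exact hw (pt_ne fun e => h (Or.inl e))⟩

theorem IsPoint.mono {x y : W → ℝ} (hx : IsPoint G x) (h0 : ∀ v, 0 ≤ y v) (h1 : ∑ v, y v = 1)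
    (hs : ∀ v, x v = 0 → y v = 0) : IsPoint G y := by
  obtain ⟨a, b, hab, h⟩ := hx.supp
  exact ⟨h0, h1, a, b, hab, fun v hv => h v fun e => hv (hs v e)⟩

theorem IsPoint.ne_zero {x : W → ℝ} (hx : IsPoint G x) : ∃ v, 0 < x v := by
  by_contra! h
  have := Finset.sum_nonpos fun v (_ : v ∈ Finset.univ) => h v
  rw [hx.sum] at this
  linarith

theorem IsPoint.le_one {x : W → ℝ} (hx : IsPoint G x) (v : W) : x v ≤ 1 := by
  rw [← hx.sum]
  exact Finset.single_le_sum (fun w _ => hx.nonneg w) (Finset.mem_univ v)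

theorem IsPoint.eq_pt {x : W → ℝ} (hx : IsPoint G x) {v : W} (h : x v = 1) : x = pt v := by
  ext w
  by_cases hw : w = v
  · rw [hw, h, pt_self]
  · rw [pt_ne hw]
    classical
    have h1 := Finset.add_sum_erase Finset.univ x (Finset.mem_univ v)
    rw [h, hx.sum] at h1
    have h2 : ∑ u ∈ Finset.univ.erase v, x u = 0 := by linarith
    exact (Finset.sum_eq_zero_iff_of_nonneg fun u _ => hx.nonneg u).1 h2 w (by simp [hw])

/-- The cell is the minimal one: all its vertices carry mass. A condition on the vertices of the
support is therefore a condition on this cell. -/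
theorem IsPoint.cases {x : W → ℝ} (hx : IsPoint G x) :
    (∃ a, x = pt a) ∨ ∃ a b, G.Adj a b ∧ x a ≠ 0 ∧ x b ≠ 0 ∧
      x ∈ segment ℝ (pt a) (pt b) := by
  classical
  obtain ⟨a, b, hab, h⟩ := hx.supp
  have hsum : a ≠ b → x a + x b = 1 := by
    intro hne
    rw [← hx.sum, ← Finset.sum_pair hne]
    refine Finset.sum_subset (Finset.subset_univ _) fun v _ hv => ?_
    by_contra h0
    rcases h v h0 with rfl | rfl <;> simp at hv
  rcases hab with rfl | hab
  · left
    refine ⟨a, hx.eq_pt ?_⟩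
    rw [← hx.sum]
    refine (Finset.sum_eq_single a (fun v _ hv => ?_) (by simp)).symm
    by_contra h0
    exact hv (by simpa using h v h0)
  · have hs := hsum hab.ne
    by_cases ha : x a = 0
    · exact Or.inl ⟨b, hx.eq_pt (by linarith)⟩
    by_cases hb : x b = 0
    · exact Or.inl ⟨a, hx.eq_pt (by linarith)⟩
    right
    refine ⟨a, b, hab, ha, hb, x a, x b, hx.nonneg a, hx.nonneg b, hs, ?_⟩
    ext v
    simp only [Pi.add_apply, Pi.smul_apply, smul_eq_mul]
    by_cases hva : v = a
    · subst hva; rw [pt_self, pt_ne hab.ne]; ring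
    by_cases hvb : v = b
    · subst hvb; rw [pt_self, pt_ne hab.ne']; ring
    rw [pt_ne hva, pt_ne hvb]
    by_contra h0
    rcases h v (fun e => h0 (by rw [e]; ring)) with h | h
    · exact hva h
    · exact hvb h

theorem segment_pt_supp {a b : W} {x : W → ℝ} (hx : x ∈ segment ℝ (pt a) (pt b)) {v : W}
    (hv : x v ≠ 0) : v = a ∨ v = b := by
  obtain ⟨s, t, -, -, -, rfl⟩ := hx
  by_contra! h
  simp [pt_ne h.1, pt_ne h.2] at hv

theorem isPoint_segment {a b : W} (hab : a = b ∨ G.Adj a b) {x : W → ℝ}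
    (hx : x ∈ segment ℝ (pt a) (pt b)) : IsPoint G x := by
  refine ⟨?_, ?_, a, b, hab, fun v => segment_pt_supp hx⟩
  · obtain ⟨s, t, hs, ht, -, rfl⟩ := hx
    intro v
    have := pt_nonneg a v
    have := pt_nonneg b v
    simp only [Pi.add_apply, Pi.smul_apply, smul_eq_mul]
    positivity
  · obtain ⟨s, t, hs, ht, hst, rfl⟩ := hx
    simp [Finset.sum_add_distrib, ← Finset.mul_sum, sum_pt, hst]

theorem isPoint_iff {x : W → ℝ} :
    IsPoint G x ↔ ∃ a b, (a = b ∨ G.Adj a b) ∧ x ∈ segment ℝ (pt a) (pt b) := by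
  constructor
  · intro hx
    rcases hx.cases with ⟨a, rfl⟩ | ⟨a, b, hab, -, -, h⟩
    · exact ⟨a, a, Or.inl rfl, left_mem_segment ℝ _ _⟩
    · exact ⟨a, b, Or.inr hab, h⟩
  · rintro ⟨a, b, hab, h⟩
    exact isPoint_segment hab h

theorem mem_confSet {z : (W → ℝ) × (W → ℝ)} :
    z ∈ confSet G ↔ IsPoint G z.1 ∧ IsPoint G z.2 ∧ z.1 ≠ z.2 := by
  rw [isPoint_iff, isPoint_iff]
  rfl

/-- The ordered configurations such that the supports of the two points are related. -/
def relSet (G : SimpleGraph W) (r : W → W → Prop) : Set ((W → ℝ) × (W → ℝ)) :=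
  {z | IsPoint G z.1 ∧ IsPoint G z.2 ∧ ∀ a b, z.1 a ≠ 0 → z.2 b ≠ 0 → r a b}

theorem relSet_subset {r : W → W → Prop} (hr : ∀ a, ¬ r a a) : relSet G r ⊆ confSet G := by
  rintro z ⟨h1, h2, h⟩
  refine mem_confSet.2 ⟨h1, h2, fun e => ?_⟩
  obtain ⟨v, hv⟩ := h1.ne_zero
  exact hr v (h v v hv.ne' (e ▸ hv.ne'))

theorem symmetric_relSet {r : W → W → Prop} (hr : ∀ a b, r a b → r b a) : Symmetric (relSet G r) :=
  fun _ ⟨h1, h2, h⟩ => ⟨h2, h1, fun a b ha hb => hr b a (h b a hb ha)⟩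

theorem down_eq {Q : Set ((W → ℝ) × (W → ℝ))} {x : UC₂ G} :
    x ∈ down G Q ↔ ∃ p : OrderedConf (Realization G), x = Quotient.mk (swapSetoid (Realization G)) p ∧
      (p.1.1.1, p.1.2.1) ∈ Q := by
  constructor
  · rintro ⟨z, hz, rfl⟩
    exact ⟨ordConf G z, rfl, hz⟩
  · rintro ⟨p, rfl, hp⟩
    exact ⟨⟨(p.1.1.1, p.1.2.1), p.1.1.2, p.1.2.2, fun h => p.2 (Subtype.ext h)⟩, hp, rfl⟩

/-- The space of the subcomplex of pairs of cells with related vertices. -/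
theorem space_eq_down {K : SquareComplex (Sym2 W)} {r : W → W → Prop}
    (hr : ∀ a b, r a b → r b a)
    (hv : ∀ v w, s(v, w) ∈ K.verts ↔ r v w)
    (ha : ∀ a b v, K.Adj s(a, v) s(b, v) ↔ G.Adj a b ∧ r a v ∧ r b v)
    (hq : ∀ a b c d, K.IsSquare s(a, c) s(b, c) s(b, d) s(a, d) ↔
      G.Adj a b ∧ G.Adj c d ∧ r a c ∧ r b c ∧ r b d ∧ r a d) :
    space G K = down G (relSet G r) := by
  have pts : ∀ {a v : W}, (pt a : W → ℝ) v ≠ 0 → v = a := fun h => by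
    by_contra e
    exact h (pt_ne e)
  ext x
  rw [down_eq]
  constructor
  · rintro ⟨p, rfl, h⟩
    refine ⟨p, rfl, ?_⟩
    rcases h with ⟨v, w, h, h1, h2⟩ | ⟨a, b, v, h, h1, h2⟩ | ⟨a, b, c, d, h, h1, h2⟩
    · refine ⟨isPoint_iff.2 p.1.1.2, isPoint_iff.2 p.1.2.2, fun e f he hf => ?_⟩
      simp only [h1, h2] at he hf
      rw [pts he, pts hf]
      exact (hv v w).1 h
    · obtain ⟨-, h3, h4⟩ := (ha a b v).1 h
      refine ⟨isPoint_iff.2 p.1.1.2, isPoint_iff.2 p.1.2.2, fun e f he hf => ?_⟩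
      simp only [h2] at hf
      rw [pts hf]
      rcases segment_pt_supp h1 he with rfl | rfl
      · exact h3
      · exact h4
    · obtain ⟨-, -, h3, h4, h5, h6⟩ := (hq a b c d).1 h
      refine ⟨isPoint_iff.2 p.1.1.2, isPoint_iff.2 p.1.2.2, fun e f he hf => ?_⟩
      rcases segment_pt_supp h1 he with rfl | rfl <;>
      rcases segment_pt_supp h2 hf with rfl | rfl <;> assumption
  · rintro ⟨p, rfl, h1, h2, h⟩
    simp only at h1 h2 h
    rcases h1.cases with ⟨a, h1'⟩ | ⟨a, b, hab, ha1, hb1, hx⟩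
    · have ha1 : p.1.1.1 a ≠ 0 := by rw [h1', pt_self]; exact one_ne_zero
      rcases h2.cases with ⟨c, h2'⟩ | ⟨c, d, hcd, hc, hd, hy⟩
      · have hc : p.1.2.1 c ≠ 0 := by rw [h2', pt_self]; exact one_ne_zero
        exact ⟨p, rfl, Or.inl ⟨a, c, (hv a c).2 (h a c ha1 hc), h1', h2'⟩⟩
      -- The cells of mixed type list the edge first, so here the two points are exchanged.
      · refine ⟨⟨(p.1.2, p.1.1), fun e => p.2 e.symm⟩,
          Quotient.sound (s := swapSetoid (Realization G)) (Or.inr ⟨rfl, rfl⟩), Or.inr (Or.inl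
          ⟨c, d, a, (ha c d a).2 ⟨hcd, hr _ _ (h a c ha1 hc), hr _ _ (h a d ha1 hd)⟩, hy, h1'⟩)⟩
    · rcases h2.cases with ⟨c, h2'⟩ | ⟨c, d, hcd, hc, hd, hy⟩
      · have hc : p.1.2.1 c ≠ 0 := by rw [h2', pt_self]; exact one_ne_zero
        exact ⟨p, rfl, Or.inr (Or.inl
          ⟨a, b, c, (ha a b c).2 ⟨hab, h a c ha1 hc, h b c hb1 hc⟩, hx, h2'⟩)⟩
      · exact ⟨p, rfl, Or.inr (Or.inr ⟨a, b, c, d, (hq a b c d).2 ⟨hab, hcd, h _ _ ha1 hc,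
          h _ _ hb1 hc, h _ _ hb1 hd, h _ _ ha1 hd⟩, hx, hy⟩)⟩

theorem mem_verts_UD₂ {v w : W} : s(v, w) ∈ (UD₂ G).verts ↔ v ≠ w := by
  constructor
  · rintro ⟨a, b, hab, h⟩
    rcases Sym2.eq_iff.1 h with ⟨rfl, rfl⟩ | ⟨rfl, rfl⟩
    · exact hab
    · exact hab.symm
  · exact fun h => ⟨v, w, h, rfl⟩

theorem UD₂_adj {a b v : W} : (UD₂ G).Adj s(a, v) s(b, v) ↔ G.Adj a b ∧ a ≠ v ∧ b ≠ v := by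
  constructor
  · rintro ⟨a', b', v', hab, h1, h2, h3, h4⟩
    have := hab.ne
    rcases Sym2.eq_iff.1 h3 with ⟨rfl, rfl⟩ | ⟨rfl, rfl⟩ <;>
    rcases Sym2.eq_iff.1 h4 with ⟨rfl, h⟩ | ⟨rfl, h⟩ <;> simp_all
    all_goals tauto
  · rintro ⟨h, h1, h2⟩
    exact ⟨a, b, v, h, h1.symm, h2.symm, rfl, rfl⟩

theorem UD₂_square {a b c d : W} : (UD₂ G).IsSquare s(a, c) s(b, c) s(b, d) s(a, d) ↔
    G.Adj a b ∧ G.Adj c d ∧ a ≠ c ∧ b ≠ c ∧ b ≠ d ∧ a ≠ d := by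
  constructor
  · intro h
    have h' := (UD₂ G).square_rotate h
    have h1 := UD₂_adj.1 ((UD₂ G).square_adj h)
    rw [Sym2.eq_swap (a := b) (b := c), Sym2.eq_swap (a := b) (b := d)] at h'
    have h2 := UD₂_adj.1 ((UD₂ G).square_adj h')
    have h3 := (UD₂ G).square_rotate h'
    rw [Sym2.eq_swap (a := d) (b := b)] at h3
    have h4 := UD₂_adj.1 ((UD₂ G).square_adj h3)
    exact ⟨h1.1, h2.1, h1.2.1, h1.2.2, h4.2.1, h4.2.2⟩
  · rintro ⟨h1, h2, h3, h4, h5, h6⟩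
    exact ⟨a, b, c, d, h1, h2, h3, h6, h4, h5, rfl, rfl, rfl, rfl⟩

theorem spaceUD₂_eq : spaceUD₂ G = down G (relSet G (· ≠ ·)) :=
  space_eq_down (fun _ _ => Ne.symm) (fun _ _ => mem_verts_UD₂)
    (fun _ _ _ => UD₂_adj) (fun _ _ _ _ => UD₂_square)

theorem down_confSet : down G (confSet G) = univ := by
  refine eq_univ_of_forall fun x => ?_
  obtain ⟨z, rfl⟩ := unord_surjective x
  exact ⟨z, z.2, rfl⟩

/-- Rescaling to coordinate sum one. -/
noncomputable def normalize (x : W → ℝ) : W → ℝ := fun v => x v / ∑ w, x w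

theorem continuousOn_normalize {Z : Type*} [TopologicalSpace Z] {S : Set Z} {f : Z → W → ℝ}
    (hf : ContinuousOn f S) (h : ∀ z ∈ S, ∑ w, f z w ≠ 0) :
    ContinuousOn (fun z => normalize (f z)) S := by
  rw [continuousOn_pi] at hf ⊢
  exact fun v => (hf v).div (continuousOn_finsetSum _ fun w _ => hf w) h

theorem sum_normalize {x : W → ℝ} (h : ∑ w, x w ≠ 0) : ∑ v, normalize x v = 1 := by
  simp only [normalize]
  rw [← Finset.sum_div, div_self h]

theorem normalize_eq_self {x : W → ℝ} (h : ∑ w, x w = 1) : normalize x = x := by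
  ext v; simp [normalize, h]

/-- Straight-line motion to the renormalization of a smaller vector. -/
theorem IsPoint.segment_normalize {x u : W → ℝ} (hx : IsPoint G x) (h0 : ∀ v, 0 ≤ u v)
    (hux : ∀ v, x v = 0 → u v = 0) (hu : 0 < ∑ v, u v) {s t : ℝ} (hs : 0 ≤ s) (ht : 0 ≤ t)
    (hst : s + t = 1) : IsPoint G (s • x + t • normalize u) := by
  refine hx.mono (fun v => ?_) ?_ fun v hv => ?_
  · have := hx.nonneg v
    have : 0 ≤ normalize u v := div_nonneg (h0 v) hu.le
    simp only [Pi.add_apply, Pi.smul_apply, smul_eq_mul]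
    positivity
  · simp only [Pi.add_apply, Pi.smul_apply, smul_eq_mul, Finset.sum_add_distrib, ← Finset.mul_sum]
    rw [hx.sum, sum_normalize hu.ne', mul_one, mul_one, hst]
  · simp [hv, normalize, hux v hv]

theorem IsPoint.normalize {x u : W → ℝ} (hx : IsPoint G x) (h0 : ∀ v, 0 ≤ u v)
    (hux : ∀ v, x v = 0 → u v = 0) (hu : 0 < ∑ v, u v) : IsPoint G (normalize u) := by
  simpa using hx.segment_normalize h0 hux hu le_rfl zero_le_one (zero_add 1)

/-- Both vectors have total mass one, so they cannot be comparable without being equal. -/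
theorem exists_lt_of_ne {x y : W → ℝ} (hx : IsPoint G x) (hy : IsPoint G y) (h : x ≠ y) :
    ∃ v, y v < x v := by
  by_contra! hle
  refine h (funext fun v => ?_)
  have : ∑ v, (y v - x v) = 0 := by rw [Finset.sum_sub_distrib, hx.sum, hy.sum, sub_self]
  have := (Finset.sum_eq_zero_iff_of_nonneg fun v _ => sub_nonneg.2 (hle v)).1 this v
    (Finset.mem_univ v)
  linarith

theorem sum_posPart_pos {x y : W → ℝ} (hx : IsPoint G x) (hy : IsPoint G y) (h : x ≠ y) :
    0 < ∑ v, max (x v - y v) 0 := by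
  obtain ⟨v, hv⟩ := exists_lt_of_ne hx hy h
  refine Finset.sum_pos' (fun w _ => le_max_right _ _) ⟨v, Finset.mem_univ v, ?_⟩
  exact lt_max_of_lt_left (sub_pos.2 hv)

/-- The unordered configuration space of a graph deforms onto the discrete one. -/
theorem exists_homotopyEquiv_UC₂ :
    ∃ e : ContinuousMap.HomotopyEquiv (down G (relSet G (· ≠ ·))) (down G (confSet G)),
      e.toFun = ContinuousMap.inclusion (down_mono (relSet_subset fun _ h => h rfl)) := by
  have hu : ∀ (x y : W → ℝ) v, 0 ≤ max (x v - y v) 0 := fun _ _ _ => le_max_right _ _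
  have hux : ∀ {x y : W → ℝ}, IsPoint G y → ∀ v, x v = 0 → max (x v - y v) 0 = 0 := by
    intro x y hy v hv
    rw [hv]
    exact max_eq_right (by linarith [hy.nonneg v])
  refine exists_homotopyEquiv_down subset_rfl (fun _ => swap_mem_confSet)
    (symmetric_relSet fun _ _ => Ne.symm) (relSet_subset fun _ h => h rfl)
    -- The common mass of the two points is removed and the remainders are rescaled. These have
    -- disjoint supports, since at each vertex at most one of the two differences is positive.
    (fun z => (normalize fun v => max (z.1 v - z.2 v) 0, normalize fun v => max (z.2 v - z.1 v) 0))
    ?_ ?_ ?_ (fun _ _ => rfl) ?_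
  · refine ContinuousOn.prodMk (continuousOn_normalize (by fun_prop) ?_)
      (continuousOn_normalize (by fun_prop) ?_)
    · intro z hz
      obtain ⟨h1, h2, h⟩ := mem_confSet.1 hz
      exact (sum_posPart_pos h1 h2 h).ne'
    · intro z hz
      obtain ⟨h1, h2, h⟩ := mem_confSet.1 hz
      exact (sum_posPart_pos h2 h1 h.symm).ne'
  · intro z hz
    obtain ⟨h1, h2, h⟩ := mem_confSet.1 hz
    refine ⟨h1.normalize (hu _ _) (hux h2) (sum_posPart_pos h1 h2 h),
      h2.normalize (hu _ _) (hux h1) (sum_posPart_pos h2 h1 h.symm), ?_⟩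
    rintro a _ ha hb rfl
    rcases le_total (z.1 a) (z.2 a) with h | h
    · exact ha (by simp [normalize, h])
    · exact hb (by simp [normalize, h])
  · rintro z ⟨h1, h2, h⟩
    have key : ∀ {x y : W → ℝ}, IsPoint G x → IsPoint G y → (∀ a b, x a ≠ 0 → y b ≠ 0 → a ≠ b) →
        (normalize fun v => max (x v - y v) 0) = x := by
      intro x y hx hy h
      have : (fun v => max (x v - y v) 0) = x := by
        ext v
        by_cases hv : x v = 0
        · rw [hux hy v hv, hv]
        · have : y v = 0 := by
            by_contra e
            exact h v v hv e rfl
          rw [this, sub_zero, max_eq_left (hx.nonneg v)]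
      rw [this, normalize_eq_self hx.sum]
    exact Prod.ext (key h1 h2 h) (key h2 h1 fun a b ha hb => (h b a hb ha).symm)
  · rintro z hz w ⟨s, t, hs, ht, hst, rfl⟩
    obtain ⟨h1, h2, h⟩ := mem_confSet.1 hz
    have p1 := sum_posPart_pos h1 h2 h
    refine mem_confSet.2 ⟨h1.segment_normalize (hu _ _) (hux h2) p1 hs ht hst,
      h2.segment_normalize (hu _ _) (hux h1) (sum_posPart_pos h2 h1 h.symm) hs ht hst, fun e => ?_⟩
    -- At a vertex where the first point has more mass, the remainder of the second one vanishes, so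
    -- the strict inequality persists along the segment.
    obtain ⟨v, hv⟩ := exists_lt_of_ne h1 h2 h
    have e := congrFun e v
    simp only [Prod.fst_add, Prod.smul_fst, Prod.snd_add, Prod.smul_snd, Pi.add_apply,
      Pi.smul_apply, smul_eq_mul, normalize] at e
    rw [max_eq_right (by linarith : z.2 v - z.1 v ≤ 0), zero_div, mul_zero, add_zero,
      max_eq_left (by linarith : 0 ≤ z.1 v - z.2 v)] at e
    have h3 : 0 < (z.1 v - z.2 v) / ∑ w, max (z.1 w - z.2 w) 0 := div_pos (by linarith) p1
    rcases hs.eq_or_lt with rfl | hs'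
    · have : t = 1 := by linarith
      subst this
      linarith
    · nlinarith [mul_nonneg ht h3.le, mul_lt_mul_of_pos_left hv hs']

end Barycentric

/-! ### Supports of points and midpoints of edges -/

section Points

variable {W : Type u} [Fintype W] {G : SimpleGraph W}

theorem IsPoint.pair {x : W → ℝ} (hx : IsPoint G x) {a b : W} (ha : x a ≠ 0) (hb : x b ≠ 0)
    (hab : a ≠ b) {c : W} (hc : x c ≠ 0) : c = a ∨ c = b := by
  obtain ⟨p, q, -, h⟩ := hx.supp
  have := h a ha
  have := h b hb
  have := h c hc
  grind

theorem IsPoint.adj {x : W → ℝ} (hx : IsPoint G x) {a b : W} (ha : x a ≠ 0) (hb : x b ≠ 0)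
    (hab : a ≠ b) : G.Adj a b := by
  obtain ⟨p, q, hpq, h⟩ := hx.supp
  have h1 := h a ha
  have h2 := h b hb
  rcases hpq with rfl | hpq
  · grind
  · rcases h1 with rfl | rfl <;> rcases h2 with rfl | rfl
    · exact absurd rfl hab
    · exact hpq
    · exact hpq.symm
    · exact absurd rfl hab

/-- A convex combination of two points on a common edge. -/
theorem IsPoint.combo {x y : W → ℝ} (hx : IsPoint G x) (hy : IsPoint G y) {a b : W}
    (hab : a = b ∨ G.Adj a b) (hxs : ∀ v, x v ≠ 0 → v = a ∨ v = b)
    (hys : ∀ v, y v ≠ 0 → v = a ∨ v = b) {s t : ℝ} (hs : 0 ≤ s) (ht : 0 ≤ t) (hst : s + t = 1) :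
    IsPoint G (s • x + t • y) where
  nonneg v := by
    have := hx.nonneg v
    have := hy.nonneg v
    simp only [Pi.add_apply, Pi.smul_apply, smul_eq_mul]
    positivity
  sum := by
    simp only [Pi.add_apply, Pi.smul_apply, smul_eq_mul, Finset.sum_add_distrib, ← Finset.mul_sum]
    rw [hx.sum, hy.sum, mul_one, mul_one, hst]
  supp := ⟨a, b, hab, fun v hv => by
    by_cases h : x v = 0
    · by_cases h' : y v = 0
      · simp [h, h'] at hv
      · exact hys v h'
    · exact hxs v h⟩

/-- The midpoint of two vertices. -/
noncomputable def mid (a b : W) : W → ℝ := (1 / 2 : ℝ) • pt a + (1 / 2 : ℝ) • pt b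

theorem isPoint_mid {a b : W} (h : G.Adj a b) : IsPoint G (mid a b) :=
  isPoint_segment (Or.inr h) ⟨1 / 2, 1 / 2, by norm_num, by norm_num, by norm_num, rfl⟩

theorem mid_supp {a b v : W} (h : mid a b v ≠ 0) : v = a ∨ v = b := by
  by_contra! e
  simp [mid, pt_ne e.1, pt_ne e.2] at h

theorem mid_left_pos {a b : W} : 0 < mid a b a := by
  have := pt_nonneg b a
  simp only [mid, Pi.add_apply, Pi.smul_apply, smul_eq_mul, pt_self]
  linarith

theorem mid_right_pos {a b : W} : 0 < mid a b b := by
  have := pt_nonneg a b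
  simp only [mid, Pi.add_apply, Pi.smul_apply, smul_eq_mul, pt_self]
  linarith

theorem pt_supp {W : Type*} {a v : W} (h : (pt a : W → ℝ) v ≠ 0) : v = a := by
  by_contra e
  exact h (pt_ne e)

end Points

/-! ### The graph -/

section Bunch

variable {V : Type u} {T : SimpleGraph V} {ℓ : V → ℕ}

/-- The vertex `b` of the `i`-th grape at `v`. -/
abbrev gv (ℓ : V → ℕ) (v : V) (i : Fin (ℓ v)) (b : Bool) : GrapeVertex ℓ := Sum.inr ⟨v, (i, b)⟩

/-- The collapse of the grapes. -/
def stemOf (a : GrapeVertex ℓ) : V := Sum.elim id Sigma.fst a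

@[simp] theorem stemOf_inl (v : V) : stemOf (Sum.inl v : GrapeVertex ℓ) = v := rfl

theorem bunch_adj_inl_inl {v w : V} : (bunch T ℓ).Adj (Sum.inl v) (Sum.inl w) ↔ T.Adj v w := by
  simp only [bunch, SimpleGraph.fromRel_adj]
  constructor
  · rintro ⟨-, h | h⟩ <;> cases h
    · assumption
    · exact SimpleGraph.Adj.symm ‹_›
  · intro h
    exact ⟨fun e => h.ne (Sum.inl_injective e), Or.inl (.twig v w h)⟩

theorem bunch_adj_inl_inr {v : V} {p : Σ v : V, Fin (ℓ v) × Bool} :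
    (bunch T ℓ).Adj (Sum.inl v) (Sum.inr p) ↔ p.1 = v := by
  simp only [bunch, SimpleGraph.fromRel_adj]
  constructor
  · rintro ⟨-, h | h⟩ <;> cases h
    rfl
  · rintro rfl
    exact ⟨by simp, Or.inl (.side p.1 p.2.1 p.2.2)⟩

theorem bunch_adj_inr_inr {v : V} {i : Fin (ℓ v)} {b : Bool} {p : Σ v : V, Fin (ℓ v) × Bool} :
    (bunch T ℓ).Adj (gv ℓ v i b) (Sum.inr p) ↔ p = ⟨v, (i, !b)⟩ := by
  simp only [bunch, SimpleGraph.fromRel_adj]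
  constructor
  · rintro ⟨-, h | h⟩ <;> cases h <;> rfl
  · rintro rfl
    refine ⟨by simp, ?_⟩
    cases b
    · exact Or.inl (.cap v i)
    · exact Or.inr (.cap v i)

/-- Only the twigs join vertices over different stem vertices. -/
theorem stemOf_adj {a b : GrapeVertex ℓ} (h : (bunch T ℓ).Adj a b) (hne : stemOf a ≠ stemOf b) :
    a = Sum.inl (stemOf a) ∧ b = Sum.inl (stemOf b) ∧ T.Adj (stemOf a) (stemOf b) := by
  rcases a with v | ⟨v, i, c⟩ <;> rcases b with w | ⟨w, j, d⟩
  · exact ⟨rfl, rfl, bunch_adj_inl_inl.1 h⟩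
  · exact absurd (bunch_adj_inl_inr.1 h).symm hne
  · exact absurd (bunch_adj_inl_inr.1 h.symm) hne
  · have := bunch_adj_inr_inr.1 h
    rw [this] at hne
    exact absurd rfl hne

variable [Fintype V]

theorem IsPoint.grape_supp {x : GrapeVertex ℓ → ℝ} (hx : IsPoint (bunch T ℓ) x) {v : V}
    {i : Fin (ℓ v)} {b : Bool} (h : x (gv ℓ v i b) ≠ 0) {a : GrapeVertex ℓ} (ha : x a ≠ 0) :
    a = Sum.inl v ∨ a = gv ℓ v i b ∨ a = gv ℓ v i (!b) := by
  by_cases hab : a = gv ℓ v i b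
  · exact Or.inr (Or.inl hab)
  · have := (hx.adj ha h hab).symm
    rcases a with w | p
    · exact Or.inl (congrArg Sum.inl (bunch_adj_inl_inr.1 this.symm).symm)
    · exact Or.inr (Or.inr (by rw [bunch_adj_inr_inr.1 this]))

theorem IsPoint.grape_unique {x : GrapeVertex ℓ → ℝ} (hx : IsPoint (bunch T ℓ) x) {v w : V}
    {i : Fin (ℓ v)} {b : Bool} {k : Fin (ℓ w)} {c : Bool} (h : x (gv ℓ v i b) ≠ 0)
    (h' : x (gv ℓ w k c) ≠ 0) : (⟨v, i⟩ : Σ v, Fin (ℓ v)) = ⟨w, k⟩ := by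
  rcases hx.grape_supp h h' with h | h | h
  · cases h
  · cases h; rfl
  · cases h; rfl

open Classical in
/-- The barycentric coordinates of the image of a point under the collapse of the grapes. -/
noncomputable def push (x : GrapeVertex ℓ → ℝ) (v : V) : ℝ :=
  ∑ a, if stemOf a = v then x a else 0

theorem continuous_push (v : V) : Continuous fun x : GrapeVertex ℓ → ℝ => push x v := by
  classical
  unfold push
  refine continuous_finsetSum _ fun a _ => ?_
  split_ifs
  · fun_prop
  · fun_prop

theorem push_ne_zero {x : GrapeVertex ℓ → ℝ} {v : V} (h : push x v ≠ 0) :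
    ∃ a, stemOf a = v ∧ x a ≠ 0 := by
  by_contra! h'
  exact h (Finset.sum_eq_zero fun a _ => by split_ifs with e; exacts [h' a e, rfl])

theorem push_nonneg {x : GrapeVertex ℓ → ℝ} (hx : ∀ a, 0 ≤ x a) (v : V) : 0 ≤ push x v :=
  Finset.sum_nonneg fun a _ => by split_ifs; exacts [hx a, le_rfl]

theorem le_push {x : GrapeVertex ℓ → ℝ} (hx : ∀ a, 0 ≤ x a) (a : GrapeVertex ℓ) :
    x a ≤ push x (stemOf a) := by
  classical
  have := Finset.single_le_sum (f := fun b => if stemOf b = stemOf a then x b else 0)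
    (fun b _ => by split_ifs; exacts [hx b, le_rfl]) (Finset.mem_univ a)
  simpa [push] using this

theorem sum_push (x : GrapeVertex ℓ → ℝ) : ∑ v, push x v = ∑ a, x a := by
  classical
  unfold push
  rw [Finset.sum_comm]
  simp

theorem IsPoint.push_eq {x : GrapeVertex ℓ → ℝ} (hx : IsPoint (bunch T ℓ) x) {v : V}
    (h : ∀ a, x a ≠ 0 → stemOf a = v) : push x = pt v := by
  ext w
  by_cases hw : w = v
  · subst hw
    rw [pt_self, ← hx.sum]
    refine Finset.sum_congr rfl fun a _ => ?_
    split_ifs with e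
    · rfl
    · by_contra h0
      exact e (h a (Ne.symm h0))
  · rw [pt_ne hw]
    by_contra h0
    obtain ⟨a, ha, hxa⟩ := push_ne_zero h0
    exact hw (ha.symm.trans (h a hxa))

/-- A point with mass at a free vertex of a grape lies in that grape, which collapses to its stem
vertex. -/
theorem IsPoint.push_grape {x : GrapeVertex ℓ → ℝ} (hx : IsPoint (bunch T ℓ) x) {v : V}
    {i : Fin (ℓ v)} {b : Bool} (h : x (gv ℓ v i b) ≠ 0) : push x = pt v := by
  refine hx.push_eq fun a ha => ?_
  rcases hx.grape_supp h ha with rfl | rfl | rfl <;> rfl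

/-- The mass of `x` that is not matched at the stem vertices by mass of `y` above them. -/
noncomputable def excess (x y : GrapeVertex ℓ → ℝ) (a : GrapeVertex ℓ) : ℝ :=
  Sum.elim (fun v => max (x (Sum.inl v) - push y v) 0) (fun p => x (Sum.inr p)) a

theorem excess_nonneg {x : GrapeVertex ℓ → ℝ} (hx : ∀ a, 0 ≤ x a) (y : GrapeVertex ℓ → ℝ)
    (a : GrapeVertex ℓ) : 0 ≤ excess x y a := by
  rcases a with v | p
  · exact le_max_right _ _
  · exact hx _

theorem excess_eq_zero {x y : GrapeVertex ℓ → ℝ} (hy : ∀ a, 0 ≤ y a) {a : GrapeVertex ℓ}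
    (h : x a = 0) : excess x y a = 0 := by
  rcases a with v | p
  · change max (x (Sum.inl v) - push y v) 0 = 0
    rw [h]
    exact max_eq_right (by linarith [push_nonneg hy v])
  · exact h

/-- If nothing is left over, then `x` lives on the stem and `push x ≤ push y`; equal total masses
force `push x = push y`. -/
theorem sum_excess_pos {x y : GrapeVertex ℓ → ℝ} (hx : IsPoint (bunch T ℓ) x)
    (hy : IsPoint (bunch T ℓ) y) (h : push x ≠ push y) : 0 < ∑ a, excess x y a := by
  by_contra h0
  have h1 : ∑ a, excess x y a = 0 :=
    le_antisymm (not_lt.1 h0) (Finset.sum_nonneg fun a _ => excess_nonneg hx.nonneg y a)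
  have h2 := (Finset.sum_eq_zero_iff_of_nonneg fun a _ => excess_nonneg hx.nonneg y a).1 h1
  have h3 : ∀ v, push x v ≤ push y v := by
    intro v
    have : push x v = x (Sum.inl v) := by
      classical
      unfold push
      rw [Finset.sum_eq_single (Sum.inl v)]
      · simp
      · rintro (w | p) - hne
        · rw [if_neg]
          rintro rfl
          exact hne rfl
        · have : x (Sum.inr p) = 0 := h2 (Sum.inr p) (Finset.mem_univ _)
          simp [this]
      · simp
    rw [this]
    have : max (x (Sum.inl v) - push y v) 0 = 0 := h2 (Sum.inl v) (Finset.mem_univ _)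
    have := le_max_left (x (Sum.inl v) - push y v) 0
    linarith
  refine h (funext fun v => ?_)
  have h4 : ∑ v, (push y v - push x v) = 0 := by
    rw [Finset.sum_sub_distrib, sum_push, sum_push, hx.sum, hy.sum, sub_self]
  have := (Finset.sum_eq_zero_iff_of_nonneg fun v _ => sub_nonneg.2 (h3 v)).1 h4 v
    (Finset.mem_univ v)
  linarith

/-- The pairs of points that are distinct in the stem. -/
def offDiag (T : SimpleGraph V) (ℓ : V → ℕ) :
    Set ((GrapeVertex ℓ → ℝ) × (GrapeVertex ℓ → ℝ)) :=
  relSet (bunch T ℓ) (· ≠ ·) ∩ {z | push z.1 ≠ push z.2}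

/-- Two vertices that lie over different vertices of the stem. -/
def Apart (a b : GrapeVertex ℓ) : Prop := stemOf a ≠ stemOf b

theorem isOpen_push_ne : IsOpen {z : (GrapeVertex ℓ → ℝ) × (GrapeVertex ℓ → ℝ) |
    push z.1 ≠ push z.2} := by
  have h : Continuous (push : (GrapeVertex ℓ → ℝ) → V → ℝ) := continuous_pi continuous_push
  exact isOpen_ne_fun (h.comp continuous_fst) (h.comp continuous_snd)

theorem symmetric_offDiag : Symmetric (offDiag T ℓ) := fun z hz =>
  ⟨symmetric_relSet (fun _ _ => Ne.symm) z hz.1, hz.2.symm⟩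

theorem symmetric_apart : Symmetric (relSet (bunch T ℓ) Apart) :=
  symmetric_relSet fun _ _ => Ne.symm

theorem apart_subset_offDiag : relSet (bunch T ℓ) Apart ⊆ offDiag T ℓ := by
  rintro z ⟨h1, h2, h⟩
  refine ⟨⟨h1, h2, ?_⟩, fun e => ?_⟩
  · rintro a _ ha hb rfl
    exact h a a ha hb rfl
  · obtain ⟨a, ha⟩ := h1.ne_zero
    have : push z.2 (stemOf a) ≠ 0 := by
      rw [← e]
      exact (ha.trans_le (le_push h1.nonneg a)).ne'
    obtain ⟨b, hb, hb'⟩ := push_ne_zero this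
    exact h a b ha.ne' hb' hb.symm

/-- Leftover mass of both points over `v` is impossible. If both have some at the stem vertex, then
`x v > push y v ≥ y v > push x v ≥ x v`. If one of them lies in a grape at `v`, its push is
concentrated at `v`, so the other one would need mass greater than one there. If both lie in grapes
at `v`, the pushes agree. -/
theorem excess_apart {x y : GrapeVertex ℓ → ℝ} (hx : IsPoint (bunch T ℓ) x)
    (hy : IsPoint (bunch T ℓ) y) (h : push x ≠ push y) {a b : GrapeVertex ℓ}
    (ha : excess x y a ≠ 0) (hb : excess y x b ≠ 0) : Apart a b := by
  intro hab
  have hxa : x a ≠ 0 := fun e => ha (excess_eq_zero hy.nonneg e)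
  have hyb : y b ≠ 0 := fun e => hb (excess_eq_zero hx.nonneg e)
  rcases a with v | ⟨v, i, c⟩ <;> rcases b with w | ⟨w, k, d⟩ <;> obtain rfl : v = w := hab
  · have h1 : push y v < x (Sum.inl v) := by
      by_contra h0
      exact ha (max_eq_right (by linarith))
    have h2 : push x v < y (Sum.inl v) := by
      by_contra h0
      exact hb (max_eq_right (by linarith))
    have h3 : x (Sum.inl v) ≤ push x v := le_push hx.nonneg (Sum.inl v)
    have h4 : y (Sum.inl v) ≤ push y v := le_push hy.nonneg (Sum.inl v)
    linarith
  · have h1 : push y v < x (Sum.inl v) := by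
      by_contra h0
      exact ha (max_eq_right (by linarith))
    rw [hy.push_grape hyb, pt_self] at h1
    linarith [hx.le_one (Sum.inl v)]
  · have h1 : push x v < y (Sum.inl v) := by
      by_contra h0
      exact hb (max_eq_right (by linarith))
    rw [hx.push_grape hxa, pt_self] at h1
    linarith [hy.le_one (Sum.inl v)]
  · exact h (by rw [hx.push_grape hxa, hy.push_grape hyb])

theorem continuous_excess : Continuous fun z : (GrapeVertex ℓ → ℝ) × (GrapeVertex ℓ → ℝ) =>
    excess z.1 z.2 := by
  refine continuous_pi fun a => ?_
  rcases a with v | p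
  · exact ((continuous_apply _).comp continuous_fst |>.sub
      ((continuous_push v).comp continuous_snd)).max continuous_const
  · change Continuous fun z : (GrapeVertex ℓ → ℝ) × (GrapeVertex ℓ → ℝ) => z.1 (Sum.inr p)
    fun_prop

theorem normalize_excess {x y : GrapeVertex ℓ → ℝ} (hx : IsPoint (bunch T ℓ) x)
    (hy : IsPoint (bunch T ℓ) y) (h : ∀ a b, x a ≠ 0 → y b ≠ 0 → Apart a b) :
    normalize (excess x y) = x := by
  have : excess x y = x := by
    ext a
    by_cases ha : x a = 0
    · rw [excess_eq_zero hy.nonneg ha, ha]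
    rcases a with v | p
    · have h0 : push y v = 0 := by
        by_contra h0
        obtain ⟨b, hb, hyb⟩ := push_ne_zero h0
        exact h _ b ha hyb hb.symm
      change max (x (Sum.inl v) - push y v) 0 = x (Sum.inl v)
      rw [h0, sub_zero, max_eq_left (hx.nonneg _)]
    · rfl
  rw [this, normalize_eq_self hx.sum]

/-- If the unmatched mass of `x` lies over a vertex that carries no mass of `y`, then this remains
true along the deformation. -/
theorem push_segment_ne {x y : GrapeVertex ℓ → ℝ} (hx : IsPoint (bunch T ℓ) x)
    (hy : IsPoint (bunch T ℓ) y) (h : push x ≠ push y) {a : GrapeVertex ℓ}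
    (ha : excess x y a ≠ 0) (hya : push y (stemOf a) = 0) {s t : ℝ} (hs : 0 ≤ s) (ht : 0 ≤ t)
    (hst : s + t = 1) : push (s • x + t • normalize (excess x y)) ≠
      push (s • y + t • normalize (excess y x)) := by
  intro e
  have p1 := hx.segment_normalize (excess_nonneg hx.nonneg y)
    (fun v => excess_eq_zero hy.nonneg) (sum_excess_pos hx hy h) hs ht hst
  have hxa : 0 < x a := lt_of_le_of_ne (hx.nonneg a) fun e => ha (excess_eq_zero hy.nonneg e.symm)
  have hna : 0 < normalize (excess x y) a :=
    div_pos (lt_of_le_of_ne (excess_nonneg hx.nonneg y a) ha.symm) (sum_excess_pos hx hy h)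
  have h1 : 0 < (s • x + t • normalize (excess x y)) a := by
    simp only [Pi.add_apply, Pi.smul_apply, smul_eq_mul]
    rcases hs.eq_or_lt with rfl | hs'
    · have : t = 1 := by linarith
      rw [this]; linarith
    · have := mul_nonneg ht hna.le
      have := mul_pos hs' hxa
      linarith
  have h2 := h1.trans_le (le_push p1.nonneg a)
  rw [e] at h2
  obtain ⟨b, hb, hb'⟩ := push_ne_zero h2.ne'
  have hyb : y b = 0 := by
    have := le_push hy.nonneg b
    rw [hb, hya] at this
    exact le_antisymm this (hy.nonneg b)
  refine hb' ?_
  simp [hyb, normalize, excess_eq_zero hx.nonneg hyb]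

/-- The pairs of points that are distinct in the stem deform onto the pairs of points that have
disjoint supports in the stem. -/
theorem exists_homotopyEquiv_offDiag :
    ∃ e : ContinuousMap.HomotopyEquiv (down (bunch T ℓ) (relSet (bunch T ℓ) Apart))
        (down (bunch T ℓ) (offDiag T ℓ)),
      e.toFun = ContinuousMap.inclusion (down_mono apart_subset_offDiag) := by
  refine exists_homotopyEquiv_down
    (inter_subset_left.trans (relSet_subset fun _ h => h rfl)) symmetric_offDiag symmetric_apart
    apart_subset_offDiag
    (fun z => (normalize (excess z.1 z.2), normalize (excess z.2 z.1))) ?_ ?_ ?_ (fun _ _ => rfl) ?_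
  · refine ContinuousOn.prodMk (continuousOn_normalize continuous_excess.continuousOn ?_)
      (continuousOn_normalize (continuous_excess.comp continuous_swap).continuousOn ?_)
    · exact fun z hz => (sum_excess_pos hz.1.1 hz.1.2.1 hz.2).ne'
    · exact fun z hz => (sum_excess_pos hz.1.2.1 hz.1.1 hz.2.symm).ne'
  · rintro z ⟨⟨h1, h2, -⟩, h⟩
    refine ⟨h1.normalize (excess_nonneg h1.nonneg _) (fun v => excess_eq_zero h2.nonneg)
      (sum_excess_pos h1 h2 h), h2.normalize (excess_nonneg h2.nonneg _)
      (fun v => excess_eq_zero h1.nonneg) (sum_excess_pos h2 h1 h.symm), fun a b ha hb => ?_⟩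
    exact excess_apart h1 h2 h (fun e => ha (by simp [normalize, e]))
      (fun e => hb (by simp [normalize, e]))
  · rintro z ⟨h1, h2, h⟩
    exact Prod.ext (normalize_excess h1 h2 h)
      (normalize_excess h2 h1 fun a b ha hb => (h b a hb ha).symm)
  · rintro z ⟨⟨h1, h2, hd⟩, h⟩ w ⟨s, t, hs, ht, hst, rfl⟩
    have p1 := sum_excess_pos h1 h2 h
    have p2 := sum_excess_pos h2 h1 h.symm
    refine ⟨⟨h1.segment_normalize (excess_nonneg h1.nonneg _) (fun v => excess_eq_zero h2.nonneg)
      p1 hs ht hst, h2.segment_normalize (excess_nonneg h2.nonneg _)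
      (fun v => excess_eq_zero h1.nonneg) p2 hs ht hst, fun a b ha hb => ?_⟩, ?_⟩
    · refine hd a b (fun e => ha ?_) fun e => hb ?_
      · simp [e, normalize, excess_eq_zero h2.nonneg e]
      · simp [e, normalize, excess_eq_zero h1.nonneg e]
    -- Leftover mass of one point over a stem vertex free of the other one keeps the pushes
    -- distinct. If neither point has such mass, both would have mass over the two ends of a twig,
    -- and their supports would share a vertex.
    · obtain ⟨a, -, ha⟩ := Finset.exists_ne_zero_of_sum_ne_zero p1.ne'
      obtain ⟨b, -, hb⟩ := Finset.exists_ne_zero_of_sum_ne_zero p2.ne'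
      have hab := excess_apart h1 h2 h ha hb
      by_cases hya : push z.2 (stemOf a) = 0
      · exact push_segment_ne h1 h2 h ha hya hs ht hst
      by_cases hxb : push z.1 (stemOf b) = 0
      · exact (push_segment_ne h2 h1 h.symm hb hxb hs ht hst).symm
      exfalso
      obtain ⟨b', hb', hyb'⟩ := push_ne_zero hya
      obtain ⟨a', ha', hxa'⟩ := push_ne_zero hxb
      have hxa : z.1 a ≠ 0 := fun e => ha (excess_eq_zero h2.nonneg e)
      have hyb : z.2 b ≠ 0 := fun e => hb (excess_eq_zero h1.nonneg e)
      have n1 : stemOf a ≠ stemOf a' := by rw [ha']; exact hab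
      have n2 : stemOf b ≠ stemOf b' := by rw [hb']; exact hab.symm
      obtain ⟨e1, -, -⟩ := stemOf_adj (h1.adj hxa hxa' fun e => n1 (by rw [e])) n1
      obtain ⟨-, e2, -⟩ := stemOf_adj (h2.adj hyb hyb' fun e => n2 (by rw [e])) n2
      rw [hb'] at e2
      exact hd a b' hxa hyb' (e1.trans e2.symm)

end Bunch

/-! ### Attaching pieces to spaces of unordered configurations -/

section Stage

variable {W : Type u} {G : SimpleGraph W}

/-- The symmetric set obtained by adding a family of sets of ordered configurations. -/
def addPieces {ι : Type*} (Q : Set ((W → ℝ) × (W → ℝ))) (S : ι → Set ((W → ℝ) × (W → ℝ))) :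
    Set ((W → ℝ) × (W → ℝ)) := Q ∪ {z | ∃ n, z ∈ S n ∨ z.swap ∈ S n}

/-- `S` is a relatively open subset of `Q`. -/
def RelOpen (Q S : Set ((W → ℝ) × (W → ℝ))) : Prop := ∃ V, IsOpen V ∧ S = Q ∩ V

variable {Q Q₀ : Set ((W → ℝ) × (W → ℝ))} {ι : Type*} {K : ι → Type*}
  {S : ι → Set ((W → ℝ) × (W → ℝ))} {C : ∀ n, K n → Set ((W → ℝ) × (W → ℝ))}

theorem symmetric_addPieces (hs : Symmetric Q₀) : Symmetric (addPieces Q₀ S) := by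
  rintro z (h | ⟨n, h⟩)
  · exact Or.inl (hs z h)
  · exact Or.inr ⟨n, by rwa [Prod.swap_swap, or_comm]⟩

theorem subset_addPieces : Q₀ ⊆ addPieces Q₀ S := subset_union_left

theorem RelOpen.addPieces (hs : Symmetric Q) (h₀ : RelOpen Q Q₀) (h : ∀ n, RelOpen Q (S n)) :
    RelOpen Q (addPieces Q₀ S) := by
  obtain ⟨V₀, hV₀, rfl⟩ := h₀
  choose V hV hSV using h
  obtain rfl : S = fun n => Q ∩ V n := funext hSV
  refine ⟨V₀ ∪ ⋃ n, (V n ∪ Prod.swap ⁻¹' V n), hV₀.union (isOpen_iUnion fun n =>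
    (hV n).union ((hV n).preimage continuous_swap)), ?_⟩
  ext z
  simp only [GraphBraid.addPieces, mem_union, mem_inter_iff, mem_ofPred_eq, mem_iUnion, mem_preimage]
  have : z.swap ∈ Q ↔ z ∈ Q := ⟨fun h => by simpa using hs _ h, hs z⟩
  rw [this]
  constructor
  · rintro (⟨h, h'⟩ | ⟨n, ⟨h, h'⟩ | ⟨h, h'⟩⟩)
    · exact ⟨h, Or.inl h'⟩
    · exact ⟨h, Or.inr ⟨n, Or.inl h'⟩⟩
    · exact ⟨h, Or.inr ⟨n, Or.inr h'⟩⟩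
  · rintro ⟨h, h' | ⟨n, h' | h'⟩⟩
    · exact Or.inl ⟨h, h'⟩
    · exact Or.inr ⟨n, Or.inl ⟨h, h'⟩⟩
    · exact Or.inr ⟨n, Or.inr ⟨h, h'⟩⟩

/-- Contractible pieces with contractible components of the intersections. -/
structure IsPieces (Q Q₀ : Set ((W → ℝ) × (W → ℝ))) (S : ι → Set ((W → ℝ) × (W → ℝ)))
    (C : ∀ n, K n → Set ((W → ℝ) × (W → ℝ))) : Prop where
  openS : ∀ n, RelOpen Q (S n)
  contrS : ∀ n, ContractibleSpace (S n)
  disjS : ∀ {n m z}, z ∈ S n → z ∈ S m → n = m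
  swapS : ∀ {n m z}, z ∈ S n → z.swap ∉ S m
  openC : ∀ n k, RelOpen Q (C n k)
  contrC : ∀ n k, ContractibleSpace (C n k)
  disjC : ∀ {n k l z}, z ∈ C n k → z ∈ C n l → k = l
  inter : ∀ n z, z ∈ Q₀ ∧ z ∈ S n ↔ ∃ k, z ∈ C n k

/-- All sets are cut out of `Q` by open conditions, so openness at every stage is inherited from
`Q`. By `swapS` no piece meets the swap of a piece, so the pieces remain embedded and disjoint after
passing to unordered pairs. -/
theorem IsPieces.isAttached (h : IsPieces Q Q₀ S C) (hQ : Q ⊆ confSet G) (hs : Symmetric Q)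
    (h₀ : RelOpen Q Q₀) (hs₀ : Symmetric Q₀) :
    IsAttached (ContinuousMap.inclusion (down_mono (G := G) (subset_addPieces (Q₀ := Q₀) (S := S))))
      (fun n => {y | (y : UC₂ G) ∈ down G (S n)}) (fun n k => {y | (y : UC₂ G) ∈ down G (C n k)}) := by
  have hCS : ∀ {n k z}, z ∈ C n k → z ∈ Q₀ ∧ z ∈ S n := fun hz => (h.inter _ _).2 ⟨_, hz⟩
  have hQ₁ : addPieces Q₀ S ⊆ Q := by
    obtain ⟨V, -, hV⟩ := RelOpen.addPieces hs h₀ h.openS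
    exact hV ▸ inter_subset_left
  have hQ₀ : Q₀ ⊆ Q := subset_addPieces.trans hQ₁
  have hS : ∀ n, S n ⊆ addPieces Q₀ S := fun n z hz => Or.inr ⟨n, Or.inl hz⟩
  constructor
  · refine ⟨IsEmbedding.inclusion (down_mono subset_addPieces), ?_⟩
    obtain ⟨V, hV, hV'⟩ := h₀
    convert isOpen_down hQ hs hV hV' (down_mono hQ₁) using 1
    ext y
    exact ⟨fun ⟨a, ha⟩ => ha ▸ a.2, fun hy => ⟨⟨y, hy⟩, rfl⟩⟩
  · intro n
    obtain ⟨V, hV, hV'⟩ := h.openS n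
    exact isOpen_down hQ hs hV hV' (down_mono hQ₁)
  · intro n
    obtain ⟨V, hV, hV'⟩ := h.openS n
    have := h.contrS n
    exact isSC_down hQ hs hV hV' (fun z hz => h.swapS hz) (down_mono (hS n))
  · rintro n m ⟨x, hx⟩ ⟨z, hz, hzx⟩ ⟨w, hw, hwx⟩
    rcases unord_eq_iff.1 (hzx.trans hwx.symm) with e | e
    · exact h.disjS hz (e ▸ hw)
    · exact absurd (e ▸ hw) (h.swapS hz)
  · intro n k
    obtain ⟨V, hV, hV'⟩ := h.openC n k
    exact isOpen_down hQ hs hV hV' (down_mono hQ₀)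
  · intro n k
    obtain ⟨V, hV, hV'⟩ := h.openC n k
    have := h.contrC n k
    exact isSC_down hQ hs hV hV' (fun z hz hz' => h.swapS (hCS hz).2 (hCS hz').2)
      (down_mono fun z hz => (hCS hz).1)
  · rintro n k l ⟨x, hx⟩ ⟨z, hz, hzx⟩ ⟨w, hw, hwx⟩
    rcases unord_eq_iff.1 (hzx.trans hwx.symm) with e | e
    · exact h.disjC hz (e ▸ hw)
    · exact absurd (e ▸ (hCS hw).2) (h.swapS (hCS hz).2)
  · rintro n ⟨x, hx⟩
    constructor
    · rintro ⟨z, hz, rfl⟩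
      obtain ⟨k, hk⟩ := (h.inter n z).1 ⟨(unord_mem_down hs₀).1 hx, hz⟩
      exact ⟨k, z, hk, rfl⟩
    · rintro ⟨k, z, hz, rfl⟩
      exact ⟨z, (hCS hz).2, rfl⟩
  · rintro ⟨_, z, hz | ⟨n, hz | hz⟩, rfl⟩
    · exact Or.inl ⟨⟨_, z, hz, rfl⟩, rfl⟩
    · exact Or.inr ⟨n, z, hz, rfl⟩
    · exact Or.inr ⟨n, ⟨z.1.swap, swap_mem_confSet z.2⟩, hz, unord_eq_iff.2 (Or.inr (by simp))⟩

end Stage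

/-! ### The pieces of the configuration space of a bunch of grapes -/

section Pieces

variable {V : Type u} [Fintype V] (T : SimpleGraph V) (ℓ : V → ℕ)

/-- The discrete configurations. -/
abbrev disc : Set ((GrapeVertex ℓ → ℝ) × (GrapeVertex ℓ → ℝ)) := relSet (bunch T ℓ) (· ≠ ·)

/-- One point in the part of a grape away from the stem, the other one near the stem vertex. -/
def capStem (n : Σ v, Fin (ℓ v)) : Set ((GrapeVertex ℓ → ℝ) × (GrapeVertex ℓ → ℝ)) :=
  disc T ℓ ∩ {z | 0 < z.1 (gv ℓ n.1 n.2 false) + z.1 (gv ℓ n.1 n.2 true) ∧ 0 < z.2 (Sum.inl n.1)}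

/-- One point in the part of a grape away from the stem, the other one in a twig. -/
def capTwig (n : Σ v, Fin (ℓ v)) (w : {w // T.Adj n.1 w}) :
    Set ((GrapeVertex ℓ → ℝ) × (GrapeVertex ℓ → ℝ)) :=
  disc T ℓ ∩ {z | (0 < z.1 (gv ℓ n.1 n.2 false) + z.1 (gv ℓ n.1 n.2 true) ∧
    0 < z.2 (Sum.inl n.1)) ∧ 0 < z.2 (Sum.inl w.1)}

/-- The two points near the two vertices of a grape. -/
def bothGrape (n : Σ v, Fin (ℓ v)) : Set ((GrapeVertex ℓ → ℝ) × (GrapeVertex ℓ → ℝ)) :=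
  disc T ℓ ∩ {z | 0 < z.1 (gv ℓ n.1 n.2 false) ∧ 0 < z.2 (gv ℓ n.1 n.2 true)}

/-- The components of the intersection of `bothGrape` with `capStem`. -/
def bothGrapeSide (n : Σ v, Fin (ℓ v)) (b : Bool) :
    Set ((GrapeVertex ℓ → ℝ) × (GrapeVertex ℓ → ℝ)) :=
  disc T ℓ ∩ {z | (0 < z.1 (gv ℓ n.1 n.2 false) ∧ 0 < z.2 (gv ℓ n.1 n.2 true)) ∧
    0 < cond b (z.1 (Sum.inl n.1)) (z.2 (Sum.inl n.1))}

/-- The two points in the parts of two different grapes away from their common stem vertex. -/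
def twoGrapes (n : Σ v, {p : Fin (ℓ v) × Fin (ℓ v) // p.1 < p.2}) :
    Set ((GrapeVertex ℓ → ℝ) × (GrapeVertex ℓ → ℝ)) :=
  disc T ℓ ∩ {z | 0 < z.1 (gv ℓ n.1 n.2.1.1 false) + z.1 (gv ℓ n.1 n.2.1.1 true) ∧
    0 < z.2 (gv ℓ n.1 n.2.1.2 false) + z.2 (gv ℓ n.1 n.2.1.2 true)}

/-- The components of the intersection of `twoGrapes` with `capStem`. -/
def twoGrapesSide (n : Σ v, {p : Fin (ℓ v) × Fin (ℓ v) // p.1 < p.2}) (b : Bool × Bool) :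
    Set ((GrapeVertex ℓ → ℝ) × (GrapeVertex ℓ → ℝ)) :=
  disc T ℓ ∩ {z | (0 < z.1 (gv ℓ n.1 n.2.1.1 false) + z.1 (gv ℓ n.1 n.2.1.1 true) ∧
    0 < z.2 (gv ℓ n.1 n.2.1.2 false) + z.2 (gv ℓ n.1 n.2.1.2 true)) ∧
    (0 < cond b.1 (z.1 (Sum.inl n.1)) (z.2 (Sum.inl n.1)) ∧
      0 < cond b.1 (z.1 (gv ℓ n.1 n.2.1.1 b.2)) (z.2 (gv ℓ n.1 n.2.1.2 b.2)))}

variable {T ℓ}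

theorem grape_of_sum_pos {x : GrapeVertex ℓ → ℝ} {v : V} {i : Fin (ℓ v)}
    (h : 0 < x (gv ℓ v i false) + x (gv ℓ v i true)) : ∃ b, x (gv ℓ v i b) ≠ 0 := by
  by_contra! h'
  rw [h', h'] at h
  simp at h

theorem sum_pos_of_grape {x : GrapeVertex ℓ → ℝ} (hx : ∀ a, 0 ≤ x a) {v : V} {i : Fin (ℓ v)}
    {b : Bool} (h : x (gv ℓ v i b) ≠ 0) : 0 < x (gv ℓ v i false) + x (gv ℓ v i true) := by
  have h1 := hx (gv ℓ v i false)
  have h2 := hx (gv ℓ v i true)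
  have h3 := lt_of_le_of_ne (hx (gv ℓ v i b)) h.symm
  cases b <;> linarith

/-- The support of a point that has a coordinate at a grape but not at the stem. -/
theorem IsPoint.cap_supp {x : GrapeVertex ℓ → ℝ} (hx : IsPoint (bunch T ℓ) x) {v : V}
    {i : Fin (ℓ v)} (h : 0 < x (gv ℓ v i false) + x (gv ℓ v i true)) (h0 : x (Sum.inl v) = 0)
    {a : GrapeVertex ℓ} (ha : x a ≠ 0) : a = gv ℓ v i false ∨ a = gv ℓ v i true := by
  obtain ⟨b, hb⟩ := grape_of_sum_pos h
  rcases hx.grape_supp hb ha with rfl | rfl | rfl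
  · exact absurd h0 ha
  · cases b <;> simp
  · cases b <;> simp

theorem adj_cap (v : V) (i : Fin (ℓ v)) :
    (bunch T ℓ).Adj (gv ℓ v i false) (gv ℓ v i true) := bunch_adj_inr_inr.2 rfl

theorem adj_side (v : V) (i : Fin (ℓ v)) (b : Bool) :
    (bunch T ℓ).Adj (Sum.inl v) (gv ℓ v i b) := bunch_adj_inl_inr.2 rfl

theorem relOpen_inter {W : Type*} {Q U : Set ((W → ℝ) × (W → ℝ))} (h : IsOpen U) :
    RelOpen Q (Q ∩ U) := ⟨U, h, rfl⟩

end Pieces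

/-! ### Segments within the discrete configurations -/

section Convexity

variable {W : Type u} [Fintype W] {G : SimpleGraph W}

theorem contractibleSpace_of_star {F : Type*} [AddCommGroup F] [Module ℝ F] [TopologicalSpace F]
    [IsTopologicalAddGroup F] [ContinuousSMul ℝ F] {S : Set F} {c : F} (hc : c ∈ S)
    (h : ∀ z ∈ S, segment ℝ z c ⊆ S) : ContractibleSpace S :=
  contractibleSpace_of_segment_subset id c continuousOn_id ⟨c, hc⟩
    (fun z hz => by simpa using hz) h

/-- Two vectors are supported in a common edge. -/
def Compat (G : SimpleGraph W) (x y : W → ℝ) : Prop :=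
  ∃ a b, (a = b ∨ G.Adj a b) ∧ (∀ v, x v ≠ 0 → v = a ∨ v = b) ∧ ∀ v, y v ≠ 0 → v = a ∨ v = b

theorem IsPoint.compat_of_supp {x y : W → ℝ} (hx : IsPoint G x) (h : ∀ v, y v ≠ 0 → x v ≠ 0) :
    Compat G x y := by
  obtain ⟨a, b, hab, hs⟩ := hx.supp
  exact ⟨a, b, hab, hs, fun v hv => hs v (h v hv)⟩

theorem IsPoint.compat_pt {x : W → ℝ} (hx : IsPoint G x) {a : W} (h : x a ≠ 0) :
    Compat G x (pt a) := hx.compat_of_supp fun _ hv => pt_supp hv ▸ h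

theorem IsPoint.compat_mid {x : W → ℝ} (hx : IsPoint G x) {a b : W} (h : x a ≠ 0) (h' : x b ≠ 0) :
    Compat G x (mid a b) :=
  hx.compat_of_supp fun _ hv => by rcases mid_supp hv with rfl | rfl <;> assumption

theorem IsPoint.compat_self {x : W → ℝ} (hx : IsPoint G x) : Compat G x x :=
  hx.compat_of_supp fun _ => id

/-- The support at an interior point of the segment lies in the union of the supports at the ends.
Compatibility keeps each point on one edge, and the two cross conditions keep the supports of the
two points disjoint. -/
theorem segment_subset_relSet {U : Set ((W → ℝ) × (W → ℝ))} (hU : Convex ℝ U)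
    {z w : (W → ℝ) × (W → ℝ)} (hz : z ∈ U) (hw : w ∈ U)
    (hz' : z ∈ relSet G (· ≠ ·)) (hw' : w ∈ relSet G (· ≠ ·))
    (h₁ : Compat G z.1 w.1) (h₂ : Compat G z.2 w.2)
    (hzw : ∀ a, z.1 a ≠ 0 → w.2 a = 0) (hwz : ∀ a, w.1 a ≠ 0 → z.2 a = 0) :
    segment ℝ z w ⊆ relSet G (· ≠ ·) ∩ U := by
  intro p hp
  refine ⟨?_, hU.segment_subset hz hw hp⟩
  obtain ⟨s, t, hs, ht, hst, rfl⟩ := hp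
  obtain ⟨a, b, hab, h1, h1'⟩ := h₁
  obtain ⟨c, d, hcd, h2, h2'⟩ := h₂
  refine ⟨hz'.1.combo hw'.1 hab h1 h1' hs ht hst, hz'.2.1.combo hw'.2.1 hcd h2 h2' hs ht hst, ?_⟩
  rintro e _ he he' rfl
  have k1 : z.1 e ≠ 0 ∨ w.1 e ≠ 0 := by
    by_contra! h
    simp [h.1, h.2] at he
  have k2 : z.2 e ≠ 0 ∨ w.2 e ≠ 0 := by
    by_contra! h
    simp [h.1, h.2] at he'
  rcases k1 with k1 | k1 <;> rcases k2 with k2 | k2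
  · exact hz'.2.2 e e k1 k2 rfl
  · exact k2 (hzw e k1)
  · exact k2 (hwz e k1)
  · exact hw'.2.2 e e k1 k2 rfl

theorem convex_pos_fst (a : W) : Convex ℝ {z : (W → ℝ) × (W → ℝ) | 0 < z.1 a} :=
  convex_halfSpace_gt ⟨fun _ _ => rfl, fun _ _ => rfl⟩ 0

theorem convex_pos_snd (a : W) : Convex ℝ {z : (W → ℝ) × (W → ℝ) | 0 < z.2 a} :=
  convex_halfSpace_gt ⟨fun _ _ => rfl, fun _ _ => rfl⟩ 0

theorem convex_pos_fst_add (a b : W) :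
    Convex ℝ {z : (W → ℝ) × (W → ℝ) | 0 < z.1 a + z.1 b} :=
  convex_halfSpace_gt ⟨fun z w => by simp only [Prod.fst_add, Pi.add_apply]; ring,
    fun s z => by simp only [Prod.smul_fst, Pi.smul_apply, smul_eq_mul]; ring⟩ 0

theorem convex_pos_snd_add (a b : W) :
    Convex ℝ {z : (W → ℝ) × (W → ℝ) | 0 < z.2 a + z.2 b} :=
  convex_halfSpace_gt ⟨fun z w => by simp only [Prod.snd_add, Pi.add_apply]; ring,
    fun s z => by simp only [Prod.smul_snd, Pi.smul_apply, smul_eq_mul]; ring⟩ 0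

end Convexity

/-! ### The first two rounds of pieces: `capStem` and `bothGrape` -/

section Stages

variable {V : Type u} [Fintype V] {T : SimpleGraph V} {ℓ : V → ℕ}

theorem disc_left {z : (GrapeVertex ℓ → ℝ) × (GrapeVertex ℓ → ℝ)} (h : z ∈ disc T ℓ)
    {a : GrapeVertex ℓ} (ha : z.1 a ≠ 0) : z.2 a = 0 := by
  by_contra h'
  exact h.2.2 a a ha h' rfl

theorem disc_right {z : (GrapeVertex ℓ → ℝ) × (GrapeVertex ℓ → ℝ)} (h : z ∈ disc T ℓ)
    {a : GrapeVertex ℓ} (ha : z.2 a ≠ 0) : z.1 a = 0 := by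
  by_contra h'
  exact h.2.2 a a h' ha rfl

theorem symmetric_disc : Symmetric (disc T ℓ) := symmetric_relSet fun _ _ => Ne.symm

theorem disc_subset_confSet : disc T ℓ ⊆ confSet (bunch T ℓ) := relSet_subset fun _ h => h rfl

theorem IsPoint.push_cap {x : GrapeVertex ℓ → ℝ} (hx : IsPoint (bunch T ℓ) x) {v : V}
    {i : Fin (ℓ v)} (h : 0 < x (gv ℓ v i false) + x (gv ℓ v i true)) : push x = pt v := by
  obtain ⟨b, hb⟩ := grape_of_sum_pos h
  exact hx.push_grape hb

theorem IsPoint.cap_unique {x : GrapeVertex ℓ → ℝ} (hx : IsPoint (bunch T ℓ) x) {v w : V}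
    {i : Fin (ℓ v)} {k : Fin (ℓ w)} (h : 0 < x (gv ℓ v i false) + x (gv ℓ v i true))
    (h' : 0 < x (gv ℓ w k false) + x (gv ℓ w k true)) : (⟨v, i⟩ : Σ v, Fin (ℓ v)) = ⟨w, k⟩ := by
  obtain ⟨b, hb⟩ := grape_of_sum_pos h
  obtain ⟨c, hc⟩ := grape_of_sum_pos h'
  exact hx.grape_unique hb hc

theorem IsPoint.cap_stem {x : GrapeVertex ℓ → ℝ} (hx : IsPoint (bunch T ℓ) x) {v w : V}
    {i : Fin (ℓ v)} (h : 0 < x (gv ℓ v i false) + x (gv ℓ v i true))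
    (h' : x (Sum.inl w) ≠ 0) : w = v := by
  obtain ⟨b, hb⟩ := grape_of_sum_pos h
  rcases hx.grape_supp hb h' with e | e | e
  · exact Sum.inl_injective e
  · cases e
  · cases e

theorem IsPoint.compat_cap {x y : GrapeVertex ℓ → ℝ} (hx : IsPoint (bunch T ℓ) x) {v : V}
    {i : Fin (ℓ v)} (h : 0 < x (gv ℓ v i false) + x (gv ℓ v i true)) (h0 : x (Sum.inl v) = 0)
    (hy : ∀ a, y a ≠ 0 → a = gv ℓ v i false ∨ a = gv ℓ v i true) : Compat (bunch T ℓ) x y :=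
  ⟨_, _, Or.inr (adj_cap v i), fun _ => hx.cap_supp h h0, hy⟩

theorem pt_cap_pos {v : V} {i : Fin (ℓ v)} :
    (0 : ℝ) < pt (gv ℓ v i false) (gv ℓ v i false) + pt (gv ℓ v i false) (gv ℓ v i true) := by
  rw [pt_self, pt_ne (by simp)]
  norm_num

theorem mid_side_cap_pos {v : V} {i : Fin (ℓ v)} {b : Bool} :
    (0 : ℝ) < mid (Sum.inl v) (gv ℓ v i b) (gv ℓ v i false) +
      mid (Sum.inl v) (gv ℓ v i b) (gv ℓ v i true) :=
  sum_pos_of_grape (isPoint_mid (adj_side (T := ⊥) v i b)).nonneg mid_right_pos.ne'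

theorem convex_capStem (n : Σ v, Fin (ℓ v)) :
    Convex ℝ {z : (GrapeVertex ℓ → ℝ) × (GrapeVertex ℓ → ℝ) |
      0 < z.1 (gv ℓ n.1 n.2 false) + z.1 (gv ℓ n.1 n.2 true) ∧ 0 < z.2 (Sum.inl n.1)} :=
  (convex_pos_fst_add _ _).inter (convex_pos_snd _)

/-- The second point has mass at the stem vertex, so the first one lies in the closed edge opposite
to it. The second point is drawn into the stem vertex, and then the first one to an end of its edge.
-/
theorem contractibleSpace_capStem (n : Σ v, Fin (ℓ v)) : ContractibleSpace (capStem T ℓ n) := by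
  obtain ⟨v, i⟩ := n
  have hc : ((pt (gv ℓ v i false), pt (Sum.inl v)) : (GrapeVertex ℓ → ℝ) × (GrapeVertex ℓ → ℝ)) ∈
      capStem T ℓ ⟨v, i⟩ := by
    refine ⟨⟨isPoint_pt _, isPoint_pt _, ?_⟩, pt_cap_pos, by simp [pt_self]⟩
    intro a b ha hb
    rw [pt_supp ha, pt_supp hb]
    simp
  have hr : ∀ z ∈ capStem T ℓ ⟨v, i⟩, (z.1, pt (Sum.inl v)) ∈ capStem T ℓ ⟨v, i⟩ := by
    rintro z ⟨hz, h1, h2⟩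
    refine ⟨⟨hz.1, isPoint_pt _, ?_⟩, h1, by simp [pt_self]⟩
    rintro a b ha hb rfl
    rw [pt_supp hb] at ha
    exact ha (disc_right hz h2.ne')
  refine contractibleSpace_of_segment_subset (fun z => (z.1, pt (Sum.inl v)))
    (pt (gv ℓ v i false), pt (Sum.inl v)) (by fun_prop) ⟨_, hc⟩ ?_ ?_
  · intro z hz
    have hz' := hr z hz
    obtain ⟨hz, h1, h2⟩ := hz
    exact segment_subset_relSet (convex_capStem _) ⟨h1, h2⟩ hz'.2 hz hz'.1 hz.1.compat_self
      (hz.2.1.compat_pt h2.ne') (fun a ha => disc_left hz'.1 ha) fun a ha => disc_left hz ha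
  · intro z hz
    have hz' := hr z hz
    obtain ⟨hz, h1, h2⟩ := hz
    refine segment_subset_relSet (convex_capStem _) hz'.2 hc.2 hz'.1 hc.1
      (hz.1.compat_cap h1 (disc_right hz h2.ne') fun a ha => Or.inl (pt_supp ha))
      (isPoint_pt _).compat_self (fun a ha => disc_left hz'.1 ha) fun a ha => disc_left hc.1 ha

theorem contractibleSpace_capTwig (n : Σ v, Fin (ℓ v)) (w : {w // T.Adj n.1 w}) :
    ContractibleSpace (capTwig T ℓ n w) := by
  obtain ⟨v, i⟩ := n
  obtain ⟨w, hw⟩ := w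
  have hU := (convex_capStem (⟨v, i⟩ : Σ v, Fin (ℓ v))).inter
    (convex_pos_snd (Sum.inl w : GrapeVertex ℓ))
  have hc : ((pt (gv ℓ v i false), mid (Sum.inl v) (Sum.inl w)) :
      (GrapeVertex ℓ → ℝ) × (GrapeVertex ℓ → ℝ)) ∈ capTwig T ℓ ⟨v, i⟩ ⟨w, hw⟩ := by
    refine ⟨⟨isPoint_pt _, isPoint_mid (bunch_adj_inl_inl.2 hw), ?_⟩,
      ⟨pt_cap_pos, mid_left_pos⟩, mid_right_pos⟩
    intro a b ha hb
    rw [pt_supp ha]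
    rcases mid_supp hb with rfl | rfl <;> simp
  refine contractibleSpace_of_star hc ?_
  rintro z ⟨hz, ⟨h1, h2⟩, h3⟩
  have h0 := disc_right hz h2.ne'
  refine segment_subset_relSet hU ⟨⟨h1, h2⟩, h3⟩ hc.2 hz hc.1
    (hz.1.compat_cap h1 h0 fun a ha => Or.inl (pt_supp ha))
    (hz.2.1.compat_mid h2.ne' h3.ne') (fun a ha => ?_) (fun a ha => ?_)
  · by_contra hb
    rcases mid_supp hb with rfl | rfl
    · exact ha h0
    · exact ha (disc_right hz h3.ne')
  · rw [pt_supp ha]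
    by_contra hb
    rcases hz.2.1.pair h2.ne' h3.ne' (fun e => hw.ne (Sum.inl_injective e)) hb with e | e <;> cases e

theorem isOpen_pos_fst (a : GrapeVertex ℓ) :
    IsOpen {z : (GrapeVertex ℓ → ℝ) × (GrapeVertex ℓ → ℝ) | 0 < z.1 a} :=
  isOpen_lt (by fun_prop) (by fun_prop)

theorem isOpen_pos_snd (a : GrapeVertex ℓ) :
    IsOpen {z : (GrapeVertex ℓ → ℝ) × (GrapeVertex ℓ → ℝ) | 0 < z.2 a} :=
  isOpen_lt (by fun_prop) (by fun_prop)

theorem isOpen_pos_fst_add (a b : GrapeVertex ℓ) :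
    IsOpen {z : (GrapeVertex ℓ → ℝ) × (GrapeVertex ℓ → ℝ) | 0 < z.1 a + z.1 b} :=
  isOpen_lt (by fun_prop) (by fun_prop)

theorem isOpen_pos_snd_add (a b : GrapeVertex ℓ) :
    IsOpen {z : (GrapeVertex ℓ → ℝ) × (GrapeVertex ℓ → ℝ) | 0 < z.2 a + z.2 b} :=
  isOpen_lt (by fun_prop) (by fun_prop)

/-- The first point collapses to `v`, so the images are distinct exactly if the second point, which
is near `v`, has entered a twig at `v`: one component for each neighbour of `v`. -/
theorem isPieces_capStem : IsPieces (disc T ℓ) (offDiag T ℓ) (capStem T ℓ) (capTwig T ℓ) where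
  openS n := relOpen_inter ((isOpen_pos_fst_add _ _).inter (isOpen_pos_snd _))
  contrS := contractibleSpace_capStem
  disjS := by
    rintro ⟨v, i⟩ ⟨w, k⟩ z ⟨hz, h, -⟩ ⟨-, h', -⟩
    exact hz.1.cap_unique h h'
  swapS := by
    rintro ⟨v, i⟩ ⟨w, k⟩ z ⟨hz, h1, h2⟩ ⟨-, h3, h4⟩
    obtain rfl := hz.1.cap_stem h1 h4.ne'
    exact h4.ne' (disc_right hz h2.ne')
  openC n k := relOpen_inter
    (((isOpen_pos_fst_add _ _).inter (isOpen_pos_snd _)).inter (isOpen_pos_snd _))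
  contrC := contractibleSpace_capTwig
  disjC := by
    rintro ⟨v, i⟩ ⟨k, hk⟩ ⟨l, hl⟩ z ⟨hz, ⟨-, h⟩, h1⟩ ⟨-, -, h2⟩
    rcases hz.2.1.pair h.ne' h1.ne' (fun e => hk.ne (Sum.inl_injective e)) h2.ne' with e | e
    · exact absurd (Sum.inl_injective e).symm hl.ne
    · exact Subtype.ext (Sum.inl_injective e).symm
  inter := by
    rintro ⟨v, i⟩ z
    constructor
    · rintro ⟨⟨-, h⟩, hz, h1, h2⟩
      have : ∃ a, z.2 a ≠ 0 ∧ stemOf a ≠ v := by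
        by_contra! h'
        exact h ((hz.1.push_cap h1).trans (hz.2.1.push_eq h').symm)
      obtain ⟨a, ha, hav⟩ := this
      have hadj := hz.2.1.adj h2.ne' ha (by rintro rfl; exact hav rfl)
      obtain ⟨-, h4, h5⟩ := stemOf_adj hadj (Ne.symm hav)
      refine ⟨⟨stemOf a, h5⟩, hz, ⟨h1, h2⟩, ?_⟩
      change 0 < z.2 (Sum.inl (stemOf a))
      rw [← h4]
      exact lt_of_le_of_ne (hz.2.1.nonneg a) ha.symm
    · rintro ⟨⟨w, hw⟩, hz, ⟨h1, h2⟩, h3⟩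
      refine ⟨⟨hz, fun e => ?_⟩, hz, h1, h2⟩
      have := le_push hz.2.1.nonneg (Sum.inl w)
      rw [← e, hz.1.push_cap h1, stemOf_inl, pt_ne hw.ne'] at this
      exact absurd h3 (not_lt.2 this)

theorem contractibleSpace_bothGrape (n : Σ v, Fin (ℓ v)) :
    ContractibleSpace (bothGrape T ℓ n) := by
  obtain ⟨v, i⟩ := n
  have hc : ((pt (gv ℓ v i false), pt (gv ℓ v i true)) :
      (GrapeVertex ℓ → ℝ) × (GrapeVertex ℓ → ℝ)) ∈ bothGrape T ℓ ⟨v, i⟩ := by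
    refine ⟨⟨isPoint_pt _, isPoint_pt _, ?_⟩, by simp [pt_self], by simp [pt_self]⟩
    intro a b ha hb
    rw [pt_supp ha, pt_supp hb]
    simp
  refine contractibleSpace_of_star hc ?_
  rintro z ⟨hz, h1, h2⟩
  refine segment_subset_relSet ((convex_pos_fst _).inter (convex_pos_snd _)) ⟨h1, h2⟩ hc.2 hz hc.1
    (hz.1.compat_pt h1.ne') (hz.2.1.compat_pt h2.ne') (fun a ha => ?_) (fun a ha => ?_)
  · by_contra hb
    rw [pt_supp hb] at ha
    exact ha (disc_right hz h2.ne')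
  · rw [pt_supp ha]
    exact disc_left hz h1.ne'

theorem contractibleSpace_bothGrapeSide (n : Σ v, Fin (ℓ v)) (b : Bool) :
    ContractibleSpace (bothGrapeSide T ℓ n b) := by
  obtain ⟨v, i⟩ := n
  cases b
  · have hc : ((pt (gv ℓ v i false), mid (Sum.inl v) (gv ℓ v i true)) :
        (GrapeVertex ℓ → ℝ) × (GrapeVertex ℓ → ℝ)) ∈ bothGrapeSide T ℓ ⟨v, i⟩ false := by
      refine ⟨⟨isPoint_pt _, isPoint_mid (adj_side _ _ _), ?_⟩,
        ⟨by simp [pt_self], mid_right_pos⟩, mid_left_pos⟩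
      intro a b ha hb
      rw [pt_supp ha]
      rcases mid_supp hb with rfl | rfl <;> simp
    refine contractibleSpace_of_star hc ?_
    rintro z ⟨hz, ⟨h1, h2⟩, h3⟩
    refine segment_subset_relSet (((convex_pos_fst _).inter (convex_pos_snd _)).inter
      (convex_pos_snd _)) ⟨⟨h1, h2⟩, h3⟩ hc.2 hz hc.1
      (hz.1.compat_pt h1.ne') (hz.2.1.compat_mid h3.ne' h2.ne') (fun a ha => ?_) (fun a ha => ?_)
    · by_contra hb
      rcases mid_supp hb with rfl | rfl
      · exact ha (disc_right hz h3.ne')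
      · exact ha (disc_right hz h2.ne')
    · rw [pt_supp ha]
      exact disc_left hz h1.ne'
  · have hc : ((mid (Sum.inl v) (gv ℓ v i false), pt (gv ℓ v i true)) :
        (GrapeVertex ℓ → ℝ) × (GrapeVertex ℓ → ℝ)) ∈ bothGrapeSide T ℓ ⟨v, i⟩ true := by
      refine ⟨⟨isPoint_mid (adj_side _ _ _), isPoint_pt _, ?_⟩,
        ⟨mid_right_pos, by simp [pt_self]⟩, mid_left_pos⟩
      intro a b ha hb
      rw [pt_supp hb]
      rcases mid_supp ha with rfl | rfl <;> simp
    refine contractibleSpace_of_star hc ?_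
    rintro z ⟨hz, ⟨h1, h2⟩, h3⟩
    refine segment_subset_relSet (((convex_pos_fst _).inter (convex_pos_snd _)).inter
      (convex_pos_fst _)) ⟨⟨h1, h2⟩, h3⟩ hc.2 hz hc.1
      (hz.1.compat_mid h3.ne' h1.ne') (hz.2.1.compat_pt h2.ne') (fun a ha => ?_) (fun a ha => ?_)
    · by_contra hb
      rw [pt_supp hb] at ha
      exact ha (disc_right hz h2.ne')
    · rcases mid_supp ha with rfl | rfl
      · exact disc_left hz h3.ne'
      · exact disc_left hz h1.ne'

theorem isOpen_cond (c : Bool) (a : GrapeVertex ℓ) :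
    IsOpen {z : (GrapeVertex ℓ → ℝ) × (GrapeVertex ℓ → ℝ) | 0 < cond c (z.1 a) (z.2 a)} := by
  cases c
  · exact isOpen_pos_snd a
  · exact isOpen_pos_fst a

theorem isOpen_cond' (c : Bool) (a b : GrapeVertex ℓ) :
    IsOpen {z : (GrapeVertex ℓ → ℝ) × (GrapeVertex ℓ → ℝ) | 0 < cond c (z.1 a) (z.2 b)} := by
  cases c
  · exact isOpen_pos_snd b
  · exact isOpen_pos_fst a

/-- The points collapse to the same vertex, so only `capStem` pieces or their swaps are met, which
happens if one of the points has mass at the stem vertex. Disjointness of supports allows this for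
at most one of them, whence two components. -/
theorem isPieces_bothGrape : IsPieces (disc T ℓ) (addPieces (offDiag T ℓ) (capStem T ℓ))
    (bothGrape T ℓ) (bothGrapeSide T ℓ) where
  openS n := relOpen_inter ((isOpen_pos_fst _).inter (isOpen_pos_snd _))
  contrS := contractibleSpace_bothGrape
  disjS := by
    rintro ⟨v, i⟩ ⟨w, k⟩ z ⟨hz, h, -⟩ ⟨-, h', -⟩
    exact hz.1.grape_unique h.ne' h'.ne'
  swapS := by
    rintro ⟨v, i⟩ ⟨w, k⟩ z ⟨hz, h1, h2⟩ ⟨-, h3, h4⟩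
    have := hz.1.grape_unique h1.ne' h4.ne'
    cases this
    exact h3.ne' (disc_left hz h1.ne')
  openC n k := relOpen_inter
    (((isOpen_pos_fst _).inter (isOpen_pos_snd _)).inter (isOpen_cond _ _))
  contrC := contractibleSpace_bothGrapeSide
  disjC := by
    rintro ⟨v, i⟩ (_ | _) (_ | _) z ⟨hz, -, h1⟩ ⟨-, -, h2⟩
    · rfl
    · exact absurd (disc_left hz h2.ne') h1.ne'
    · exact absurd (disc_left hz h1.ne') h2.ne'
    · rfl
  inter := by
    rintro ⟨v, i⟩ z
    constructor
    · rintro ⟨⟨-, h⟩ | ⟨⟨w, k⟩, ⟨-, h3, h4⟩ | ⟨-, h3, h4⟩⟩, hz, h1, h2⟩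
      · exact absurd ((hz.1.push_grape h1.ne').trans (hz.2.1.push_grape h2.ne').symm) h
      · obtain rfl := hz.2.1.cap_stem (sum_pos_of_grape hz.2.1.nonneg h2.ne') h4.ne'
        exact ⟨false, hz, ⟨h1, h2⟩, h4⟩
      · obtain rfl := hz.1.cap_stem (sum_pos_of_grape hz.1.nonneg h1.ne') h4.ne'
        exact ⟨true, hz, ⟨h1, h2⟩, h4⟩
    · rintro ⟨_ | _, hz, ⟨h1, h2⟩, h3⟩
      · exact ⟨Or.inr ⟨⟨v, i⟩, Or.inl ⟨hz, sum_pos_of_grape hz.1.nonneg h1.ne', h3⟩⟩, hz, h1, h2⟩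
      · exact ⟨Or.inr ⟨⟨v, i⟩, Or.inr ⟨symmetric_disc _ hz,
          sum_pos_of_grape hz.2.1.nonneg h2.ne', h3⟩⟩, hz, h1, h2⟩

end Stages

/-! ### The third round of pieces: `twoGrapes` -/

section TwoGrapes

variable {V : Type u} [Fintype V] {T : SimpleGraph V} {ℓ : V → ℕ}

open Classical in
/-- Push a point off a vertex. -/
noncomputable def erase (v : V) (x : GrapeVertex ℓ → ℝ) : GrapeVertex ℓ → ℝ :=
  normalize fun a => if a = Sum.inl v then 0 else x a

theorem erase_ne_zero {v : V} {x : GrapeVertex ℓ → ℝ} {a : GrapeVertex ℓ} (h : erase v x a ≠ 0) :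
    x a ≠ 0 := by
  intro e
  simp [erase, normalize, e] at h

theorem erase_self (v : V) (x : GrapeVertex ℓ → ℝ) : erase v x (Sum.inl v) = 0 := by
  simp [erase, normalize]

theorem sum_erase_pos {v : V} {i : Fin (ℓ v)} {x : GrapeVertex ℓ → ℝ}
    (hx : IsPoint (bunch T ℓ) x) (h : 0 < x (gv ℓ v i false) + x (gv ℓ v i true)) :
    0 < ∑ a, (open Classical in if a = Sum.inl v then 0 else x a) := by
  classical
  obtain ⟨b, hb⟩ := grape_of_sum_pos h
  refine Finset.sum_pos' (fun a _ => ?_) ⟨gv ℓ v i b, Finset.mem_univ _, ?_⟩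
  · split_ifs
    exacts [le_rfl, hx.nonneg a]
  · rw [if_neg (by simp)]
    exact lt_of_le_of_ne (hx.nonneg _) hb.symm

theorem IsPoint.erase {v : V} {i : Fin (ℓ v)} {x : GrapeVertex ℓ → ℝ}
    (hx : IsPoint (bunch T ℓ) x) (h : 0 < x (gv ℓ v i false) + x (gv ℓ v i true)) :
    IsPoint (bunch T ℓ) (GraphBraid.erase v x) := by
  classical
  refine hx.normalize (fun a => ?_) (fun a ha => ?_) (sum_erase_pos hx h)
  · split_ifs
    exacts [le_rfl, hx.nonneg a]
  · simp [ha]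

theorem erase_cap_pos {v : V} {i : Fin (ℓ v)} {x : GrapeVertex ℓ → ℝ}
    (hx : IsPoint (bunch T ℓ) x) (h : 0 < x (gv ℓ v i false) + x (gv ℓ v i true)) :
    0 < erase v x (gv ℓ v i false) + erase v x (gv ℓ v i true) := by
  have := sum_erase_pos hx h
  simp only [erase, normalize, reduceCtorEq, if_false, ← add_div]
  exact div_pos h this

/-- Both points are first pushed off the stem vertex, into the edges opposite to it, and then moved
along these edges. The push only shrinks supports, so they remain disjoint. -/
theorem contractibleSpace_twoGrapes (n : Σ v, {p : Fin (ℓ v) × Fin (ℓ v) // p.1 < p.2}) :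
    ContractibleSpace (twoGrapes T ℓ n) := by
  classical
  obtain ⟨v, ⟨i, k⟩, hik⟩ := n
  have hU := (convex_pos_fst_add (gv ℓ v i false) (gv ℓ v i true)).inter
    (convex_pos_snd_add (gv ℓ v k false) (gv ℓ v k true))
  have hc : ((pt (gv ℓ v i false), pt (gv ℓ v k false)) :
      (GrapeVertex ℓ → ℝ) × (GrapeVertex ℓ → ℝ)) ∈ twoGrapes T ℓ ⟨v, ⟨i, k⟩, hik⟩ := by
    refine ⟨⟨isPoint_pt _, isPoint_pt _, ?_⟩, pt_cap_pos, pt_cap_pos⟩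
    intro a b ha hb
    rw [pt_supp ha, pt_supp hb]
    intro e
    cases e
    exact lt_irrefl _ hik
  have hr : ∀ z ∈ twoGrapes T ℓ ⟨v, ⟨i, k⟩, hik⟩,
      (erase v z.1, erase v z.2) ∈ twoGrapes T ℓ ⟨v, ⟨i, k⟩, hik⟩ := by
    rintro z ⟨hz, h1, h2⟩
    exact ⟨⟨hz.1.erase h1, hz.2.1.erase h2, fun a b ha hb =>
      hz.2.2 a b (erase_ne_zero ha) (erase_ne_zero hb)⟩, erase_cap_pos hz.1 h1,
      erase_cap_pos hz.2.1 h2⟩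
  refine contractibleSpace_of_segment_subset (fun z => (erase v z.1, erase v z.2))
    (pt (gv ℓ v i false), pt (gv ℓ v k false)) ?_ ⟨_, hc⟩ ?_ ?_
  · refine ContinuousOn.prodMk (continuousOn_normalize (Continuous.continuousOn ?_) ?_)
      (continuousOn_normalize (Continuous.continuousOn ?_) ?_)
    · refine continuous_pi fun a => ?_
      split_ifs <;> fun_prop
    · exact fun z hz => (sum_erase_pos hz.1.1 hz.2.1).ne'
    · refine continuous_pi fun a => ?_
      split_ifs <;> fun_prop
    · exact fun z hz => (sum_erase_pos hz.1.2.1 hz.2.2).ne'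
  · intro z hz
    have hz' := hr z hz
    obtain ⟨hz, h1, h2⟩ := hz
    exact segment_subset_relSet hU ⟨h1, h2⟩ hz'.2 hz hz'.1
      (hz.1.compat_of_supp fun a => erase_ne_zero) (hz.2.1.compat_of_supp fun a => erase_ne_zero)
      (fun a ha => by
        by_contra hb
        exact hz.2.2 a a ha (erase_ne_zero hb) rfl)
      fun a ha => disc_left hz (erase_ne_zero ha)
  · intro z hz
    have hz' := hr z hz
    obtain ⟨hz', h1, h2⟩ := hz'
    refine segment_subset_relSet hU ⟨h1, h2⟩ hc.2 hz' hc.1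
      (hz'.1.compat_cap h1 (erase_self v _) fun a ha => Or.inl (pt_supp ha))
      (hz'.2.1.compat_cap h2 (erase_self v _) fun a ha => Or.inl (pt_supp ha))
      (fun a ha => ?_) (fun a ha => ?_)
    · by_contra hb
      obtain rfl := pt_supp hb
      have : (⟨v, i⟩ : Σ v, Fin (ℓ v)) = ⟨v, k⟩ := hz'.1.cap_unique h1 (sum_pos_of_grape hz'.1.nonneg ha)
      cases this
      exact lt_irrefl _ hik
    · by_contra hb
      obtain rfl := pt_supp ha
      have : (⟨v, k⟩ : Σ v, Fin (ℓ v)) = ⟨v, i⟩ := hz'.2.1.cap_unique h2 (sum_pos_of_grape hz'.2.1.nonneg hb)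
      cases this
      exact lt_irrefl _ hik

theorem contractibleSpace_twoGrapesSide (n : Σ v, {p : Fin (ℓ v) × Fin (ℓ v) // p.1 < p.2})
    (b : Bool × Bool) : ContractibleSpace (twoGrapesSide T ℓ n b) := by
  obtain ⟨v, ⟨i, k⟩, hik⟩ := n
  obtain ⟨b, c⟩ := b
  have hU := (convex_pos_fst_add (gv ℓ v i false) (gv ℓ v i true)).inter
    (convex_pos_snd_add (gv ℓ v k false) (gv ℓ v k true))
  cases b
  · have hc : ((pt (gv ℓ v i false), mid (Sum.inl v) (gv ℓ v k c)) :
        (GrapeVertex ℓ → ℝ) × (GrapeVertex ℓ → ℝ)) ∈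
        twoGrapesSide T ℓ ⟨v, ⟨i, k⟩, hik⟩ (false, c) := by
      refine ⟨⟨isPoint_pt _, isPoint_mid (adj_side _ _ _), ?_⟩, ⟨pt_cap_pos, mid_side_cap_pos⟩,
        mid_left_pos, mid_right_pos⟩
      intro a b ha hb
      rw [pt_supp ha]
      rcases mid_supp hb with rfl | rfl
      · simp
      · intro e
        cases e
        exact lt_irrefl _ hik
    refine contractibleSpace_of_star hc ?_
    rintro z ⟨hz, ⟨h1, h2⟩, h3, h4⟩
    refine segment_subset_relSet (hU.inter ((convex_pos_snd (Sum.inl v : GrapeVertex ℓ)).inter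
      (convex_pos_snd (gv ℓ v k c)))) ⟨⟨h1, h2⟩, h3, h4⟩ hc.2 hz hc.1
      (hz.1.compat_cap h1 (disc_right hz h3.ne') fun a ha => Or.inl (pt_supp ha))
      (hz.2.1.compat_mid h3.ne' h4.ne') (fun a ha => ?_) (fun a ha => ?_)
    · by_contra hb
      rcases mid_supp hb with rfl | rfl
      · exact ha (disc_right hz h3.ne')
      · exact ha (disc_right hz h4.ne')
    · by_contra hb
      obtain rfl := pt_supp ha
      have : (⟨v, k⟩ : Σ v, Fin (ℓ v)) = ⟨v, i⟩ := hz.2.1.cap_unique h2 (sum_pos_of_grape hz.2.1.nonneg hb)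
      cases this
      exact lt_irrefl _ hik
  · have hc : ((mid (Sum.inl v) (gv ℓ v i c), pt (gv ℓ v k false)) :
        (GrapeVertex ℓ → ℝ) × (GrapeVertex ℓ → ℝ)) ∈
        twoGrapesSide T ℓ ⟨v, ⟨i, k⟩, hik⟩ (true, c) := by
      refine ⟨⟨isPoint_mid (adj_side _ _ _), isPoint_pt _, ?_⟩, ⟨mid_side_cap_pos, pt_cap_pos⟩,
        mid_left_pos, mid_right_pos⟩
      intro a b ha hb
      rw [pt_supp hb]
      rcases mid_supp ha with rfl | rfl
      · simp
      · intro e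
        cases e
        exact lt_irrefl _ hik
    refine contractibleSpace_of_star hc ?_
    rintro z ⟨hz, ⟨h1, h2⟩, h3, h4⟩
    refine segment_subset_relSet (hU.inter ((convex_pos_fst (Sum.inl v : GrapeVertex ℓ)).inter
      (convex_pos_fst (gv ℓ v i c)))) ⟨⟨h1, h2⟩, h3, h4⟩ hc.2 hz hc.1
      (hz.1.compat_mid h3.ne' h4.ne')
      (hz.2.1.compat_cap h2 (disc_left hz h3.ne') fun a ha => Or.inl (pt_supp ha))
      (fun a ha => ?_) (fun a ha => ?_)
    · by_contra hb
      obtain rfl := pt_supp hb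
      have : (⟨v, i⟩ : Σ v, Fin (ℓ v)) = ⟨v, k⟩ := hz.1.cap_unique h1 (sum_pos_of_grape hz.1.nonneg ha)
      cases this
      exact lt_irrefl _ hik
    · rcases mid_supp ha with rfl | rfl
      · exact disc_left hz h3.ne'
      · exact disc_left hz h4.ne'

theorem grape_bool_unique {x : GrapeVertex ℓ → ℝ} (hx : IsPoint (bunch T ℓ) x) {v : V}
    {i : Fin (ℓ v)} {b c : Bool} (h0 : 0 < x (Sum.inl v)) (hb : 0 < x (gv ℓ v i b))
    (hc : 0 < x (gv ℓ v i c)) : b = c := by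
  rcases hx.pair h0.ne' hb.ne' (by simp) hc.ne' with e | e <;> cases e
  rfl

/-- An earlier stage is met exactly if one of the points has mass at the stem vertex. It then lies
on one of the two sides of its grape: two points and two sides give four components. The ordering of
the two grapes selects one of the two orderings of each configuration. -/
theorem isPieces_twoGrapes : IsPieces (disc T ℓ)
    (addPieces (addPieces (offDiag T ℓ) (capStem T ℓ)) (bothGrape T ℓ))
    (twoGrapes T ℓ) (twoGrapesSide T ℓ) where
  openS n := relOpen_inter ((isOpen_pos_fst_add _ _).inter (isOpen_pos_snd_add _ _))
  contrS := contractibleSpace_twoGrapes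
  disjS := by
    rintro ⟨v, ⟨i, k⟩, hik⟩ ⟨w, ⟨i', k'⟩, hik'⟩ z ⟨hz, h1, h2⟩ ⟨-, h3, h4⟩
    have e1 := hz.1.cap_unique h1 h3
    have e2 := hz.2.1.cap_unique h2 h4
    cases e1
    cases e2
    rfl
  swapS := by
    rintro ⟨v, ⟨i, k⟩, hik⟩ ⟨w, ⟨i', k'⟩, hik'⟩ z ⟨hz, h1, h2⟩ ⟨-, h3, h4⟩
    have e1 := hz.1.cap_unique h1 h4
    have e2 := hz.2.1.cap_unique h2 h3
    cases e1
    cases e2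
    exact lt_asymm hik hik'
  openC n k := relOpen_inter (((isOpen_pos_fst_add _ _).inter (isOpen_pos_snd_add _ _)).inter
    ((isOpen_cond _ _).inter (isOpen_cond' _ _ _)))
  contrC := contractibleSpace_twoGrapesSide
  disjC := by
    rintro ⟨v, ⟨i, k⟩, hik⟩ ⟨_ | _, c⟩ ⟨_ | _, d⟩ z ⟨hz, -, h1, h2⟩ ⟨-, -, h3, h4⟩
    · exact Prod.ext rfl (grape_bool_unique hz.2.1 h1 h2 h4)
    · exact absurd (disc_left hz h3.ne') h1.ne'
    · exact absurd (disc_left hz h1.ne') h3.ne'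
    · exact Prod.ext rfl (grape_bool_unique hz.1 h1 h2 h4)
  inter := by
    rintro ⟨v, ⟨i, k⟩, hik⟩ z
    constructor
    · rintro ⟨h, hz, h1, h2⟩
      have key : 0 < z.1 (Sum.inl v) ∨ 0 < z.2 (Sum.inl v) := by
        rcases h with (⟨-, h⟩ | ⟨⟨w, l⟩, ⟨-, h3, h4⟩ | ⟨-, h3, h4⟩⟩) |
          ⟨⟨w, l⟩, ⟨-, h3, h4⟩ | ⟨-, h3, h4⟩⟩
        · exact absurd ((hz.1.push_cap h1).trans (hz.2.1.push_cap h2).symm) h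
        · obtain rfl := hz.2.1.cap_stem h2 h4.ne'
          exact Or.inr h4
        · obtain rfl := hz.1.cap_stem h1 h4.ne'
          exact Or.inl h4
        · have e1 := hz.1.cap_unique h1 (sum_pos_of_grape hz.1.nonneg h3.ne')
          have e2 := hz.2.1.cap_unique h2 (sum_pos_of_grape hz.2.1.nonneg h4.ne')
          cases e1
          cases e2
          exact absurd hik (lt_irrefl _)
        · have e1 := hz.1.cap_unique h1 (sum_pos_of_grape hz.1.nonneg h4.ne')
          have e2 := hz.2.1.cap_unique h2 (sum_pos_of_grape hz.2.1.nonneg h3.ne')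
          cases e1
          cases e2
          exact absurd hik (lt_irrefl _)
      rcases key with h3 | h3
      · obtain ⟨c, hc⟩ := grape_of_sum_pos h1
        exact ⟨(true, c), hz, ⟨h1, h2⟩, h3, lt_of_le_of_ne (hz.1.nonneg _) hc.symm⟩
      · obtain ⟨c, hc⟩ := grape_of_sum_pos h2
        exact ⟨(false, c), hz, ⟨h1, h2⟩, h3, lt_of_le_of_ne (hz.2.1.nonneg _) hc.symm⟩
    · rintro ⟨⟨_ | _, c⟩, hz, ⟨h1, h2⟩, h3, -⟩
      · exact ⟨Or.inl (Or.inr ⟨⟨v, i⟩, Or.inl ⟨hz, h1, h3⟩⟩), hz, h1, h2⟩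
      · exact ⟨Or.inl (Or.inr ⟨⟨v, k⟩, Or.inr ⟨symmetric_disc _ hz, h2, h3⟩⟩), hz, h1, h2⟩

theorem mem_addPieces_of_grape {z : (GrapeVertex ℓ → ℝ) × (GrapeVertex ℓ → ℝ)}
    (hz : z ∈ disc T ℓ) {v : V} {i : Fin (ℓ v)} {b : Bool} (hx : z.1 (gv ℓ v i b) ≠ 0)
    (h : push z.1 = push z.2) :
    z ∈ addPieces (addPieces (addPieces (offDiag T ℓ) (capStem T ℓ)) (bothGrape T ℓ))
      (twoGrapes T ℓ) := by
  have hx' := sum_pos_of_grape hz.1.nonneg hx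
  have hy : ∀ a, z.2 a ≠ 0 → stemOf a = v := by
    intro a ha
    have := (lt_of_le_of_ne (hz.2.1.nonneg a) ha.symm).trans_le (le_push hz.2.1.nonneg a)
    rw [← h, hz.1.push_grape hx] at this
    exact pt_supp this.ne'
  by_cases hyv : z.2 (Sum.inl v) = 0
  swap
  · exact Or.inl (Or.inl (Or.inr ⟨⟨v, i⟩, Or.inl ⟨hz, hx', lt_of_le_of_ne (hz.2.1.nonneg _)
      (Ne.symm hyv)⟩⟩))
  obtain ⟨a, ha⟩ := hz.2.1.ne_zero
  rcases a with w | ⟨w, k, c⟩ <;> obtain rfl : w = v := hy _ ha.ne'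
  · exact absurd hyv ha.ne'
  have hy' := sum_pos_of_grape hz.2.1.nonneg ha.ne'
  by_cases hxv : z.1 (Sum.inl w) = 0
  swap
  · exact Or.inl (Or.inl (Or.inr ⟨⟨w, k⟩, Or.inr ⟨symmetric_disc _ hz, hy',
      lt_of_le_of_ne (hz.1.nonneg _) (Ne.symm hxv)⟩⟩))
  rcases lt_trichotomy i k with hik | rfl | hik
  · exact Or.inr ⟨⟨w, ⟨i, k⟩, hik⟩, Or.inl ⟨hz, hx', hy'⟩⟩
  -- Both points lie in the same grape and have no mass at the stem; disjoint supports put them at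
  -- its two opposite free vertices.
  · have hx'' := lt_of_le_of_ne (hz.1.nonneg _) hx.symm
    refine Or.inl (Or.inr ⟨⟨w, i⟩, ?_⟩)
    cases b <;> cases c
    · exact absurd (disc_left hz hx) ha.ne'
    · exact Or.inl ⟨hz, hx'', ha⟩
    · exact Or.inr ⟨symmetric_disc _ hz, ha, hx''⟩
    · exact absurd (disc_left hz hx) ha.ne'
  · exact Or.inr ⟨⟨w, ⟨k, i⟩, hik⟩, Or.inr ⟨symmetric_disc _ hz, hy', hx'⟩⟩

theorem addPieces_subset {W ι : Type*} {Q Q₀ : Set ((W → ℝ) × (W → ℝ))}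
    {S : ι → Set ((W → ℝ) × (W → ℝ))} (hs : Symmetric Q) (h₀ : Q₀ ⊆ Q) (h : ∀ n, S n ⊆ Q) :
    addPieces Q₀ S ⊆ Q := by
  rintro z (hz | ⟨n, hz | hz⟩)
  · exact h₀ hz
  · exact h n hz
  · exact hs _ (h n hz)

/-- Outside `offDiag` the pushes agree. Two points of the stem with equal pushes would have equal
supports, so one of the points lies in a grape and the other one over the same stem vertex. -/
theorem addPieces_eq_disc :
    addPieces (addPieces (addPieces (offDiag T ℓ) (capStem T ℓ)) (bothGrape T ℓ))
      (twoGrapes T ℓ) = disc T ℓ := by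
  have hsym : Symmetric (addPieces (addPieces (addPieces (offDiag T ℓ) (capStem T ℓ))
      (bothGrape T ℓ)) (twoGrapes T ℓ)) :=
    symmetric_addPieces (symmetric_addPieces (symmetric_addPieces symmetric_offDiag))
  refine Subset.antisymm ?_ fun z hz => ?_
  · exact addPieces_subset symmetric_disc (addPieces_subset symmetric_disc
      (addPieces_subset symmetric_disc inter_subset_left fun _ => inter_subset_left)
      fun _ => inter_subset_left) fun _ => inter_subset_left
  by_cases h : push z.1 = push z.2
  swap
  · exact Or.inl (Or.inl (Or.inl ⟨hz, h⟩))
  by_cases hx : ∃ p, z.1 (Sum.inr p) ≠ 0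
  · obtain ⟨⟨v, i, b⟩, hx⟩ := hx
    exact mem_addPieces_of_grape hz hx h
  by_cases hy : ∃ p, z.2 (Sum.inr p) ≠ 0
  · obtain ⟨⟨v, i, b⟩, hy⟩ := hy
    exact hsym _ (mem_addPieces_of_grape (symmetric_disc _ hz) hy h.symm)
  push Not at hx hy
  obtain ⟨v | p, ha⟩ := hz.1.ne_zero
  · have := ha.trans_le (le_push hz.1.nonneg (Sum.inl v))
    rw [h] at this
    obtain ⟨b, hb, hb'⟩ := push_ne_zero this.ne'
    rcases b with w | p
    · obtain rfl : w = v := hb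
      exact absurd (disc_left hz ha.ne') hb'
    · exact absurd (hy p) hb'
  · exact absurd (hx p) ha.ne'

end TwoGrapes

/-! ### The three rounds combined -/

section Chain

variable {V : Type u} [Fintype V] {T : SimpleGraph V} {ℓ : V → ℕ}

/-- The generators of the free factor: the components of the intersections, apart from one for each
attached piece. -/
abbrev FreeGen (T : SimpleGraph V) (ℓ : V → ℕ)
    (w₀ : ∀ n : Σ v, Fin (ℓ v), {w // T.Adj n.1 w}) : Type u :=
  ((Σ n : Σ v, Fin (ℓ v), {w : {w // T.Adj n.1 w} // w ≠ w₀ n}) ⊕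
    (Σ _ : Σ v, Fin (ℓ v), {b : Bool // b ≠ false})) ⊕
    (Σ _ : Σ v, {p : Fin (ℓ v) × Fin (ℓ v) // p.1 < p.2},
      {b : Bool × Bool // b ≠ (false, false)})

theorem offDiag_subset_disc : offDiag T ℓ ⊆ disc T ℓ := inter_subset_left

theorem isFreeExt_offDiag_disc [PathConnectedSpace (down (bunch T ℓ) (offDiag T ℓ))]
    (w₀ : ∀ n : Σ v, Fin (ℓ v), {w // T.Adj n.1 w}) :
    PathConnectedSpace (down (bunch T ℓ) (disc T ℓ)) ∧
    IsFreeExt (ContinuousMap.inclusion (down_mono (G := bunch T ℓ)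
      (offDiag_subset_disc (T := T) (ℓ := ℓ))))
      (FreeGen T ℓ w₀) := by
  have r₀ : RelOpen (disc T ℓ) (offDiag T ℓ) := relOpen_inter isOpen_push_ne
  have rA := RelOpen.addPieces symmetric_disc r₀ isPieces_capStem.openS
  have rB := RelOpen.addPieces symmetric_disc rA isPieces_bothGrape.openS
  have sA : Symmetric (addPieces (offDiag T ℓ) (capStem T ℓ)) :=
    symmetric_addPieces symmetric_offDiag
  have sB : Symmetric (addPieces (addPieces (offDiag T ℓ) (capStem T ℓ)) (bothGrape T ℓ)) :=
    symmetric_addPieces sA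
  have hA := isPieces_capStem.isAttached disc_subset_confSet symmetric_disc r₀ symmetric_offDiag
  have hB := isPieces_bothGrape.isAttached disc_subset_confSet symmetric_disc rA sA
  have hD := isPieces_twoGrapes.isAttached disc_subset_confSet symmetric_disc rB sB
  have := hA.pathConnectedSpace w₀
  have := hB.pathConnectedSpace fun _ => false
  have hX := hD.pathConnectedSpace fun _ => (false, false)
  have key := ((hA.isFreeExt w₀).comp (hB.isFreeExt fun _ => false)).comp
    (hD.isFreeExt fun _ => (false, false))
  -- The result of the last round equals `disc` only propositionally; generalizing the set allows a
  -- substitution.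
  have : ∀ (Q : Set ((GrapeVertex ℓ → ℝ) × (GrapeVertex ℓ → ℝ))) (hQ : Q = disc T ℓ)
      (h : offDiag T ℓ ⊆ Q), PathConnectedSpace (down (bunch T ℓ) Q) →
      IsFreeExt (ContinuousMap.inclusion (down_mono (G := bunch T ℓ) h)) (FreeGen T ℓ w₀) →
      PathConnectedSpace (down (bunch T ℓ) (disc T ℓ)) ∧
      IsFreeExt (ContinuousMap.inclusion (down_mono (G := bunch T ℓ)
      (offDiag_subset_disc (T := T) (ℓ := ℓ))))
        (FreeGen T ℓ w₀) := by
    rintro Q rfl h h1 h2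
    exact ⟨h1, h2⟩
  exact this _ addPieces_eq_disc
    (subset_addPieces.trans (subset_addPieces.trans subset_addPieces)) hX key

end Chain

/-! ### The free product decompositions -/

section Conclusion

theorem pathConnectedSpace_of_homotopyEquiv {A B : Type*} [TopologicalSpace A]
    [TopologicalSpace B] (e : ContinuousMap.HomotopyEquiv A B) [PathConnectedSpace A] :
    PathConnectedSpace B := by
  have h : ∀ b, Joined (e.toFun (e.invFun b)) b := fun b =>
    e.right_inv.elim fun H => ⟨H.evalAt b⟩
  have hA : Nonempty A := inferInstance
  refine ⟨hA.map e.toFun, fun b b' => (h b).symm.trans (Joined.trans ?_ (h b'))⟩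
  exact (PathConnectedSpace.joined (e.invFun b) (e.invFun b')).map e.toFun.continuous

variable {V : Type u} [Fintype V] {T : SimpleGraph V} {ℓ : V → ℕ}

theorem isFreeExt_inclUP₂
    (hUP : spaceUP₂ (bunch T ℓ) = down (bunch T ℓ) (relSet (bunch T ℓ) Apart))
    (hconn : IsPathConnected (spaceUP₂ (bunch T ℓ)))
    (w₀ : ∀ n : Σ v, Fin (ℓ v), {w // T.Adj n.1 w}) :
    IsPathConnected (spaceUD₂ (bunch T ℓ)) ∧
      IsFreeExt (inclUP₂ (bunch T ℓ)) (FreeGen T ℓ w₀) := by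
  have := isPathConnected_iff_pathConnectedSpace.1 hconn
  rw [hUP] at this
  obtain ⟨e, he⟩ := exists_homotopyEquiv_offDiag (T := T) (ℓ := ℓ)
  have := pathConnectedSpace_of_homotopyEquiv e
  obtain ⟨h1, h2⟩ := isFreeExt_offDiag_disc w₀
  have h3 := IsFreeExt.comp_iso (isPiOneIso_of_homotopyEquiv e) h2
  rw [he] at h3
  rw [isPathConnected_iff_pathConnectedSpace]
  have key : ∀ (A B : Set (UC₂ (bunch T ℓ))) (hA : A = down _ (relSet (bunch T ℓ) Apart))
      (hB : B = down _ (disc T ℓ)) (h : A ⊆ B),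
      PathConnectedSpace B ∧ IsFreeExt (ContinuousMap.inclusion h) (FreeGen T ℓ w₀) := by
    rintro _ _ rfl rfl h
    exact ⟨h1, h3⟩
  exact key _ _ hUP spaceUD₂_eq _

theorem exists_homotopyEquiv_spaceUD₂ {W : Type u} [Fintype W] (G : SimpleGraph W) :
    Nonempty (ContinuousMap.HomotopyEquiv (spaceUD₂ G) (UC₂ G)) := by
  obtain ⟨e, -⟩ := exists_homotopyEquiv_UC₂ (G := G)
  exact ⟨((Homeomorph.setCongr spaceUD₂_eq).toHomotopyEquiv.trans e).trans
    ((Homeomorph.setCongr down_confSet).trans (Homeomorph.Set.univ _)).toHomotopyEquiv⟩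

theorem braidGroup₂_equiv {W : Type u} [Fintype W] {G : SimpleGraph W}
    (hc : IsPathConnected (spaceUD₂ G)) {S : Type*} (h : IsFreeExt (inclUP₂ G) S) (x : UC₂ G)
    (y : spaceUP₂ G) :
    Nonempty (braidGroup₂ G x ≃*
      Monoid.Coprod (FundamentalGroup (spaceUP₂ G) y) (FreeGroup S)) := by
  obtain ⟨e⟩ := exists_homotopyEquiv_spaceUD₂ G
  have := isPathConnected_iff_pathConnectedSpace.1 hc
  have := pathConnectedSpace_of_homotopyEquiv e
  obtain ⟨i, -⟩ := h y
  exact ⟨((FundamentalGroup.fundamentalGroupMulEquivOfPathConnected x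
    (e.toFun (inclUP₂ G y))).trans
    (MulEquiv.ofBijective _ (isPiOneIso_of_homotopyEquiv e (inclUP₂ G y))).symm).trans i⟩

/-- Each grape has its own generator from the second round, that of the component `true` of
`bothGrape`. -/
theorem sum_le_card_freeGen (w₀ : ∀ n : Σ v, Fin (ℓ v), {w // T.Adj n.1 w}) :
    ∑ v, ℓ v ≤ Nat.card (FreeGen T ℓ w₀) := by
  have : ∑ v, ℓ v = Nat.card (Σ v, Fin (ℓ v)) := by simp
  rw [this]
  exact Nat.card_le_card_of_injective
    (fun n => (Sum.inl (Sum.inr ⟨n, true, by simp⟩) : FreeGen T ℓ w₀))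
    fun n m h => (Sigma.mk.inj (Sum.inr_injective (Sum.inl_injective h))).1

theorem freeProduct_decomposition
    (hUP : spaceUP₂ (bunch T ℓ) = down (bunch T ℓ) (relSet (bunch T ℓ) Apart))
    (hconn : IsPathConnected (spaceUP₂ (bunch T ℓ))) (hT : ∀ v, ∃ w, T.Adj v w) :
    IsPathConnected (spaceUD₂ (bunch T ℓ)) ∧
    (∀ y : spaceUP₂ (bunch T ℓ),
      Function.Injective (FundamentalGroup.map (inclUP₂ (bunch T ℓ)) y)) ∧
    ∃ N : ℕ, ∑ v, ℓ v ≤ N ∧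
      (∀ y : spaceUP₂ (bunch T ℓ),
        Nonempty (FundamentalGroup (spaceUD₂ (bunch T ℓ)) (inclUP₂ (bunch T ℓ) y) ≃*
          Monoid.Coprod (FundamentalGroup.map (inclUP₂ (bunch T ℓ)) y).range
            (FreeGroup (Fin N)))) ∧
      (∀ (x : UC₂ (bunch T ℓ)) (y : spaceUP₂ (bunch T ℓ)),
        Nonempty (braidGroup₂ (bunch T ℓ) x ≃*
          Monoid.Coprod (FundamentalGroup (spaceUP₂ (bunch T ℓ)) y) (FreeGroup (Fin N)))) := by
  choose w hw using hT
  obtain ⟨hc, hF⟩ := isFreeExt_inclUP₂ hUP hconn fun n => ⟨w n.1, hw n.1⟩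
  have hF' := hF.congr (Finite.equivFin _)
  exact ⟨hc, hF.injective, _, sum_le_card_freeGen _, hF'.range, braidGroup₂_equiv hc hF'⟩

end Conclusion

/-! ### Curvature, hyperplanes and compactness of the discrete configuration space -/

section UD

variable {W : Type u} {G : SimpleGraph W}

/-- Two edges that span a square move different points: `a` moves along one and stays along the
other, and the reverse holds for `c`. -/
theorem linkAdj_UD₂ {x y z : Sym2 W} (h : (UD₂ G).LinkAdj x y z) :
    ∃ a c, x = s(a, c) ∧ c ∈ y ∧ a ∉ y ∧ a ∈ z ∧ c ∉ z := by
  obtain ⟨w, a, b, c, d, h1, h2, h3, h4, h5, h6, rfl, rfl, rfl, rfl⟩ := h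
  have := h1.ne
  have := h2.ne
  exact ⟨a, c, rfl, by simp, by simp [*], by simp, by simp [*, Ne.symm]⟩

theorem isNPC_UD₂ (G : SimpleGraph W) : (UD₂ G).IsNPC := by
  constructor
  · rintro x y z w w' ⟨a, b, c, d, h1, h2, h3, h4, h5, h6, rfl, rfl, rfl, rfl⟩
      ⟨a', b', c', d', h1', h2', h3', h4', h5', h6', e1, e2, rfl, e4⟩
    have := h1.ne
    have := h2.ne
    have := h1'.ne
    have := h2'.ne
    simp only [Sym2.eq_iff] at *
    grind
  -- A triangle in a link would need three edges that move pairwise different points of a pair.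
  · intro x y z t h1 h2 h3
    obtain ⟨a, c, rfl, k1, k2, k3, k4⟩ := linkAdj_UD₂ h1
    obtain ⟨a', c', e, k1', k2', k3', k4'⟩ := linkAdj_UD₂ h2
    obtain ⟨a'', c'', e', k1'', k2'', k3'', k4''⟩ := linkAdj_UD₂ h3
    simp only [Sym2.eq_iff] at *
    grind

/-- The edge `e` of the discrete configuration space moves a point along `m`. -/
def Moves (m : Sym2 W) (e : Sym2 (Sym2 W)) : Prop :=
  ∃ a b v, a ≠ b ∧ v ≠ a ∧ v ≠ b ∧ m = s(a, b) ∧ e = s(s(a, v), s(b, v))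

theorem Moves.unique {m m' : Sym2 W} {e : Sym2 (Sym2 W)} (h : Moves m e) (h' : Moves m' e) :
    m = m' := by
  obtain ⟨a, b, v, h1, h2, h3, rfl, rfl⟩ := h
  obtain ⟨a', b', v', h1', h2', h3', rfl, e⟩ := h'
  simp only [Sym2.eq_iff] at *
  grind

/-- Opposite sides of a square move a point along the same edge of the graph, so this edge is an
invariant of the hyperplane. -/
theorem Moves.of_parallel {e e' : Sym2 (Sym2 W)} (h : (UD₂ G).Parallel e e') (m : Sym2 W) :
    Moves m e ↔ Moves m e' := by
  induction h with
  | rel e e' h =>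
    obtain ⟨x, y, z, w, ⟨a, b, c, d, h1, h2, h3, h4, h5, h6, rfl, rfl, rfl, rfl⟩, rfl, rfl⟩ := h
    have k1 : Moves s(a, b) s(s(a, c), s(b, c)) :=
      ⟨a, b, c, h1.ne, h3.symm, h5.symm, rfl, rfl⟩
    have k2 : Moves s(a, b) s(s(a, d), s(b, d)) :=
      ⟨a, b, d, h1.ne, h4.symm, h6.symm, rfl, rfl⟩
    exact ⟨fun k => k.unique k1 ▸ k2, fun k => k.unique k2 ▸ k1⟩
  | refl e => rfl
  | symm _ _ _ ih => exact ih.symm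
  | trans _ _ _ _ _ ih ih' => exact ih.trans ih'

/-- The edge of the graph is an invariant of parallelism. At a given pair only one of the points can
be moved along it, since the other one does not lie on it. -/
theorem isWeaklySpecial_UD₂ (G : SimpleGraph W) : (UD₂ G).IsWeaklySpecial := by
  rintro x y z ⟨a, b, v, h1, h2, h3, rfl, rfl⟩ - h
  obtain ⟨a', b', v', h1', h2', h3', e1, e2⟩ :=
    (Moves.of_parallel h s(a, b)).1 ⟨a, b, v, h1.ne, h2, h3, rfl, rfl⟩
  have := h1.ne
  simp only [Sym2.eq_iff] at *
  grind

variable [Fintype W]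

theorem isCompact_segment {F : Type*} [AddCommGroup F] [Module ℝ F] [TopologicalSpace F]
    [IsTopologicalAddGroup F] [ContinuousSMul ℝ F] (x y : F) : IsCompact (segment ℝ x y) := by
  rw [segment_eq_image_lineMap]
  exact isCompact_Icc.image AffineMap.lineMap_continuous

/-- The set is the finite union of the products of disjoint closed cells. -/
theorem isCompact_relSet_ne (G : SimpleGraph W) : IsCompact (relSet G (· ≠ ·)) := by
  have : relSet G (· ≠ ·) = ⋃ c ∈ {c : (W × W) × W × W | (c.1.1 = c.1.2 ∨ G.Adj c.1.1 c.1.2) ∧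
      (c.2.1 = c.2.2 ∨ G.Adj c.2.1 c.2.2) ∧
      ∀ a b, (a = c.1.1 ∨ a = c.1.2) → (b = c.2.1 ∨ b = c.2.2) → a ≠ b},
      segment ℝ (pt c.1.1) (pt c.1.2) ×ˢ segment ℝ (pt c.2.1) (pt c.2.2) := by
    ext z
    simp only [mem_iUnion, exists_prop, mem_ofPred_eq, mem_prod]
    have key : ∀ {x : W → ℝ}, IsPoint G x → ∃ a b, (a = b ∨ G.Adj a b) ∧
        x ∈ segment ℝ (pt a) (pt b) ∧ ∀ v, (v = a ∨ v = b) → x v ≠ 0 := by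
      intro x hx
      rcases hx.cases with ⟨a, rfl⟩ | ⟨a, b, hab, ha, hb, h⟩
      · exact ⟨a, a, Or.inl rfl, left_mem_segment _ _ _, by rintro v (rfl | rfl) <;> simp [pt_self]⟩
      · exact ⟨a, b, Or.inr hab, h, by rintro v (rfl | rfl) <;> assumption⟩
    constructor
    · rintro ⟨h1, h2, h⟩
      obtain ⟨a, b, hab, hx, hx'⟩ := key h1
      obtain ⟨c, d, hcd, hy, hy'⟩ := key h2
      exact ⟨((a, b), c, d), ⟨hab, hcd, fun v w hv hw => h v w (hx' v hv) (hy' w hw)⟩, hx, hy⟩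
    · rintro ⟨c, ⟨h1, h2, h⟩, hx, hy⟩
      exact ⟨isPoint_segment h1 hx, isPoint_segment h2 hy, fun a b ha hb =>
        h a b (segment_pt_supp hx ha) (segment_pt_supp hy hb)⟩
  rw [this]
  exact (Set.toFinite _).isCompact_biUnion fun c _ =>
    (isCompact_segment _ _).prod (isCompact_segment _ _)

theorem isCompact_spaceUD₂ (G : SimpleGraph W) : IsCompact (spaceUD₂ G) := by
  rw [spaceUD₂_eq]
  have h : IsCompact ((↑) ⁻¹' relSet G (· ≠ ·) : Set (confSet G)) :=
    IsEmbedding.subtypeVal.isInducing.isCompact_preimage' (isCompact_relSet_ne G)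
      (by rw [Subtype.range_coe]; exact relSet_subset fun _ h => h rfl)
  exact h.image continuous_unord

end UD

/-! ### Full subcomplexes -/

namespace SquareComplex

variable {X : Type u}

/-- The full subcomplex spanned by a set of vertices. -/
def full (L : SquareComplex X) (S : Set X) : SquareComplex X where
  verts := L.verts ∩ S
  Adj x y := L.Adj x y ∧ x ∈ S ∧ y ∈ S
  IsSquare x y z w := L.IsSquare x y z w ∧ x ∈ S ∧ y ∈ S ∧ z ∈ S ∧ w ∈ S
  adj_symm h := ⟨L.adj_symm h.1, h.2.2, h.2.1⟩
  adj_ne h := L.adj_ne h.1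
  adj_mem h := ⟨L.adj_mem h.1, h.2.1⟩
  square_adj h := ⟨L.square_adj h.1, h.2.1, h.2.2.1⟩
  square_ne h := L.square_ne h.1
  square_rotate h := ⟨L.square_rotate h.1, h.2.2.1, h.2.2.2.1, h.2.2.2.2, h.2.1⟩
  square_reflect h := ⟨L.square_reflect h.1, h.2.1, h.2.2.2.2, h.2.2.2.1, h.2.2.1⟩

theorem IsSubcomplex.full {K L : SquareComplex X} (h : K.IsSubcomplex L) {S : Set X}
    (hS : K.verts ⊆ S) : K.IsSubcomplex (L.full S) where
  verts hx := ⟨h.verts hx, hS hx⟩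
  adj hx := ⟨h.adj hx, hS (K.adj_mem hx), hS (K.adj_mem (K.adj_symm hx))⟩
  square hx := ⟨h.square hx, hS (K.adj_mem (K.square_adj hx)),
    hS (K.adj_mem (K.square_adj (K.square_rotate hx))),
    hS (K.adj_mem (K.square_adj (K.square_rotate (K.square_rotate hx)))),
    hS (K.adj_mem (K.square_adj (K.square_rotate (K.square_rotate (K.square_rotate hx)))))⟩

theorem IsStandardProduct.isSubcomplex {L P : SquareComplex X} (h : IsStandardProduct L P) :
    P.IsSubcomplex L := by
  obtain ⟨V₁, V₂, G₁, G₂, f, -, -, hf, -, -, hP⟩ := h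
  refine ⟨fun hx => ?_, fun hx => ?_, fun hx => ?_⟩
  · obtain ⟨y, hy, rfl⟩ := (hP.verts _).1 hx
    exact hf.verts hy
  · obtain ⟨x', y', h', rfl, rfl⟩ := (hP.adj _ _).1 hx
    exact hf.adj h'
  · obtain ⟨x', y', z', w', h', rfl, rfl, rfl, rfl⟩ := (hP.square _ _ _ _).1 hx
    exact hf.square h'

end SquareComplex

open SquareComplex

/-! ### Leaves, disjoint cycles and squares in a bunch of grapes -/

section Basic

variable {V : Type u} {T : SimpleGraph V} {ℓ : V → ℕ}

theorem leafless_bunch (h : IsNormalBunch T ℓ) : Leafless (bunch T ℓ) := by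
  rintro (v | ⟨v, i, b⟩) ⟨w | p, hw, hu⟩
  · have hn : T.neighborSet v = {w} := by
      ext x
      refine ⟨fun hx => Sum.inl_injective (hu (Sum.inl x) (bunch_adj_inl_inl.2 hx)), ?_⟩
      rintro rfl
      exact bunch_adj_inl_inl.1 hw
    have := h.leaf v (by rw [hn, ncard_singleton])
    have := hu (gv ℓ v ⟨0, this⟩ false) (bunch_adj_inl_inr.2 rfl)
    cases this
  · obtain ⟨v, i, b⟩ := p
    obtain rfl := bunch_adj_inl_inr.1 hw
    have := hu (gv ℓ v i (!b)) (bunch_adj_inl_inr.2 rfl)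
    cases b <;> cases this
  · have := hu (gv ℓ v i (!b)) (bunch_adj_inr_inr.2 rfl)
    cases this
  · have := hu (Sum.inl v) (bunch_adj_inl_inr.2 rfl).symm
    cases this

theorem exists_triangle {v : V} (h : 0 < ℓ v) :
    ∃ p : (bunch T ℓ).Walk (Sum.inl v) (Sum.inl v), p.IsCycle ∧
      ∀ a ∈ p.support, stemOf a = v := by
  have h1 : (bunch T ℓ).Adj (Sum.inl v) (gv ℓ v ⟨0, h⟩ false) := bunch_adj_inl_inr.2 rfl
  have h2 : (bunch T ℓ).Adj (gv ℓ v ⟨0, h⟩ false) (gv ℓ v ⟨0, h⟩ true) := bunch_adj_inr_inr.2 rfl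
  have h3 : (bunch T ℓ).Adj (gv ℓ v ⟨0, h⟩ true) (Sum.inl v) := (bunch_adj_inl_inr.2 rfl).symm
  refine ⟨.cons h1 (.cons h2 (.cons h3 .nil)), ?_, ?_⟩
  · simp [SimpleGraph.Walk.isCycle_def, SimpleGraph.Walk.isTrail_def]
  · intro a ha
    simp only [SimpleGraph.Walk.support_cons, SimpleGraph.Walk.support_nil, List.mem_cons,
      List.not_mem_nil, or_false] at ha
    rcases ha with rfl | rfl | rfl | rfl <;> rfl

theorem hasDisjointCycles_bunch (h : IsNormalBunch T ℓ) : HasDisjointCycles (bunch T ℓ) := by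
  obtain ⟨v₁, v₂, hne, h1, h2⟩ := h.large
  obtain ⟨p, hp, hp'⟩ := exists_triangle (T := T) h1
  obtain ⟨q, hq, hq'⟩ := exists_triangle (T := T) h2
  exact ⟨_, _, p, q, hp, hq, fun a ha hb => hne ((hp' a ha).symm.trans (hq' a hb))⟩

theorem IsNormalBunch.exists_adj (h : IsNormalBunch T ℓ) (v : V) : ∃ w, T.Adj v w := by
  obtain ⟨v₁, v₂, hne, -, -⟩ := h.large
  have : Nontrivial V := ⟨v₁, v₂, hne⟩
  exact h.tree.connected.preconnected.exists_adj_of_nontrivial v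

theorem neighbor_gv {v : V} {i : Fin (ℓ v)} {c : Bool} {a : GrapeVertex ℓ}
    (h : (bunch T ℓ).Adj (gv ℓ v i c) a) : a = Sum.inl v ∨ a = gv ℓ v i (!c) := by
  rcases a with w | p
  · exact Or.inl (congrArg Sum.inl (bunch_adj_inl_inr.1 h.symm).symm)
  · exact Or.inr (by rw [bunch_adj_inr_inr.1 h])

/-- If `b` and `d` lie over the same stem vertex, then the edges `ab` and `cd` both cross to another
one, hence are twigs, and `b` and `d` are both that stem vertex. -/
theorem apart_of_adj {a b c d : GrapeVertex ℓ} (hab : (bunch T ℓ).Adj a b)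
    (hcd : (bunch T ℓ).Adj c d) (hbd : b ≠ d) (h2 : Apart b c) (h3 : Apart a d) :
    Apart b d := by
  intro e
  have hb := (stemOf_adj hab fun h => h3 (h.trans e)).2.1
  have hd := (stemOf_adj hcd fun h => h2 (e.trans h.symm)).2.1
  exact hbd (by rw [hb, hd, e])

end Basic

/-! ### Products in the discrete configuration space -/

section Split

variable {W : Type u} {G : SimpleGraph W} {V₁ V₂ : Type u} {G₁ : SimpleGraph V₁}
  {G₂ : SimpleGraph V₂} {f : V₁ × V₂ → Sym2 W}

theorem exists_adj_of_connected {U : Type*} {H : SimpleGraph U} (h : H.Connected)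
    (h' : ∃ a b, H.Adj a b) (v : U) : ∃ w, H.Adj v w := by
  obtain ⟨a, b, hab⟩ := h'
  have : Nontrivial U := ⟨a, b, hab.ne⟩
  exact h.preconnected.exists_adj_of_nontrivial v

theorem eq_of_connected {U Z : Type*} {H : SimpleGraph U} (h : H.Connected) {g : U → Z}
    (hg : ∀ a b, H.Adj a b → g a = g b) (a b : U) : g a = g b := by
  obtain ⟨p⟩ := h.preconnected a b
  induction p with
  | nil => rfl
  | cons hab _ ih => exact (hg _ _ hab).trans ih

/-- A map from a product to the discrete configuration space moves one point in each direction. -/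
theorem exists_split (h₁ : G₁.Connected) (h₁' : ∃ a b, G₁.Adj a b) (h₂ : G₂.Connected)
    (h₂' : ∃ a b, G₂.Adj a b) (hf : IsCombinatorial (prod G₁ G₂) (UD₂ G) f) :
    ∃ (α : V₁ → W) (β : V₂ → W), (∀ a b, f (a, b) = s(α a, β b)) ∧
      (∀ a a', G₁.Adj a a' → G.Adj (α a) (α a')) ∧ ∀ a b, α a ≠ β b := by
  have hsq : ∀ a a' b b', G₁.Adj a a' → G₂.Adj b b' → ∃ p q r t, G.Adj p q ∧ G.Adj r t ∧
      p ≠ r ∧ p ≠ t ∧ q ≠ r ∧ q ≠ t ∧ f (a, b) = s(p, r) ∧ f (a', b) = s(q, r) ∧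
      f (a', b') = s(q, t) ∧ f (a, b') = s(p, t) := fun a a' b b' h h' =>
    hf.square ⟨a, a', b, b', h, h', Or.inl ⟨rfl, rfl, rfl, rfl⟩⟩
  -- At each vertex one point, `p`, moves along all edges of the first factor and the other one,
  -- `r`, along all edges of the second. Comparing two squares with a common edge shows that the
  -- labels do not depend on the edge.
  have hrep : ∀ a b, ∃ p r, f (a, b) = s(p, r) ∧
      (∀ a', G₁.Adj a a' → r ∈ f (a', b) ∧ p ∉ f (a', b)) ∧
      ∀ b', G₂.Adj b b' → p ∈ f (a, b') ∧ r ∉ f (a, b') := by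
    intro a b
    obtain ⟨a₀, ha₀⟩ := exists_adj_of_connected h₁ h₁' a
    obtain ⟨b₀, hb₀⟩ := exists_adj_of_connected h₂ h₂' b
    obtain ⟨p, q, r, t, h1, h2, h3, h4, h5, h6, e1, e2, e3, e4⟩ := hsq a a₀ b b₀ ha₀ hb₀
    have := h1.ne
    have := h2.ne
    refine ⟨p, r, e1, fun a' ha' => ?_, fun b' hb' => ?_⟩
    · obtain ⟨p', q', r', t', h1', h2', h3', h4', h5', h6', e1', e2', e3', e4'⟩ :=
        hsq a a' b b₀ ha' hb₀
      have := h1'.ne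
      have := h2'.ne
      rw [e2']
      rw [e1'] at e1
      rw [e4'] at e4
      simp only [Sym2.eq_iff, Sym2.mem_iff] at *
      grind
    · obtain ⟨p', q', r', t', h1', h2', h3', h4', h5', h6', e1', e2', e3', e4'⟩ :=
        hsq a a₀ b b' ha₀ hb'
      have := h1'.ne
      have := h2'.ne
      rw [e4']
      rw [e1'] at e1
      rw [e2'] at e2
      simp only [Sym2.eq_iff, Sym2.mem_iff] at *
      grind
  choose P R hPR hH hV using hrep
  have key : ∀ a a' b b', G₁.Adj a a' → G₂.Adj b b' →
      G.Adj (P a b) (P a' b) ∧ R a b = R a' b ∧ P a b = P a b' ∧ P a b ≠ R a b := by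
    intro a a' b b' ha hb
    obtain ⟨p, q, r, t, h1, h2, h3, h4, h5, h6, e1, e2, e3, e4⟩ := hsq a a' b b' ha hb
    have := h1.ne
    have := h2.ne
    have k1 := hH a b a' ha
    have k2 := hV a b b' hb
    have k3 := hH a' b a ha.symm
    have k4 := hV a' b b' hb
    have k5 := hV a b' b hb.symm
    have k6 := hH a b' a' ha
    have l1 := hPR a b
    have l2 := hPR a' b
    have l3 := hPR a b'
    have m1 : P a b = p ∧ R a b = r := by
      rw [e2] at k1
      rw [e1] at l1
      simp only [Sym2.eq_iff, Sym2.mem_iff] at *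
      grind
    have m2 : P a' b = q ∧ R a' b = r := by
      rw [e3] at k4
      rw [e2] at l2
      simp only [Sym2.eq_iff, Sym2.mem_iff] at *
      grind
    have m3 : P a b' = p := by
      rw [e3] at k6
      rw [e4] at l3
      simp only [Sym2.eq_iff, Sym2.mem_iff] at *
      grind
    rw [m1.1, m1.2, m2.1, m2.2, m3]
    exact ⟨h1, rfl, rfl, h3⟩
  have hN₁ := exists_adj_of_connected h₁ h₁'
  have hN₂ := exists_adj_of_connected h₂ h₂'
  obtain ⟨a₀, -, -⟩ := h₁'
  obtain ⟨b₀, -, -⟩ := h₂'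
  -- The first point does not change along edges of the second factor, which is connected.
  have hP : ∀ a b, P a b = P a b₀ := fun a b => eq_of_connected h₂ (g := P a) (fun b b' hb => by
    obtain ⟨a', ha'⟩ := hN₁ a
    exact (key a a' b b' ha' hb).2.2.1) b b₀
  have hR : ∀ a b, R a b = R a₀ b := fun a b => eq_of_connected h₁ (g := fun a => R a b)
    (fun a a' ha => by
      obtain ⟨b', hb'⟩ := hN₂ b
      exact (key a a' b b' ha hb').2.1) a a₀
  refine ⟨fun a => P a b₀, R a₀, fun a b => by rw [hPR, hP, hR], fun a a' ha => ?_, fun a b => ?_⟩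
  · obtain ⟨b', hb'⟩ := hN₂ b₀
    exact (key a a' b₀ b' ha hb').1
  · obtain ⟨a', ha'⟩ := hN₁ a
    obtain ⟨b', hb'⟩ := hN₂ b
    have := (key a a' b b' ha' hb').2.2.2
    rwa [hP, hR] at this

end Split

/-! ### The maximal product subcomplexes -/

section Products

variable {V : Type u} {T : SimpleGraph V} {ℓ : V → ℕ}

/-- The pairs of vertices with distinct images in the stem. -/
def apartSet (ℓ : V → ℕ) : Set (Sym2 (GrapeVertex ℓ)) := {p | ∃ a b, Apart a b ∧ p = s(a, b)}

theorem mem_apartSet {a b : GrapeVertex ℓ} : s(a, b) ∈ apartSet ℓ ↔ Apart a b := by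
  constructor
  · rintro ⟨c, d, h, e⟩
    rcases Sym2.eq_iff.1 e with ⟨rfl, rfl⟩ | ⟨rfl, rfl⟩
    exacts [h, h.symm]
  · exact fun h => ⟨a, b, h, rfl⟩

/-- An immersed leafless graph that meets a grape contains its stem vertex. -/
theorem exists_eq_inl {U : Type*} {H : SimpleGraph U} (hc : H.Connected) (he : ∃ a b, H.Adj a b)
    (hl : Leafless H) {α : U → GrapeVertex ℓ} (hα : ∀ a b, H.Adj a b → (bunch T ℓ).Adj (α a) (α b))
    (hi : Function.Injective α) (a : U) : ∃ b, α b = Sum.inl (stemOf (α a)) := by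
  rcases h : α a with v | ⟨v, i, c⟩
  · exact ⟨a, h⟩
  obtain ⟨b, hb⟩ := exists_adj_of_connected hc he a
  obtain ⟨b', hb', hne⟩ : ∃ b', H.Adj a b' ∧ b' ≠ b := by
    by_contra! h'
    exact hl a ⟨b, hb, h'⟩
  have k := hα _ _ hb
  have k' := hα _ _ hb'
  rw [h] at k k'
  rcases neighbor_gv k with e | e
  · exact ⟨b, e⟩
  rcases neighbor_gv k' with e' | e'
  · exact ⟨b', e'⟩
  exact absurd (hi (e'.trans e.symm)) hne

/-- A standard product subcomplex is the set of pairs of cells of two subgraphs over disjoint parts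
of the stem. -/
theorem exists_split_apart {P : SquareComplex (Sym2 (GrapeVertex ℓ))}
    (hP : IsStandardProduct (UD₂ (bunch T ℓ)) P) :
    ∃ A B : Set (GrapeVertex ℓ), (∀ a ∈ A, ∀ b ∈ B, Apart a b) ∧
      P.verts = {p | ∃ a ∈ A, ∃ b ∈ B, p = s(a, b)} := by
  obtain ⟨V₁, V₂, G₁, G₂, f, ⟨c₁, e₁, l₁⟩, ⟨c₂, e₂, l₂⟩, hf, ⟨v₂, i₁⟩, ⟨v₁, i₂⟩, hP⟩ := hP
  obtain ⟨α, β, hfαβ, hα, hne⟩ := exists_split c₁ e₁ c₂ e₂ hf.toIsCombinatorial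
  have hβ : ∀ b b', G₂.Adj b b' → (bunch T ℓ).Adj (β b) (β b') := by
    intro b b' hb
    obtain ⟨p, q, v, h1, h2, h3, k1, k2⟩ := hf.adj (x := (v₁, b)) (y := (v₁, b'))
      (SimpleGraph.boxProd_adj.2 (Or.inr ⟨hb, rfl⟩))
    rw [hfαβ] at k1 k2
    have := hne v₁ b
    have := hne v₁ b'
    have hpq := h1.ne
    rcases Sym2.eq_iff.1 k1 with ⟨h, h'⟩ | ⟨h, h'⟩ <;>
    rcases Sym2.eq_iff.1 k2 with ⟨k, k'⟩ | ⟨k, k'⟩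
    · exact absurd (h.symm.trans k) hpq
    · exact absurd (k.symm.trans h) h2
    · exact absurd (h.symm.trans k) h3
    · rw [h', k']
      exact h1
  have hαi : Function.Injective α := fun a a' h => i₁ (by simp only [hfαβ, h])
  have hβi : Function.Injective β := fun b b' h => i₂ (by simp only [hfαβ, h])
  refine ⟨range α, range β, ?_, ?_⟩
  -- Over a common stem vertex both factors would contain this vertex itself, although their images
  -- are disjoint.
  · rintro _ ⟨a, rfl⟩ _ ⟨b, rfl⟩ h
    obtain ⟨a', ha'⟩ := exists_eq_inl c₁ e₁ l₁ hα hαi a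
    obtain ⟨b', hb'⟩ := exists_eq_inl c₂ e₂ l₂ hβ hβi b
    exact hne a' b' (by rw [ha', hb', h])
  · ext p
    rw [hP.verts]
    constructor
    · rintro ⟨⟨a, b⟩, -, rfl⟩
      exact ⟨_, ⟨a, rfl⟩, _, ⟨b, rfl⟩, hfαβ a b⟩
    · rintro ⟨_, ⟨a, rfl⟩, _, ⟨b, rfl⟩, rfl⟩
      exact ⟨(a, b), mem_univ _, hfαβ a b⟩

theorem UP₂_subcomplex_full :
    (UP₂ (bunch T ℓ)).IsSubcomplex ((UD₂ (bunch T ℓ)).full (apartSet ℓ)) := by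
  refine (UP₂_isSubcomplex _).full ?_
  rintro p ⟨M, hM, hp⟩
  obtain ⟨A, B, hAB, hv⟩ := exists_split_apart hM.1
  rw [hv] at hp
  obtain ⟨a, ha, b, hb, rfl⟩ := hp
  exact ⟨a, b, hAB a ha b hb, rfl⟩

/-- One side of a twig. -/
structure IsSide (T : SimpleGraph V) (S : Set V) (s s' : V) : Prop where
  mem : s ∈ S
  cross : ∀ v ∈ S, ∀ w ∉ S, T.Adj v w → v = s ∧ w = s'
  conn : ∀ v ∈ S, Relation.ReflTransGen (fun u w => T.Adj u w ∧ u ∈ S ∧ w ∈ S) s v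

/-- The part of the bunch of grapes over a part of the stem. -/
abbrev grapesOver (T : SimpleGraph V) (ℓ : V → ℕ) (S : Set V) :
    SimpleGraph {a : GrapeVertex ℓ | stemOf a ∈ S} := (bunch T ℓ).induce _

theorem IsSide.connected {S : Set V} {s s' : V} (h : IsSide T S s s') :
    (grapesOver T ℓ S).Connected := by
  have h0 : ∀ v (hv : v ∈ S), (grapesOver T ℓ S).Reachable ⟨Sum.inl s, h.mem⟩ ⟨Sum.inl v, hv⟩ := by
    intro v hv
    have hr := h.conn v hv
    induction hr with
    | refl => exact .rfl
    | @tail u w _ huw ih =>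
      refine (ih huw.2.1).trans (SimpleGraph.Adj.reachable ?_)
      exact bunch_adj_inl_inl.2 huw.1
  have h1 : ∀ a : {a : GrapeVertex ℓ | stemOf a ∈ S},
      (grapesOver T ℓ S).Reachable ⟨Sum.inl s, h.mem⟩ a := by
    rintro ⟨v | ⟨v, p⟩, hv⟩
    · exact h0 v hv
    · refine (h0 v hv).trans (SimpleGraph.Adj.reachable ?_)
      exact bunch_adj_inl_inr.2 rfl
  have : Nonempty {a : GrapeVertex ℓ | stemOf a ∈ S} := ⟨⟨Sum.inl s, h.mem⟩⟩
  exact ⟨fun a b => (h1 a).symm.trans (h1 b)⟩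

/-- A stem vertex with a grape has its two grape neighbours. Without a grape, normality and
minimality exclude valencies one and two, so the valency is at least three, and at most the
neighbour `s'` lies on the other side. -/
theorem IsSide.exists_two_neighbors [Finite V] (hΓ : IsNormalBunch T ℓ) {S : Set V} {s s' : V}
    (h : IsSide T S s s') (a : {a : GrapeVertex ℓ | stemOf a ∈ S}) :
    ∃ b c, b ≠ c ∧ (grapesOver T ℓ S).Adj a b ∧ (grapesOver T ℓ S).Adj a c := by
  obtain ⟨v | ⟨v, i, c⟩, hv⟩ := a
  · by_cases h0 : 1 ≤ ℓ v
    · refine ⟨⟨gv ℓ v ⟨0, h0⟩ false, hv⟩, ⟨gv ℓ v ⟨0, h0⟩ true, hv⟩, ?_,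
        bunch_adj_inl_inr.2 rfl, bunch_adj_inl_inr.2 rfl⟩
      intro e
      have := congrArg Subtype.val e
      cases this
    · have hn1 : (T.neighborSet v).ncard ≠ 1 := fun e => h0 (hΓ.leaf v e)
      have hn2 : (T.neighborSet v).ncard ≠ 2 := fun e => h0 (hΓ.minimal v e)
      have hn0 : (T.neighborSet v).ncard ≠ 0 := by
        obtain ⟨w, hw⟩ := hΓ.exists_adj v
        exact ncard_ne_zero_of_mem (a := w) hw
      have hn : 1 < (T.neighborSet v \ {s'}).ncard := by
        have := pred_ncard_le_ncard_sdiff_singleton (T.neighborSet v) s'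
        omega
      obtain ⟨b, c, hb, hc, hbc⟩ := (one_lt_ncard_iff (toFinite _)).1 hn
      have hS : ∀ b ∈ T.neighborSet v \ {s'}, b ∈ S := by
        intro b hb
        by_contra hbS
        exact hb.2 (h.cross v hv b hbS hb.1).2
      refine ⟨⟨Sum.inl b, hS b hb⟩, ⟨Sum.inl c, hS c hc⟩, ?_,
        bunch_adj_inl_inl.2 hb.1, bunch_adj_inl_inl.2 hc.1⟩
      intro e
      exact hbc (Sum.inl_injective (congrArg Subtype.val e))
  · refine ⟨⟨Sum.inl v, hv⟩, ⟨gv ℓ v i (!c), hv⟩, ?_, (bunch_adj_inl_inr.2 rfl).symm,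
      bunch_adj_inr_inr.2 rfl⟩
    intro e
    have := congrArg Subtype.val e
    cases this

theorem IsSide.leafless [Finite V] (hΓ : IsNormalBunch T ℓ) {S : Set V} {s s' : V}
    (h : IsSide T S s s') : Leafless (grapesOver T ℓ S) := by
  rintro a ⟨w, -, hu⟩
  obtain ⟨b, c, hbc, hb, hc⟩ := h.exists_two_neighbors hΓ a
  exact hbc ((hu b hb).trans (hu c hc).symm)

theorem IsSide.exists_adj [Finite V] (hΓ : IsNormalBunch T ℓ) {S : Set V} {s s' : V}
    (h : IsSide T S s s') : ∃ a b, (grapesOver T ℓ S).Adj a b := by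
  obtain ⟨b, -, -, hb, -⟩ := h.exists_two_neighbors hΓ ⟨Sum.inl s, h.mem⟩
  exact ⟨_, b, hb⟩

/-- The pairs of vertices over the two sides of a twig. -/
def sideSet (ℓ : V → ℕ) (S : Set V) : Set (Sym2 (GrapeVertex ℓ)) :=
  {p | ∃ a b, stemOf a ∈ S ∧ stemOf b ∈ Sᶜ ∧ p = s(a, b)}

theorem mem_sideSet {S : Set V} {a b : GrapeVertex ℓ} :
    s(a, b) ∈ sideSet ℓ S ↔
      (stemOf a ∈ S ∧ stemOf b ∈ Sᶜ) ∨ (stemOf b ∈ S ∧ stemOf a ∈ Sᶜ) := by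
  constructor
  · rintro ⟨c, d, hc, hd, e⟩
    rcases Sym2.eq_iff.1 e with ⟨rfl, rfl⟩ | ⟨rfl, rfl⟩
    exacts [Or.inl ⟨hc, hd⟩, Or.inr ⟨hc, hd⟩]
  · rintro (⟨h, h'⟩ | ⟨h, h'⟩)
    exacts [⟨a, b, h, h', rfl⟩, ⟨b, a, h, h', Sym2.eq_swap⟩]

/-- The pair of a vertex over `S` and a vertex over the complement. -/
def sidePair (ℓ : V → ℕ) (S : Set V)
    (x : {a : GrapeVertex ℓ | stemOf a ∈ S} × {a : GrapeVertex ℓ | stemOf a ∈ Sᶜ}) :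
    Sym2 (GrapeVertex ℓ) := s(x.1.1, x.2.1)

theorem side_ne {S : Set V} (a : {a : GrapeVertex ℓ | stemOf a ∈ S})
    (b : {a : GrapeVertex ℓ | stemOf a ∈ Sᶜ}) : a.1 ≠ b.1 := fun e => b.2 (e ▸ a.2)

theorem injective_sidePair {S : Set V} : Function.Injective (sidePair ℓ S) := by
  rintro ⟨a, b⟩ ⟨a', b'⟩ h
  rcases Sym2.eq_iff.1 h with ⟨h1, h2⟩ | ⟨h1, h2⟩
  · exact Prod.ext (Subtype.ext h1) (Subtype.ext h2)
  · exact absurd h1 (side_ne a b')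

/-- A square at a vertex moves both points, so its two edges come from different factors and span a
square of the product. -/
theorem isLocalIsometry_sidePair (S : Set V) :
    IsLocalIsometry (prod (grapesOver T ℓ S) (grapesOver T ℓ Sᶜ)) (UD₂ (bunch T ℓ)) (sidePair ℓ S) where
  verts {x} _ := ⟨x.1.1, x.2.1, side_ne _ _, rfl⟩
  adj {x y} h := by
    obtain ⟨a, b⟩ := x
    obtain ⟨a', b'⟩ := y
    rcases SimpleGraph.boxProd_adj.1 h with ⟨g, e⟩ | ⟨g, e⟩ <;> dsimp only at g e <;> subst e
    · exact ⟨a.1, a'.1, b.1, g, (side_ne _ _).symm, (side_ne _ _).symm, rfl, rfl⟩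
    · exact ⟨b.1, b'.1, a.1, g, side_ne _ _, side_ne _ _, Sym2.eq_swap, Sym2.eq_swap⟩
  square {x y z w} h := by
    obtain ⟨a, b, c, d, h1, h2, ⟨rfl, rfl, rfl, rfl⟩ | ⟨rfl, rfl, rfl, rfl⟩⟩ := h
    · exact ⟨a.1, b.1, c.1, d.1, h1, h2, side_ne _ _, side_ne _ _, side_ne _ _, side_ne _ _,
        rfl, rfl, rfl, rfl⟩
    · exact ⟨c.1, d.1, a.1, b.1, h2, h1, (side_ne _ _).symm, (side_ne _ _).symm,
        (side_ne _ _).symm, (side_ne _ _).symm, Sym2.eq_swap, Sym2.eq_swap, Sym2.eq_swap,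
        Sym2.eq_swap⟩
  link_injective _ _ h := injective_sidePair h
  link_induced {x y z} h h' hl := by
    obtain ⟨a, b⟩ := x
    obtain ⟨a', b'⟩ := y
    obtain ⟨a'', b''⟩ := z
    obtain ⟨p, q, e, k1, k2, k3, k4⟩ := linkAdj_UD₂ hl
    rcases SimpleGraph.boxProd_adj.1 h with ⟨g, e1⟩ | ⟨g, e1⟩ <;>
    rcases SimpleGraph.boxProd_adj.1 h' with ⟨g', e2⟩ | ⟨g', e2⟩ <;>
    dsimp only at g g' e1 e2 <;> subst e1 <;> subst e2
    · have n1 := side_ne a b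
      have n2 := side_ne a' b
      have n3 := side_ne a'' b
      have m1 : a.1 ≠ a'.1 := fun e => g.ne (Subtype.ext e)
      have m2 : a.1 ≠ a''.1 := fun e => g'.ne (Subtype.ext e)
      simp only [sidePair, Sym2.mem_iff, Sym2.eq_iff] at e k1 k2 k3 k4
      grind
    · exact ⟨(a', b''), a, a', b, b'', g, g', Or.inl ⟨rfl, rfl, rfl, rfl⟩⟩
    · exact ⟨(a'', b'), a, a'', b, b', g', g, Or.inr ⟨rfl, rfl, rfl, rfl⟩⟩
    · have n1 := side_ne a b
      have n2 := side_ne a b'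
      have n3 := side_ne a b''
      have m1 : b.1 ≠ b'.1 := fun e => g.ne (Subtype.ext e)
      have m2 : b.1 ≠ b''.1 := fun e => g'.ne (Subtype.ext e)
      simp only [sidePair, Sym2.mem_iff, Sym2.eq_iff] at e k1 k2 k3 k4
      grind

theorem adj_of_sideSet {S : Set V} {p q : Sym2 (GrapeVertex ℓ)} (h : (UD₂ (bunch T ℓ)).Adj p q)
    (hp : p ∈ sideSet ℓ S) (hq : q ∈ sideSet ℓ S) :
    ∃ x y, (prod (grapesOver T ℓ S) (grapesOver T ℓ Sᶜ)).Adj x y ∧ sidePair ℓ S x = p ∧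
      sidePair ℓ S y = q := by
  obtain ⟨a, b, v, hab, h1, h2, rfl, rfl⟩ := h
  rcases mem_sideSet.1 hp with ⟨k1, k2⟩ | ⟨k1, k2⟩ <;>
  rcases mem_sideSet.1 hq with ⟨k3, k4⟩ | ⟨k3, k4⟩
  · exact ⟨(⟨a, k1⟩, ⟨v, k2⟩), (⟨b, k3⟩, ⟨v, k2⟩), SimpleGraph.boxProd_adj.2 (Or.inl ⟨hab, rfl⟩),
      rfl, rfl⟩
  · exact absurd k3 k2
  · exact absurd k1 k4
  · exact ⟨(⟨v, k1⟩, ⟨a, k2⟩), (⟨v, k1⟩, ⟨b, k4⟩), SimpleGraph.boxProd_adj.2 (Or.inr ⟨hab, rfl⟩),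
      Sym2.eq_swap, Sym2.eq_swap⟩

theorem square_of_sideSet {S : Set V} {p q r t : Sym2 (GrapeVertex ℓ)}
    (h : (UD₂ (bunch T ℓ)).IsSquare p q r t) (hp : p ∈ sideSet ℓ S) (hq : q ∈ sideSet ℓ S)
    (hr : r ∈ sideSet ℓ S) (ht : t ∈ sideSet ℓ S) :
    ∃ x y z w, (prod (grapesOver T ℓ S) (grapesOver T ℓ Sᶜ)).IsSquare x y z w ∧ sidePair ℓ S x = p ∧
      sidePair ℓ S y = q ∧ sidePair ℓ S z = r ∧ sidePair ℓ S w = t := by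
  obtain ⟨a, b, c, d, hab, hcd, h1, h2, h3, h4, rfl, rfl, rfl, rfl⟩ := h
  rcases mem_sideSet.1 hp with ⟨k1, k2⟩ | ⟨k1, k2⟩
  · have k3 : stemOf b ∈ S := by
      rcases mem_sideSet.1 hq with ⟨k, -⟩ | ⟨k, -⟩
      exacts [k, absurd k k2]
    have k4 : stemOf d ∈ Sᶜ := by
      rcases mem_sideSet.1 ht with ⟨-, k⟩ | ⟨-, k⟩
      exacts [k, absurd k1 k]
    exact ⟨(⟨a, k1⟩, ⟨c, k2⟩), (⟨b, k3⟩, ⟨c, k2⟩), (⟨b, k3⟩, ⟨d, k4⟩), (⟨a, k1⟩, ⟨d, k4⟩),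
      ⟨⟨a, k1⟩, ⟨b, k3⟩, ⟨c, k2⟩, ⟨d, k4⟩, hab, hcd, Or.inl ⟨rfl, rfl, rfl, rfl⟩⟩,
      rfl, rfl, rfl, rfl⟩
  · have k3 : stemOf b ∈ Sᶜ := by
      rcases mem_sideSet.1 hq with ⟨-, k⟩ | ⟨-, k⟩
      exacts [absurd k1 k, k]
    have k4 : stemOf d ∈ S := by
      rcases mem_sideSet.1 ht with ⟨k, -⟩ | ⟨k, -⟩
      exacts [absurd k k2, k]
    exact ⟨(⟨c, k1⟩, ⟨a, k2⟩), (⟨c, k1⟩, ⟨b, k3⟩), (⟨d, k4⟩, ⟨b, k3⟩), (⟨d, k4⟩, ⟨a, k2⟩),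
      ⟨⟨c, k1⟩, ⟨d, k4⟩, ⟨a, k2⟩, ⟨b, k3⟩, hcd, hab, Or.inr ⟨rfl, rfl, rfl, rfl⟩⟩,
      Sym2.eq_swap, Sym2.eq_swap, Sym2.eq_swap, Sym2.eq_swap⟩

theorem isImage_sidePair (S : Set V) :
    IsImage (prod (grapesOver T ℓ S) (grapesOver T ℓ Sᶜ)) (sidePair ℓ S)
      ((UD₂ (bunch T ℓ)).full (sideSet ℓ S)) := by
  have hf := isLocalIsometry_sidePair (T := T) (ℓ := ℓ) S
  have hm : ∀ x, sidePair ℓ S x ∈ sideSet ℓ S := fun x => ⟨_, _, x.1.2, x.2.2, rfl⟩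
  refine ⟨fun p => ⟨?_, ?_⟩, fun p q => ⟨?_, ?_⟩, fun p q r t => ⟨?_, ?_⟩⟩
  · rintro ⟨-, a, b, ha, hb, rfl⟩
    exact ⟨(⟨a, ha⟩, ⟨b, hb⟩), mem_univ _, rfl⟩
  · rintro ⟨x, hx, rfl⟩
    exact ⟨hf.verts hx, hm x⟩
  · rintro ⟨h, hp, hq⟩
    exact adj_of_sideSet h hp hq
  · rintro ⟨x, y, h, rfl, rfl⟩
    exact ⟨hf.adj h, hm x, hm y⟩
  · rintro ⟨h, hp, hq, hr, ht⟩
    exact square_of_sideSet h hp hq hr ht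
  · rintro ⟨x, y, z, w, h, rfl, rfl, rfl, rfl⟩
    exact ⟨hf.square h, hm x, hm y, hm z, hm w⟩

/-- A larger standard product has vertex pairs from disjoint sets `A` and `B`. Once `s` lies in `A`
and `s'` in `B`, pairing with these two vertices puts everything over `S` in `A` and everything over
the complement in `B`. As the two sides exhaust the graph, nothing is gained. -/
theorem isMaximalProduct_side [Finite V] (hΓ : IsNormalBunch T ℓ) {S : Set V} {s s' : V}
    (h : IsSide T S s s') (h' : IsSide T Sᶜ s' s) :
    IsMaximalProduct (UD₂ (bunch T ℓ)) ((UD₂ (bunch T ℓ)).full (sideSet ℓ S)) := by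
  refine ⟨⟨_, _, _, _, sidePair ℓ S, ⟨h.connected, h.exists_adj hΓ, h.leafless hΓ⟩,
    ⟨h'.connected, h'.exists_adj hΓ, h'.leafless hΓ⟩, isLocalIsometry_sidePair S,
    ⟨⟨Sum.inl s', h'.mem⟩, fun a a' e => (Prod.ext_iff.1 (injective_sidePair e)).1⟩,
    ⟨⟨Sum.inl s, h.mem⟩, fun a a' e => (Prod.ext_iff.1 (injective_sidePair e)).2⟩,
    isImage_sidePair S⟩, fun P hP hMP => hP.isSubcomplex.full ?_⟩
  obtain ⟨A, B, hAB, hv⟩ := exists_split_apart hP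
  have hd : ∀ a ∈ A, a ∉ B := fun a ha hb => hAB a ha a hb rfl
  have key : ∀ a b, stemOf a ∈ S → stemOf b ∈ Sᶜ → (a ∈ A ∧ b ∈ B) ∨ (b ∈ A ∧ a ∈ B) := by
    intro a b ha hb
    have : s(a, b) ∈ P.verts :=
      hMP.verts ⟨⟨a, b, fun e => hb (e ▸ ha), rfl⟩, a, b, ha, hb, rfl⟩
    rw [hv] at this
    obtain ⟨c, hc, d, hd, e⟩ := this
    rcases Sym2.eq_iff.1 e with ⟨rfl, rfl⟩ | ⟨rfl, rfl⟩
    exacts [Or.inl ⟨hc, hd⟩, Or.inr ⟨hc, hd⟩]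
  rw [hv]
  rintro _ ⟨a, ha, b, hb, rfl⟩
  rw [mem_sideSet]
  have ks := key (Sum.inl s) (Sum.inl s') h.mem h'.mem
  have k1 := fun c hc => key c (Sum.inl s') hc h'.mem
  have k2 := fun c hc => key (Sum.inl s) c h.mem hc
  have cov : ∀ c : GrapeVertex ℓ, stemOf c ∈ S ∨ stemOf c ∈ Sᶜ := fun c => em _
  have ca := cov a
  have cb := cov b
  grind

end Products

/-! ### Separation by twigs and the determination of `UP₂` -/

section Twigs

variable {V : Type u} {T : SimpleGraph V} {ℓ : V → ℕ}

/-- A walk into `K` crosses into `K` for the first time. -/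
theorem exists_entry (K : Set V) {y x : V} (p : T.Walk y x) (hy : y ∉ K) (hx : x ∈ K) :
    ∃ s ∈ K, ∃ s' ∉ K, T.Adj s s' ∧
      Relation.ReflTransGen (fun u v => T.Adj u v ∧ u ∉ K ∧ v ∉ K) s' y := by
  induction p with
  | nil => exact absurd hx hy
  | @cons y y₁ x h p ih =>
    by_cases h1 : y₁ ∈ K
    · exact ⟨y₁, h1, y, hy, h.symm, .refl⟩
    · obtain ⟨s, hs, s', hs', hss, hr⟩ := ih h1 hx
      exact ⟨s, hs, s', hs', hss, hr.tail ⟨h.symm, h1, hy⟩⟩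

/-- Reachability without using the twig from `s` to `s'`. -/
abbrev TwigReach (T : SimpleGraph V) (s s' : V) : V → V → Prop :=
  Relation.ReflTransGen fun u v => T.Adj u v ∧ s(u, v) ≠ s(s, s')

theorem TwigReach.symm {s s' u v : V} (h : TwigReach T s s' u v) : TwigReach T s s' v u :=
  have : Std.Symm (fun u v => T.Adj u v ∧ s(u, v) ≠ s(s, s')) :=
    ⟨fun u v h => ⟨h.1.symm, by rw [Sym2.eq_swap]; exact h.2⟩⟩
  Relation.ReflTransGen.stdSymm.symm _ _ h

/-- Every edge of an acyclic graph is a bridge. -/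
theorem not_twigReach (hT : T.IsAcyclic) {s s' : V} (h : T.Adj s s') : ¬ TwigReach T s s' s s' := by
  intro hr
  have hb := SimpleGraph.isAcyclic_iff_forall_adj_isBridge.1 hT h
  refine SimpleGraph.isBridge_iff.1 hb ?_
  rw [SimpleGraph.reachable_iff_reflTransGen]
  exact Relation.ReflTransGen.mono (fun u v huv => SimpleGraph.deleteEdges_adj.2 huv) _ _ hr

theorem twigReach_or (hT : T.Connected) (s s' v : V) :
    TwigReach T s s' s v ∨ TwigReach T s s' s' v := by
  suffices h : ∀ x, T.Walk v x → x = s → TwigReach T s s' s v ∨ TwigReach T s s' s' v from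
    h s (hT.preconnected v s).some rfl
  rintro x p hx
  induction p with
  | nil => exact hx ▸ Or.inl .refl
  | @cons v w _ h p ih =>
    replace ih := ih hx
    by_cases e : s(w, v) = s(s, s')
    · rcases Sym2.eq_iff.1 e with ⟨-, rfl⟩ | ⟨-, rfl⟩
      exacts [Or.inr .refl, Or.inl .refl]
    · exact ih.imp (fun k => k.tail ⟨h.symm, e⟩) fun k => k.tail ⟨h.symm, e⟩

theorem isSide_of_twigReach {s s' : V} {S : Set V} (hS : ∀ v, v ∈ S ↔ TwigReach T s s' s v)
    (hs' : s' ∉ S) : IsSide T S s s' where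
  mem := (hS s).2 .refl
  cross v hv w hw hvw := by
    by_contra hne
    have : s(v, w) = s(s, s') := by
      by_contra e
      exact hw ((hS w).2 (((hS v).1 hv).tail ⟨hvw, e⟩))
    rcases Sym2.eq_iff.1 this with e | ⟨rfl, rfl⟩
    · exact hne e
    · exact hs' hv
  conn v hv := by
    have := (hS v).1 hv
    induction this with
    | refl => exact .refl
    | @tail u w hu huw ih => exact (ih ((hS u).2 hu)).tail ⟨huw.1, (hS u).2 hu, hv⟩

/-- Removing the twig leaves exactly two components, those of its ends. -/
theorem exists_isSide (hT : T.IsTree) {s s' : V} (h : T.Adj s s') :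
    IsSide T {v | TwigReach T s s' s v} s s' ∧ IsSide T {v | TwigReach T s s' s v}ᶜ s' s := by
  have hn := not_twigReach hT.isAcyclic h
  refine ⟨isSide_of_twigReach (fun _ => Iff.rfl) hn, isSide_of_twigReach (fun v => ?_) ?_⟩
  · have e : TwigReach T s' s = TwigReach T s s' := by
      unfold TwigReach
      rw [Sym2.eq_swap]
    rw [e]
    constructor
    · exact (twigReach_or hT.connected s s' v).resolve_left
    · exact fun h1 h2 => hn (Relation.ReflTransGen.trans h2 h1.symm)
  · exact fun h => h .refl

/-- Two disjoint cells of the stem are separated by a twig. -/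
theorem exists_separating (hT : T.IsTree) {a b c d : V} (hab : a = b ∨ T.Adj a b)
    (hcd : c = d ∨ T.Adj c d) (hac : a ≠ c) (had : a ≠ d) (hbc : b ≠ c) (hbd : b ≠ d) :
    ∃ S s s', IsSide T S s s' ∧ IsSide T Sᶜ s' s ∧ a ∈ S ∧ b ∈ S ∧ c ∈ Sᶜ ∧ d ∈ Sᶜ := by
  obtain ⟨p⟩ := hT.connected.preconnected c a
  -- The separating twig is the one by which a walk from `c` first enters the cell `{a, b}`. The
  -- part of the walk before it and the cell `{c, d}` avoid `{a, b}`, hence avoid the twig.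
  obtain ⟨s, hs, s', hs', hss, hr⟩ := exists_entry {a, b} p
    (by simp [hac.symm, hbc.symm]) (by simp)
  obtain ⟨h1, h2⟩ := exists_isSide hT hss
  refine ⟨_, s, s', h1, h2, ?_⟩
  have hK : ∀ u v, u ∉ ({a, b} : Set V) → v ∉ ({a, b} : Set V) → s(u, v) ≠ s(s, s') := by
    intro u v hu hv e
    rcases Sym2.eq_iff.1 e with ⟨rfl, -⟩ | ⟨-, rfl⟩
    exacts [hu hs, hv hs]
  have hcd' : TwigReach T s s' c d := by
    rcases hcd with rfl | hcd
    · exact .refl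
    · exact .single ⟨hcd, hK c d (by simp [hac.symm, hbc.symm]) (by simp [had.symm, hbd.symm])⟩
  have hc : TwigReach T s s' s' c := Relation.ReflTransGen.mono (fun u v huv => ⟨huv.1, hK u v huv.2.1 huv.2.2⟩) _ _ hr
  have hab' : TwigReach T s s' a b := by
    rcases hab with rfl | hab
    · exact .refl
    · refine .single ⟨hab, fun e => ?_⟩
      rcases Sym2.eq_iff.1 e with ⟨-, rfl⟩ | ⟨rfl, -⟩
      · exact hs' (by simp)
      · exact hs' (by simp)
  have hS : ∀ v, TwigReach T s s' s' v → v ∈ {v | TwigReach T s s' s v}ᶜ := fun v h1 h2 =>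
    not_twigReach hT.isAcyclic hss (Relation.ReflTransGen.trans h2 h1.symm)
  refine ⟨?_, ?_, hS c hc, hS d (hc.trans hcd')⟩
  · rcases hs with rfl | rfl
    · exact .refl
    · exact hab'.symm
  · rcases hs with rfl | rfl
    · exact hab'
    · exact .refl

theorem stemOf_adj_or {a b : GrapeVertex ℓ} (h : a = b ∨ (bunch T ℓ).Adj a b) :
    stemOf a = stemOf b ∨ T.Adj (stemOf a) (stemOf b) := by
  rcases h with rfl | h
  · exact Or.inl rfl
  · by_cases e : stemOf a = stemOf b
    exacts [Or.inl e, Or.inr (stemOf_adj h e).2.2]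

theorem exists_maximal [Finite V] (hΓ : IsNormalBunch T ℓ) {a b c d : GrapeVertex ℓ}
    (hab : a = b ∨ (bunch T ℓ).Adj a b) (hcd : c = d ∨ (bunch T ℓ).Adj c d) (hac : Apart a c)
    (had : Apart a d) (hbc : Apart b c) (hbd : Apart b d) :
    ∃ S : Set V, IsMaximalProduct (UD₂ (bunch T ℓ)) ((UD₂ (bunch T ℓ)).full (sideSet ℓ S)) ∧
      s(a, c) ∈ sideSet ℓ S ∧ s(a, d) ∈ sideSet ℓ S ∧ s(b, c) ∈ sideSet ℓ S ∧
      s(b, d) ∈ sideSet ℓ S := by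
  obtain ⟨S, s, s', h1, h2, ha, hb, hc, hd⟩ := exists_separating hΓ.tree (stemOf_adj_or hab)
    (stemOf_adj_or hcd) hac had hbc hbd
  exact ⟨S, isMaximalProduct_side hΓ h1 h2, ⟨a, c, ha, hc, rfl⟩, ⟨a, d, ha, hd, rfl⟩,
    ⟨b, c, hb, hc, rfl⟩, ⟨b, d, hb, hd, rfl⟩⟩

/-- The union of the maximal product subcomplexes consists of the pairs of cells with disjoint
images in the stem. -/
theorem full_isSubcomplex_UP₂ [Finite V] (hΓ : IsNormalBunch T ℓ) :
    ((UD₂ (bunch T ℓ)).full (apartSet ℓ)).IsSubcomplex (UP₂ (bunch T ℓ)) where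
  verts := by
    rintro _ ⟨h, a, c, hac, rfl⟩
    obtain ⟨S, hS, k, -⟩ := exists_maximal hΓ (Or.inl (rfl : a = a)) (Or.inl (rfl : c = c))
      hac hac hac hac
    exact ⟨_, hS, h, k⟩
  adj := by
    rintro _ _ ⟨h, h1, h2⟩
    have h' := h
    obtain ⟨a, b, v, hab, -, -, rfl, rfl⟩ := h'
    rw [mem_apartSet] at h1 h2
    obtain ⟨S, hS, k1, -, k2, -⟩ := exists_maximal hΓ (Or.inr hab) (Or.inl (rfl : v = v))
      h1 h1 h2 h2
    exact ⟨_, hS, h, k1, k2⟩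
  square := by
    rintro _ _ _ _ ⟨h, h1, h2, h3, h4⟩
    have h' := h
    obtain ⟨a, b, c, d, hab, hcd, -, -, -, -, rfl, rfl, rfl, rfl⟩ := h'
    rw [mem_apartSet] at h1 h2 h3 h4
    obtain ⟨S, hS, k1, k2, k3, k4⟩ := exists_maximal hΓ (Or.inr hab) (Or.inr hcd) h1 h4 h2 h3
    exact ⟨_, hS, h, k1, k3, k4, k2⟩

/-- By fullness it suffices that a square of `UD₂` with three corners apart has its fourth corner
apart, which is `apart_of_adj`. -/
theorem isLocallyConvex_UP₂ [Finite V] (hΓ : IsNormalBunch T ℓ) :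
    (UP₂ (bunch T ℓ)).IsLocallyConvex (UD₂ (bunch T ℓ)) := by
  have hs := UP₂_isSubcomplex (bunch T ℓ)
  have hF := UP₂_subcomplex_full (T := T) (ℓ := ℓ)
  refine ⟨hs, ⟨hs.verts, hs.adj, hs.square⟩, fun _ _ h => h, ?_⟩
  rintro x y z hxy hxz ⟨w, h⟩
  refine ⟨w, (full_isSubcomplex_UP₂ hΓ).square ?_⟩
  have h1 := hF.adj hxy
  have h2 := hF.adj hxz
  have h' : (UD₂ (bunch T ℓ)).IsSquare x y w z := h
  refine ⟨h, h1.2.1, h1.2.2, ?_, h2.2.2⟩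
  obtain ⟨a, b, c, d, hab, hcd, -, -, -, hbd, rfl, rfl, rfl, rfl⟩ := h'
  have k1 := mem_apartSet.1 h1.2.2
  have k2 := mem_apartSet.1 h2.2.2
  exact mem_apartSet.2 (apart_of_adj hab hcd hbd k1 k2)

theorem spaceUP₂_eq [Fintype V] (hΓ : IsNormalBunch T ℓ) :
    spaceUP₂ (bunch T ℓ) = down (bunch T ℓ) (relSet (bunch T ℓ) Apart) := by
  have hF := UP₂_subcomplex_full (T := T) (ℓ := ℓ)
  have hF' := full_isSubcomplex_UP₂ hΓ
  have hne : ∀ {a b : GrapeVertex ℓ}, Apart a b → a ≠ b := fun h e => h (e ▸ rfl)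
  refine space_eq_down (fun _ _ => Ne.symm) (fun v w => ⟨fun h => ?_, fun h => ?_⟩)
    (fun a b v => ⟨fun h => ?_, fun h => ?_⟩) (fun a b c d => ⟨fun h => ?_, fun h => ?_⟩)
  · exact mem_apartSet.1 (hF.verts h).2
  · exact hF'.verts ⟨mem_verts_UD₂.2 (hne h), mem_apartSet.2 h⟩
  · obtain ⟨k, k1, k2⟩ := hF.adj h
    exact ⟨(UD₂_adj.1 k).1, mem_apartSet.1 k1, mem_apartSet.1 k2⟩
  · exact hF'.adj ⟨UD₂_adj.2 ⟨h.1, hne h.2.1, hne h.2.2⟩, mem_apartSet.2 h.2.1,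
      mem_apartSet.2 h.2.2⟩
  · obtain ⟨k, k1, k2, k3, k4⟩ := hF.square h
    exact ⟨(UD₂_square.1 k).1, (UD₂_square.1 k).2.1, mem_apartSet.1 k1, mem_apartSet.1 k2,
      mem_apartSet.1 k3, mem_apartSet.1 k4⟩
  · obtain ⟨h1, h2, h3, h4, h5, h6⟩ := h
    exact hF'.square ⟨UD₂_square.2 ⟨h1, h2, hne h3, hne h4, hne h5, hne h6⟩, mem_apartSet.2 h3,
      mem_apartSet.2 h4, mem_apartSet.2 h5, mem_apartSet.2 h6⟩

end Twigs

/-! ### Connectedness -/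

section Connected

variable {W : Type u} [Fintype W] {G : SimpleGraph W}

/-- Two configurations are joined in the image of `Q`. -/
def Linked (G : SimpleGraph W) (Q : Set ((W → ℝ) × (W → ℝ))) (z w : (W → ℝ) × (W → ℝ)) : Prop :=
  ∃ (hz : z ∈ confSet G) (hw : w ∈ confSet G),
    JoinedIn (down G Q) (unord G ⟨z, hz⟩) (unord G ⟨w, hw⟩)

variable {Q : Set ((W → ℝ) × (W → ℝ))} {z w t : (W → ℝ) × (W → ℝ)}

theorem Linked.symm (h : Linked G Q z w) : Linked G Q w z := by
  obtain ⟨hz, hw, h⟩ := h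
  exact ⟨hw, hz, h.symm⟩

theorem Linked.trans (h : Linked G Q z w) (h' : Linked G Q w t) : Linked G Q z t := by
  obtain ⟨hz, hw, h⟩ := h
  obtain ⟨hw', ht, h'⟩ := h'
  exact ⟨hz, ht, h.trans h'⟩

theorem linked_of_segment (hQ : Q ⊆ confSet G) (h : segment ℝ z w ⊆ Q) : Linked G Q z w := by
  have hc : IsPathConnected (segment ℝ z w) :=
    (convex_segment z w).isPathConnected ⟨z, left_mem_segment ℝ z w⟩
  obtain ⟨γ, hγ⟩ := hc.joinedIn z (left_mem_segment ℝ z w) w (right_mem_segment ℝ z w)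
  refine ⟨hQ (h (left_mem_segment ℝ z w)), hQ (h (right_mem_segment ℝ z w)),
    ⟨⟨fun t => unord G ⟨γ t, hQ (h (hγ t))⟩,
      continuous_unord.comp (γ.continuous.subtype_mk _)⟩, ?_, ?_⟩, fun t => ⟨_, h (hγ t), rfl⟩⟩
  · simp
  · simp

theorem linked_swap (hQ : Q ⊆ confSet G) (hz : z ∈ Q) : Linked G Q z z.swap := by
  refine ⟨hQ hz, swap_mem_confSet (hQ hz), ?_⟩
  have : unord G ⟨z, hQ hz⟩ = unord G ⟨z.swap, swap_mem_confSet (hQ hz)⟩ :=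
    unord_eq_iff.2 (Or.inr rfl)
  rw [← this]
  exact JoinedIn.refl ⟨_, hz, rfl⟩

theorem isPathConnected_down (hQ : Q ⊆ confSet G) (hz : z ∈ Q) (h : ∀ w ∈ Q, Linked G Q z w) :
    IsPathConnected (down G Q) := by
  refine ⟨unord G ⟨z, hQ hz⟩, ⟨_, hz, rfl⟩, ?_⟩
  rintro _ ⟨w, hw, rfl⟩
  obtain ⟨_, _, k⟩ := h _ hw
  exact k

end Connected

/-! ### Sliding two points that are apart in the stem -/

section Connected

variable {V : Type u} [Fintype V] {T : SimpleGraph V} {ℓ : V → ℕ}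

theorem apart_subset_confSet : relSet (bunch T ℓ) Apart ⊆ confSet (bunch T ℓ) :=
  relSet_subset fun _ h => h rfl

theorem pt_mem_apart {a b : GrapeVertex ℓ} (h : Apart a b) :
    (pt a, pt b) ∈ relSet (bunch T ℓ) Apart :=
  ⟨isPoint_pt _, isPoint_pt _, fun _ _ hc hd => pt_supp hc ▸ pt_supp hd ▸ h⟩

/-- The configurations that are linked in `relSet Apart`. -/
abbrev ApartLinked (T : SimpleGraph V) (ℓ : V → ℕ) :=
  Linked (bunch T ℓ) (relSet (bunch T ℓ) Apart)

theorem linked_of_compat {z w : (GrapeVertex ℓ → ℝ) × (GrapeVertex ℓ → ℝ)}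
    (hz : z ∈ relSet (bunch T ℓ) Apart) (hw : w ∈ relSet (bunch T ℓ) Apart)
    (h₁ : Compat (bunch T ℓ) z.1 w.1) (h₂ : Compat (bunch T ℓ) z.2 w.2)
    (hzw : ∀ a b, z.1 a ≠ 0 → w.2 b ≠ 0 → Apart a b)
    (hwz : ∀ a b, w.1 a ≠ 0 → z.2 b ≠ 0 → Apart a b) : ApartLinked T ℓ z w := by
  refine linked_of_segment apart_subset_confSet ?_
  rintro _ ⟨s, t, hs, ht, hst, rfl⟩
  obtain ⟨a, b, hab, h1, h1'⟩ := h₁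
  obtain ⟨c, d, hcd, h2, h2'⟩ := h₂
  refine ⟨hz.1.combo hw.1 hab h1 h1' hs ht hst, hz.2.1.combo hw.2.1 hcd h2 h2' hs ht hst, ?_⟩
  intro e f he hf
  have k1 : z.1 e ≠ 0 ∨ w.1 e ≠ 0 := by
    by_contra! h
    simp [h.1, h.2] at he
  have k2 : z.2 f ≠ 0 ∨ w.2 f ≠ 0 := by
    by_contra! h
    simp [h.1, h.2] at hf
  rcases k1 with k1 | k1 <;> rcases k2 with k2 | k2
  · exact hz.2.2 e f k1 k2
  · exact hzw e f k1 k2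
  · exact hwz e f k1 k2
  · exact hw.2.2 e f k1 k2

/-- Each point can be drawn to any vertex of its support without enlarging the support. -/
theorem linked_vertex {z : (GrapeVertex ℓ → ℝ) × (GrapeVertex ℓ → ℝ)}
    (hz : z ∈ relSet (bunch T ℓ) Apart) :
    ∃ a b, Apart a b ∧ ApartLinked T ℓ z (pt a, pt b) := by
  obtain ⟨a, ha⟩ := hz.1.ne_zero
  obtain ⟨b, hb⟩ := hz.2.1.ne_zero
  have hab := hz.2.2 a b ha.ne' hb.ne'
  refine ⟨a, b, hab, linked_of_compat hz (pt_mem_apart hab) (hz.1.compat_pt ha.ne')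
    (hz.2.1.compat_pt hb.ne') (fun c d hc hd => ?_) fun c d hc hd => ?_⟩
  · rw [pt_supp hd]
    exact hz.2.2 c b hc hb.ne'
  · rw [pt_supp hc]
    exact hz.2.2 a d ha.ne' hd

theorem linked_move {a b c : GrapeVertex ℓ} (h : a = b ∨ (bunch T ℓ).Adj a b) (hac : Apart a c)
    (hbc : Apart b c) : ApartLinked T ℓ (pt a, pt c) (pt b, pt c) := by
  refine linked_of_compat (pt_mem_apart hac) (pt_mem_apart hbc)
    ⟨a, b, h, fun _ hv => Or.inl (pt_supp hv), fun _ hv => Or.inr (pt_supp hv)⟩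
    (isPoint_pt _).compat_self (fun d e hd he => ?_) fun d e hd he => ?_
  · rw [pt_supp hd, pt_supp he]
    exact hac
  · rw [pt_supp hd, pt_supp he]
    exact hbc

theorem linked_pt_swap {a b : GrapeVertex ℓ} (h : Apart a b) :
    ApartLinked T ℓ (pt a, pt b) (pt b, pt a) :=
  linked_swap apart_subset_confSet (pt_mem_apart h)

/-- The configuration of two stem vertices. -/
noncomputable abbrev stemPair (ℓ : V → ℕ) (v w : V) :
    (GrapeVertex ℓ → ℝ) × (GrapeVertex ℓ → ℝ) := (pt (Sum.inl v), pt (Sum.inl w))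

theorem linked_stemPair_swap {v w : V} (h : v ≠ w) :
    ApartLinked T ℓ (stemPair ℓ v w) (stemPair ℓ w v) := linked_pt_swap h

theorem linked_stemPair_move {v v' w : V} (h : v = v' ∨ T.Adj v v') (hvw : v ≠ w) (hvw' : v' ≠ w) :
    ApartLinked T ℓ (stemPair ℓ v w) (stemPair ℓ v' w) :=
  linked_move (h.imp (congrArg Sum.inl) bunch_adj_inl_inl.2) hvw hvw'

theorem linked_stem {a b : GrapeVertex ℓ} (h : Apart a b) :
    ApartLinked T ℓ (pt a, pt b) (stemPair ℓ (stemOf a) (stemOf b)) := by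
  have key : ∀ a : GrapeVertex ℓ, a = Sum.inl (stemOf a) ∨
      (bunch T ℓ).Adj a (Sum.inl (stemOf a)) := by
    rintro (v | ⟨v, i, c⟩)
    exacts [Or.inl rfl, Or.inr (bunch_adj_inl_inr.2 rfl).symm]
  have h1 : Apart (Sum.inl (stemOf a)) b := h
  have h2 : Apart (Sum.inl (stemOf b)) (Sum.inl (stemOf a) : GrapeVertex ℓ) := Ne.symm h
  exact (linked_move (key a) h h1).trans ((linked_pt_swap h1).trans
    ((linked_move (key b) h1.symm h2).trans (linked_pt_swap h2)))

/-- The first point walks towards the second one and stops just before it. -/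
theorem linked_adjacent {v w : V} (p : T.Walk v w) (h : v ≠ w) :
    ∃ u, T.Adj w u ∧ ApartLinked T ℓ (stemPair ℓ v w) (stemPair ℓ u w) := by
  induction p with
  | nil => exact absurd rfl h
  | @cons v v₁ w hv p ih =>
    by_cases h1 : v₁ = w
    · subst h1
      exact ⟨v, hv.symm, linked_stemPair_move (Or.inl rfl) h h⟩
    · obtain ⟨u, hu, k⟩ := ih h1
      exact ⟨u, hu, (linked_stemPair_move (Or.inr hv) h h1).trans k⟩

/-- For distinct neighbours `u` and `t` of `w`, the point at `w` moves on to `t` and then the one at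
`u` follows to `w`. -/
theorem linked_twigs {u w t : V} (hu : T.Adj w u) (ht : T.Adj w t) :
    ApartLinked T ℓ (stemPair ℓ u w) (stemPair ℓ t w) := by
  by_cases h : u = t
  · exact linked_stemPair_move (Or.inl h) hu.ne' ht.ne'
  · exact (linked_stemPair_swap hu.ne').trans ((linked_stemPair_move (Or.inr ht) hu.ne
      (Ne.symm h)).trans ((linked_stemPair_swap (Ne.symm h)).trans
      ((linked_stemPair_move (Or.inr hu.symm) h ht.ne).trans (linked_stemPair_swap ht.ne))))

theorem linked_twigs_walk {w w' : V} (p : T.Walk w w') {u t : V} (hu : T.Adj w u)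
    (ht : T.Adj w' t) : ApartLinked T ℓ (stemPair ℓ u w) (stemPair ℓ t w') := by
  induction p generalizing u with
  | nil => exact linked_twigs hu ht
  | cons h p ih =>
    exact (linked_twigs hu h).trans ((linked_stemPair_swap h.ne').trans (ih h.symm ht))

/-- Every configuration can be drawn to two vertices, then to their stem vertices, then to the ends
of a twig. A pair at the ends of a twig can crawl to any other twig along a walk in the stem. -/
theorem isPathConnected_spaceUP₂ (hΓ : IsNormalBunch T ℓ) :
    IsPathConnected (spaceUP₂ (bunch T ℓ)) := by
  rw [spaceUP₂_eq hΓ]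
  obtain ⟨v, -, -⟩ := hΓ.large
  obtain ⟨u, hu⟩ := hΓ.exists_adj v
  refine isPathConnected_down apart_subset_confSet
    (pt_mem_apart (a := Sum.inl u) (b := Sum.inl v) hu.ne') fun z hz => ?_
  obtain ⟨a, b, hab, h1⟩ := linked_vertex hz
  obtain ⟨p⟩ := hΓ.tree.connected.preconnected (stemOf a) (stemOf b)
  obtain ⟨t, ht, h2⟩ := linked_adjacent (ℓ := ℓ) p hab
  obtain ⟨q⟩ := hΓ.tree.connected.preconnected v (stemOf b)
  exact (linked_twigs_walk q hu ht).trans (h1.trans ((linked_stem hab).trans h2)).symm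

end Connected

end GraphBraid

theorem mainTheorem6 {V : Type u} [Fintype V] (T : SimpleGraph V) (ℓ : V → ℕ)
    (hΓ : IsNormalBunch T ℓ) :
    -- the graph is leafless and contains two disjoint cycles
    (Leafless (bunch T ℓ) ∧ HasDisjointCycles (bunch T ℓ)) ∧
    -- `UD₂` is a compact, connected, weakly special, non-positively curved square complex
    ((UD₂ (bunch T ℓ)).IsNPC ∧ (UD₂ (bunch T ℓ)).IsWeaklySpecial ∧
      IsCompact (spaceUD₂ (bunch T ℓ)) ∧ IsPathConnected (spaceUD₂ (bunch T ℓ))) ∧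
    -- `UP₂` is nonempty and connected
    IsPathConnected (spaceUP₂ (bunch T ℓ)) ∧
    -- `UP₂` is locally convex in `UD₂`
    (UP₂ (bunch T ℓ)).IsLocallyConvex (UD₂ (bunch T ℓ)) ∧
    -- the inclusion is injective on fundamental groups
    (∀ y : spaceUP₂ (bunch T ℓ),
      Function.Injective (FundamentalGroup.map (inclUP₂ (bunch T ℓ)) y)) ∧
    -- the free product decompositions
    ∃ N : ℕ, ∑ v, ℓ v ≤ N ∧
      (∀ y : spaceUP₂ (bunch T ℓ),
        Nonempty (FundamentalGroup (spaceUD₂ (bunch T ℓ)) (inclUP₂ (bunch T ℓ) y) ≃*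
          Monoid.Coprod (FundamentalGroup.map (inclUP₂ (bunch T ℓ)) y).range
            (FreeGroup (Fin N)))) ∧
      (∀ (x : UC₂ (bunch T ℓ)) (y : spaceUP₂ (bunch T ℓ)),
        Nonempty (braidGroup₂ (bunch T ℓ) x ≃*
          Monoid.Coprod (FundamentalGroup (spaceUP₂ (bunch T ℓ)) y) (FreeGroup (Fin N)))) := by
  have hU := isPathConnected_spaceUP₂ hΓ
  obtain ⟨hc, hi, hN⟩ := freeProduct_decomposition (spaceUP₂_eq hΓ) hU hΓ.exists_adj
  exact ⟨⟨leafless_bunch hΓ, hasDisjointCycles_bunch hΓ⟩,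
    ⟨isNPC_UD₂ _, isWeaklySpecial_UD₂ _, isCompact_spaceUD₂ _, hc⟩, hU, isLocallyConvex_UP₂ hΓ,
    hi, hN⟩
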